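/- \textbf{Setting.} Consider a chain of $N\ge 1$ subsystems. For $1\le i\le N$ let $n_i,m_i\ge1$, $\Lambda_i^+=\mathrm{diag}(\lambda_i^k)$ with $0<\lambda_i^1<\dots<\lambda_i^{n_i}$, $\Lambda_i^-=\mathrm{diag}(\mu_i^\ell)$ with $0<\mu_i^1<\dots<\mu_i^{m_i}$, and let $\Sigma_i=\begin{pmatrix}\Sigma_i^{++}&\Sigma_i^{+-}\\ \Sigma_i^{-+}&\Sigma_i^{--}\end{pmatrix}$ be continuous on $[0,1]$ with zero diagonal. The state $(u_i,v_i)(t,x)\in\mathbb R^{n_i}\times\mathbb R^{m_i}$, $t\ge 0$, $x\in[0,1]$, satisfies $$\partial_tu_i+\Lambda_i^+\partial_xu_i=\Sigma_i^{++}u_i+\Sigma_i^{+-}v_i,\qquad \partial_tv_i-\Lambda_i^-\partial_xv_i=\Sigma_i^{-+}u_i+\Sigma_i^{--}v_i,$$ $$u_i(t,0)=Q_{i,i}v_i(t,0)+Q_{i,i-1}u_{i-1}(t,1),\qquad v_i(t,1)=R_{i,i}u_i(t,1)+R_{i,i+1}v_{i+1}(t,0),$$ where $Q_{1,0}u_0(t,1)$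 stands for the control $U(t)$ and $v_{N+1}\equiv0$. Solutions are functions continuous on $[0,\infty)\times[0,1]$ that satisfy the transport equations in integrated form along characteristics (this includes the $H^1$ solutions). Put $\tau_i=\frac1{\lambda_i^1}+\frac1{\mu_i^1}$, $\tau_0=0$, $\tau_{\max}=\max_r\tau_r$, $D_i=\sum_{k<i}\frac1{\lambda_k^1}$. Let $\Lambda_i=\mathrm{diag}(\Lambda_i^+,-\Lambda_i^-)$, and let $K_i=\begin{pmatrix}K_i^{uu}&K_i^{uv}\\K_i^{vu}&K_i^{vv}\end{pmatrix}$ (on $0\le x\le y\le1$) and, for $i<N$, $F_i$ (on $0\le x\le 1$, $0\le y\le x/\lambda_i^1$) be any bounded measurable solution, in integrated form along characteristics, of $$\Lambda_i\partial_xK_i+\partial_yK_i\Lambda_i=-K_i\Sigma_i(y)+\mathrm{diag}(G_i(x),0)K_i,\quad \Lambda_iK_i(x,x)-K_i(x,x)\Lambda_i=\Sigma_i(x)-\mathrm{diag}(G_i(x),0),$$ $$K_i^{uu}(x,1)\Lambda_i^+=K_i^{uv}(x,1)\Lambda_i^-R_{i,i},$$ $$\Lambda_i^+\partial_xF_i+\partial_yF_i=G_i(x)F_i,\quad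 F_i(x,0)=-K_i^{uv}(x,1)\Lambda_i^-R_{i,i+1},\quad (F_i(x,\tfrac{x}{\lambda_i^1}))_{k\ell}=0\ (k>1),$$ with boundary conditions for $0<x<1$, where $G_i$ is strictly upper triangular with entries $(\Sigma_i^{++})_{k\ell}(x)+(\lambda_i^\ell-\lambda_i^k)(K_i^{uu}(x,x))_{k\ell}$ for $k<\ell$. Define $$\alpha_i(t,x)=u_i(t,x)+\int_0^{x/\lambda_i^1}F_i(x,y)v_{i+1}(t-y,0)dy+\int_x^1\big(K_i^{uu}(x,y)u_i(t,y)+K_i^{uv}(x,y)v_i(t,y)\big)dy,$$ $$\beta_i(t,x)=v_i(t,x)+\int_x^1\big(K_i^{vu}(x,y)u_i(t,y)+K_i^{vv}(x,y)v_i(t,y)\big)dy$$ (the $F_N$ term being $0$), and the virtual inputs $\hat U_1=U$, $\hat U_i(t)=Q_{i,i-1}\alpha_{i-1}(t+D_i,1)$ for $i\ge2$. \textbf{Claim.} There are bounded measurable matrix functions $g_j^1,g_j^2,h_j^1,h_j^2,h_j^3$ of $\nu$, $\tilde G_j$ of $(x,\nu)$ and $L_j,H_j$ of $(x,y)$ ($1\le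 j\le N$), depending only on the system and on the kernels $K,F$, such that the following holds. (1) \emph{Time-delay representation.} For all controls $U$, all solutions, all $j$, all $s>\tau_{\max}$ and all $x\in[0,1]$, $$\alpha_j(s,0)=Q_{j,j}v_j(s,0)+p_j(s)+\int_0^{\tau_j}h_j^1(\nu)\alpha_j(s-\nu,0)d\nu+\int_0^{\tau_j}h_j^2(\nu)v_{j+1}(s-\nu,0)d\nu+\int_0^{\tau_{j-1}}h_j^3(\nu)v_j(s-\nu,0)d\nu,\tag{a}$$ with $p_1=U$ and $p_j(s)=Q_{j,j-1}\alpha_{j-1}(s,1)$ for $j\ge2$; $$\alpha_j^k(s,x)=\alpha_j^k(s-\tfrac{x}{\lambda_j^k},0)+\sum_{q>k}\int_0^{x/\lambda_j^k}(\tilde G_j(x,\nu))_{kq}\,\alpha_j^q(s-\nu,0)d\nu;\tag{b}$$ $$v_j^\ell(s,0)=\big(R_{j,j}\alpha_j(s-\tfrac1{\mu_j^\ell},1)+R_{j,j+1}v_{j+1}(s-\tfrac1{\mu_j^\ell},0)\big)_\ell+\int_0^{\tau_j}\big(g_j^1(\nu)\alpha_j(s-\nu,0)+g_j^2(\nu)v_{j+1}(s-\nu,0)\big)_\ell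 d\nu;\tag{c}$$ with $w_j(\sigma)=\alpha_j(\sigma,1)-\int_0^{1/\lambda_j^1}F_j(1,y)v_{j+1}(\sigma-y,0)dy$, $\bar G_j(x)=K_j^{vv}(x,1)\Lambda_j^-R_{j,j}-K_j^{vu}(x,1)\Lambda_j^+$ and $\bar f_j(x)=K_j^{vv}(x,1)\Lambda_j^-R_{j,j+1}$, $$\begin{aligned}\beta_j^\ell(s,x)=&\big(R_{j,j}w_j(s-\tfrac{1-x}{\mu_j^\ell})+R_{j,j+1}v_{j+1}(s-\tfrac{1-x}{\mu_j^\ell},0)\big)_\ell\\&+\int_0^{(1-x)/\mu_j^\ell}\big(\bar G_j(x+\mu_j^\ell\nu)w_j(s-\nu)+\bar f_j(x+\mu_j^\ell\nu)v_{j+1}(s-\nu,0)\big)_\ell d\nu;\end{aligned}\tag{d}$$ $$\begin{pmatrix}u_j\\v_j\end{pmatrix}(s,x)=\begin{pmatrix}\alpha_j\\\beta_j\end{pmatrix}(s,x)+\int_0^{1/\lambda_j^1}H_j(x,y)v_{j+1}(s-y,0)dy+\int_x^1L_j(x,y)\begin{pmatrix}\alpha_j\\\beta_j\end{pmatrix}(s,y)dy.\tag{e}$$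 (2) \emph{Prediction.} For each $i\in\{1,\dots,N\}$ there are predictors $P_{u_j},P_{v_j},P_{\alpha_j},P_{\beta_j}$, $j\ge i$, that are causal: their values at time $t$ depend only on the values on $[0,t]$ of the states $(u_r,v_r)$, $r\ge i$, and of the virtual input $\hat U_i$. For every solution, every $t>\tau_{\max}+D_i$, every $x\in[0,1]$ and every $j\in\{i,\dots,N\}$, $$P_{u_j}(t,x)=u_j(t+D_i,x),\quad P_{v_j}(t,x)=v_j(t+D_i,x),\quad P_{\alpha_j}(t,x)=\alpha_j(t+D_i,x),\quad P_{\beta_j}(t,x)=\beta_j(t+D_i,x).$$ (3) \emph{Form of the predictors.} In the situation of (2), consider functions $P_{\alpha_j^0}(t,s),P_{\alpha_j^1}(t,s),P_{v_j^0}(t,s)$, $j\ge i$, of $s\in[t-\tau_{\max}-D_i,t]$ (the first and third integrable in $s$, and $P_{v_{N+1}^0}=0$) such that: for $s\le t-D_i$ they are the known values $\alpha_j(s+D_i,0)$, $\alpha_j(s+D_i,1)$ (where defined, i.e. $s+D_i\ge 1/\lambda_j^1$) and $v_j(s+D_i,0)$; for $s>t-D_i$ they satisfy (a), (b) with $x=1$,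 and (c), with $\alpha_j(\cdot,0),\alpha_j(\cdot,1),v_j(\cdot,0)$ replaced by $P_{\alpha_j^0}(t,\cdot),P_{\alpha_j^1}(t,\cdot),P_{v_j^0}(t,\cdot)$ and, for $j=i$, $p_i(s)$ replaced by $\hat U_i(s)$. Such functions exist, and any such functions satisfy, for all $s\in[t-\tau_{\max}-D_i,t]$, $P_{\alpha_j^0}(t,s)=\alpha_j(s+D_i,0)$, $P_{v_j^0}(t,s)=v_j(s+D_i,0)$, and $P_{\alpha_j^1}(t,s)=\alpha_j(s+D_i,1)$ if $s+D_i\ge1/\lambda_j^1$. Moreover $P_{\alpha_j}(t,x)$, $P_{\beta_j}(t,x)$ are the right-hand sides of (b), (d) at $s=t$ evaluated on these functions, and $(P_{u_j},P_{v_j})(t,x)$ is the right-hand side of (e) evaluated on these functions and on $P_{\alpha_j}(t,\cdot),P_{\beta_j}(t,\cdot)$. -/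

import Mathlib

open Set MeasureTheory
open scoped Matrix

noncomputable section

/-- A chain of `N ≥ 1` linear hyperbolic systems.  Subsystems are numbered `0, …, N - 1`, subsystem
`0` being the actuated one.  All families are indexed by `ℕ` for convenience; entries with index
`≥ N` are never used by the definitions below.
`n i`, `m i` : numbers of rightward and leftward components;
`lam i`, `mu i` : velocities; `Sig i x` : the full in-domain coupling matrix, in block form
`[[Σ⁺⁺, Σ⁺⁻], [Σ⁻⁺, Σ⁻⁻]]`;
`Q i`, `R i` : the local reflection matrices `Q_{i,i}`, `R_{i,i}`;
`Qc i = Q_{i+1,i}` and `Rc i = R_{i,i+1}` : the couplings between subsystems `i` and `i + 1`. -/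
structure HyperbolicChain where
  N : ℕ
  N_pos : 0 < N
  n : ℕ → ℕ
  m : ℕ → ℕ
  n_pos : ∀ i, 0 < n i
  m_pos : ∀ i, 0 < m i
  lam : (i : ℕ) → Fin (n i) → ℝ
  mu : (i : ℕ) → Fin (m i) → ℝ
  lam_pos : ∀ i k, 0 < lam i k
  mu_pos : ∀ i l, 0 < mu i l
  lam_strictMono : ∀ i, StrictMono (lam i)
  mu_strictMono : ∀ i, StrictMono (mu i)
  Sig : (i : ℕ) → ℝ → Matrix (Fin (n i) ⊕ Fin (m i)) (Fin (n i) ⊕ Fin (m i)) ℝ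
  Sig_continuousOn : ∀ i a b, ContinuousOn (fun x => Sig i x a b) (Icc 0 1)
  Sig_diag : ∀ i, ∀ x ∈ Icc (0 : ℝ) 1, ∀ a, Sig i x a a = 0
  Q : (i : ℕ) → Matrix (Fin (n i)) (Fin (m i)) ℝ
  R : (i : ℕ) → Matrix (Fin (m i)) (Fin (n i)) ℝ
  Qc : (i : ℕ) → Matrix (Fin (n (i + 1))) (Fin (n i)) ℝ
  Rc : (i : ℕ) → Matrix (Fin (m i)) (Fin (m (i + 1))) ℝ

namespace HyperbolicChain

/-- Components of subsystem `i`: `inl k` for `u_i^k` (or `α_i^k`), `inr l` for `v_i^l`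
(or `β_i^l`). -/
abbrev Idx (C : HyperbolicChain) (i : ℕ) : Type := Fin (C.n i) ⊕ Fin (C.m i)

/-- The signed velocities, the diagonal of `Λ_i = diag (Λ_i⁺, -Λ_i⁻)`. -/
def speed (C : HyperbolicChain) (i : ℕ) : C.Idx i → ℝ :=
  Sum.elim (C.lam i) (fun l => - C.mu i l)

/-- The smallest rightward velocity `λ_i^1`. -/
def lam1 (C : HyperbolicChain) (i : ℕ) : ℝ := C.lam i ⟨0, C.n_pos i⟩

/-- The smallest leftward velocity `μ_i^1`. -/
def mu1 (C : HyperbolicChain) (i : ℕ) : ℝ := C.mu i ⟨0, C.m_pos i⟩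

/-- `τ_i = 1 / λ_i^1 + 1 / μ_i^1`. -/
def tau (C : HyperbolicChain) (i : ℕ) : ℝ := 1 / C.lam1 i + 1 / C.mu1 i

/-- `τ_{i-1}`, which is `0` for the first subsystem (there is no upstream subsystem). -/
def tauPrev (C : HyperbolicChain) : ℕ → ℝ
  | 0 => 0
  | i + 1 => C.tau i

/-- `max_r τ_r`, the maximum over all subsystems. -/
def tauMax (C : HyperbolicChain) : ℝ := ⨆ r : Fin C.N, C.tau r

/-- The prediction horizon of subsystem `i`, the sum of `1 / λ_k^1` over the subsystems `k`
upstream of `i`. -/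
def horizon (C : HyperbolicChain) (i : ℕ) : ℝ := ∑ k ∈ Finset.range i, 1 / C.lam1 k

/-- A family of states `w i t x = (u_i(t,x), v_i(t,x))` (or `(α_i(t,x), β_i(t,x))`). -/
abbrev State (C : HyperbolicChain) : Type := (i : ℕ) → ℝ → ℝ → C.Idx i → ℝ

/-- `v_i(t,0)`, with the convention that it vanishes beyond the last subsystem. -/
def vZero (C : HyperbolicChain) (w : C.State) (i : ℕ) (t : ℝ) : Fin (C.m i) → ℝ :=
  if i < C.N then fun l => w i t 0 (Sum.inr l) else 0

/-- `w = (u_i, v_i)_i` is a solution on `t ≥ 0` of the interconnected system with control input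
`U`: it is continuous on `[0,∞) × [0,1]`, satisfies the transport equations integrated along each
characteristic, and the boundary and interconnection conditions. -/
structure IsSolution (C : HyperbolicChain) (U : ℝ → Fin (C.n 0) → ℝ) (w : C.State) : Prop where
  continuousOn : ∀ i < C.N, ContinuousOn (fun p : ℝ × ℝ => w i p.1 p.2) (Ici 0 ×ˢ Icc 0 1)
  pde : ∀ i < C.N, ∀ a : C.Idx i, ∀ t x h : ℝ, 0 ≤ t → x ∈ Icc (0 : ℝ) 1 → 0 ≤ h →
    x + C.speed i a * h ∈ Icc (0 : ℝ) 1 →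
    w i (t + h) (x + C.speed i a * h) a - w i t x a =
      ∫ s in (0 : ℝ)..h,
        (C.Sig i (x + C.speed i a * s) *ᵥ w i (t + s) (x + C.speed i a * s)) a
  left_first : ∀ t, 0 ≤ t →
    (fun k => w 0 t 0 (Sum.inl k)) = C.Q 0 *ᵥ (fun l => w 0 t 0 (Sum.inr l)) + U t
  left_next : ∀ i, i + 1 < C.N → ∀ t, 0 ≤ t →
    (fun k => w (i + 1) t 0 (Sum.inl k)) =
      C.Q (i + 1) *ᵥ (fun l => w (i + 1) t 0 (Sum.inr l)) +
        C.Qc i *ᵥ (fun k => w i t 1 (Sum.inl k))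
  right : ∀ i < C.N, ∀ t, 0 ≤ t →
    (fun l => w i t 1 (Sum.inr l)) =
      C.R i *ᵥ (fun k => w i t 1 (Sum.inl k)) + C.Rc i *ᵥ C.vZero w (i + 1) t

/-- The kernels of the transformations: `K i x y = [[K^{uu}, K^{uv}], [K^{vu}, K^{vv}]]` and
`F i x y`. -/
structure Kernels (C : HyperbolicChain) where
  K : (i : ℕ) → ℝ → ℝ → Matrix (C.Idx i) (C.Idx i) ℝ
  F : (i : ℕ) → ℝ → ℝ → Matrix (Fin (C.n i)) (Fin (C.m (i + 1))) ℝ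

/-- The triangle `0 ≤ x ≤ y ≤ 1`, domain of `K_i`. -/
def triK : Set (ℝ × ℝ) := {p | 0 ≤ p.1 ∧ p.1 ≤ p.2 ∧ p.2 ≤ 1}

/-- The triangle `0 ≤ x ≤ 1`, `0 ≤ y ≤ x / λ_i^1`, domain of `F_i`. -/
def triF (C : HyperbolicChain) (i : ℕ) : Set (ℝ × ℝ) :=
  {p | 0 ≤ p.1 ∧ p.1 ≤ 1 ∧ 0 ≤ p.2 ∧ p.2 ≤ p.1 / C.lam1 i}

variable {C : HyperbolicChain}

/-- The strictly upper triangular matrix `G_i(x)`, with entries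
`Σ⁺⁺_{kl}(x) + (λ^l - λ^k) K^{uu}_{kl}(x,x)` for `k < l`. -/
def Kernels.G (ker : C.Kernels) (i : ℕ) (x : ℝ) : Matrix (Fin (C.n i)) (Fin (C.n i)) ℝ :=
  fun k l => if k < l then
    C.Sig i x (Sum.inl k) (Sum.inl l) +
      (C.lam i l - C.lam i k) * ker.K i x x (Sum.inl k) (Sum.inl l)
  else 0

/-- `diag (G_i(x), 0)`. -/
def Kernels.Gfull (ker : C.Kernels) (i : ℕ) (x : ℝ) : Matrix (C.Idx i) (C.Idx i) ℝ :=
  Matrix.fromBlocks (ker.G i x) 0 0 0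

/-- The kernel equations, for bounded measurable kernels:
`Λ ∂ₓK + ∂_yK Λ = - K Σ(y) + diag(G(x),0) K` and `Λ⁺ ∂ₓF + ∂_yF = G(x) F`, both integrated along
each characteristic inside the closed triangles, together with the boundary conditions on the sides
(corners excepted, where the conditions on two sides need not be compatible).  The values of
`K^{vv}` that are left free by these conditions are arbitrary. -/
structure Kernels.Solves (ker : C.Kernels) : Prop where
  K_measurable : ∀ i < C.N, ∀ a b, Measurable (fun p : ℝ × ℝ => ker.K i p.1 p.2 a b)
  K_bounded : ∀ i < C.N, ∃ M : ℝ, ∀ x y, (x, y) ∈ triK → ∀ a b, |ker.K i x y a b| ≤ M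
  K_pde : ∀ i < C.N, ∀ a b : C.Idx i, ∀ x y h : ℝ, (x, y) ∈ triK → 0 ≤ h →
    (x + C.speed i a * h, y + C.speed i b * h) ∈ triK →
    ker.K i (x + C.speed i a * h) (y + C.speed i b * h) a b - ker.K i x y a b =
      ∫ s in (0 : ℝ)..h,
        (-(ker.K i (x + C.speed i a * s) (y + C.speed i b * s) *
            C.Sig i (y + C.speed i b * s)) +
          ker.Gfull i (x + C.speed i a * s) *
            ker.K i (x + C.speed i a * s) (y + C.speed i b * s)) a b
  K_diag : ∀ i < C.N, ∀ x ∈ Ioo (0 : ℝ) 1,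
    Matrix.diagonal (C.speed i) * ker.K i x x - ker.K i x x * Matrix.diagonal (C.speed i) =
      C.Sig i x - ker.Gfull i x
  K_right : ∀ i < C.N, ∀ x ∈ Ioo (0 : ℝ) 1,
    (ker.K i x 1).toBlocks₁₁ * Matrix.diagonal (C.lam i) =
      (ker.K i x 1).toBlocks₁₂ * Matrix.diagonal (C.mu i) * C.R i
  F_measurable : ∀ i, i + 1 < C.N → ∀ k l, Measurable (fun p : ℝ × ℝ => ker.F i p.1 p.2 k l)
  F_bounded : ∀ i, i + 1 < C.N →
    ∃ M : ℝ, ∀ x y, (x, y) ∈ C.triF i → ∀ k l, |ker.F i x y k l| ≤ M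
  F_pde : ∀ i, i + 1 < C.N → ∀ k l, ∀ x y h : ℝ, (x, y) ∈ C.triF i → 0 ≤ h →
    (x + C.lam i k * h, y + h) ∈ C.triF i →
    ker.F i (x + C.lam i k * h) (y + h) k l - ker.F i x y k l =
      ∫ s in (0 : ℝ)..h,
        (ker.G i (x + C.lam i k * s) * ker.F i (x + C.lam i k * s) (y + s)) k l
  F_zero : ∀ i, i + 1 < C.N → ∀ x ∈ Ioo (0 : ℝ) 1,
    ker.F i x 0 = -((ker.K i x 1).toBlocks₁₂ * Matrix.diagonal (C.mu i) * C.Rc i)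
  F_side : ∀ i, i + 1 < C.N → ∀ x ∈ Ioo (0 : ℝ) 1,
    ∀ (k : Fin (C.n i)) (l : Fin (C.m (i + 1))), 0 < (k : ℕ) → ker.F i x (x / C.lam1 i) k l = 0

/-- The target state `(α_i(t,x), β_i(t,x))` obtained from `w = (u_i, v_i)` (meaningful for
`t ≥ x / λ_i^1`):
`α_i = u_i + ∫_0^{x/λ_i^1} F_i(x,y) v_{i+1}(t-y,0) dy + ∫_x^1 (K^{uu} u_i + K^{uv} v_i)(t,y) dy`,
`β_i = v_i + ∫_x^1 (K^{vu} u_i + K^{vv} v_i)(t,y) dy`. -/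
def Kernels.target (ker : C.Kernels) (w : C.State) : C.State := fun i t x =>
  Sum.elim
    (fun k => w i t x (Sum.inl k)
      + (∫ y in (0 : ℝ)..(x / C.lam1 i), (ker.F i x y *ᵥ C.vZero w (i + 1) (t - y)) k)
      + ∫ y in x..1, (ker.K i x y *ᵥ w i t y) (Sum.inl k))
    (fun l => w i t x (Sum.inr l) + ∫ y in x..1, (ker.K i x y *ᵥ w i t y) (Sum.inr l))

/-- The virtual input: `Û_i(t) = Q_{i,i-1} α_{i-1}(t + horizon i, 1)`, and `Û = U` for the first
subsystem. -/
def Kernels.virtualInput (ker : C.Kernels) (U : ℝ → Fin (C.n 0) → ℝ) (w : C.State) :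
    (i : ℕ) → ℝ → Fin (C.n i) → ℝ
  | 0 => U
  | i + 1 => fun t => C.Qc i *ᵥ fun k => ker.target w i (t + C.horizon (i + 1)) 1 (Sum.inl k)

/-- Three families of boundary signals, standing for `α_j(·,0)`, `α_j(·,1)` and `v_j(·,0)`. -/
structure Signals (C : HyperbolicChain) where
  a0 : (j : ℕ) → ℝ → Fin (C.n j) → ℝ
  a1 : (j : ℕ) → ℝ → Fin (C.n j) → ℝ
  v0 : (j : ℕ) → ℝ → Fin (C.m j) → ℝ

/-- The actual boundary signals of a trajectory. -/
def Kernels.signals (ker : C.Kernels) (w : C.State) : C.Signals where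
  a0 := fun j t k => ker.target w j t 0 (Sum.inl k)
  a1 := fun j t k => ker.target w j t 1 (Sum.inl k)
  v0 := fun j t => C.vZero w j t

/-- The coefficients of the time-delay representation of the network: `g¹_j, g²_j, h¹_j, h²_j, h³_j`
(functions of a delay `ν`), `G̃_j(x,ν)`, and the kernels `L_j(x,y)`, `H_j(x,y)` of the inverse
transformation. -/
structure DelayCoeff (C : HyperbolicChain) where
  g1 : (j : ℕ) → ℝ → Matrix (Fin (C.m j)) (Fin (C.n j)) ℝ
  g2 : (j : ℕ) → ℝ → Matrix (Fin (C.m j)) (Fin (C.m (j + 1))) ℝ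
  h1 : (j : ℕ) → ℝ → Matrix (Fin (C.n j)) (Fin (C.n j)) ℝ
  h2 : (j : ℕ) → ℝ → Matrix (Fin (C.n j)) (Fin (C.m (j + 1))) ℝ
  h3 : (j : ℕ) → ℝ → Matrix (Fin (C.n j)) (Fin (C.m j)) ℝ
  Gt : (j : ℕ) → ℝ → ℝ → Matrix (Fin (C.n j)) (Fin (C.n j)) ℝ
  L : (j : ℕ) → ℝ → ℝ → Matrix (C.Idx j) (C.Idx j) ℝ
  H : (j : ℕ) → ℝ → ℝ → Matrix (C.Idx j) (Fin (C.m (j + 1))) ℝ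

/-- A matrix-valued function of one variable with bounded measurable entries. -/
def BddMeas₁ {ι κ : Type} (f : ℝ → Matrix ι κ ℝ) : Prop :=
  ∀ a b, Measurable (fun s => f s a b) ∧ ∃ M : ℝ, ∀ s, |f s a b| ≤ M

/-- A matrix-valued function of two variables with bounded measurable entries. -/
def BddMeas₂ {ι κ : Type} (f : ℝ → ℝ → Matrix ι κ ℝ) : Prop :=
  ∀ a b, Measurable (fun p : ℝ × ℝ => f p.1 p.2 a b) ∧ ∃ M : ℝ, ∀ x y, |f x y a b| ≤ M

/-- All coefficients are bounded and measurable. -/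
def DelayCoeff.BddMeas (cf : C.DelayCoeff) : Prop :=
  ∀ j < C.N, BddMeas₁ (cf.g1 j) ∧ BddMeas₁ (cf.g2 j) ∧ BddMeas₁ (cf.h1 j) ∧ BddMeas₁ (cf.h2 j) ∧
    BddMeas₁ (cf.h3 j) ∧ BddMeas₂ (cf.Gt j) ∧ BddMeas₂ (cf.L j) ∧ BddMeas₂ (cf.H j)

/-- Right-hand side of the integral-delay equation of `α_j(s,0)`, where `p` is the contribution
`Q_{j,j-1} α_{j-1}(s,1)` of the upstream subsystem. -/
def DelayCoeff.eqA0 (cf : C.DelayCoeff) (B : C.Signals) (j : ℕ) (p : Fin (C.n j) → ℝ) (s : ℝ) :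
    Fin (C.n j) → ℝ := fun k =>
  (C.Q j *ᵥ B.v0 j s) k + p k
    + (∫ ν in (0 : ℝ)..C.tau j, (cf.h1 j ν *ᵥ B.a0 j (s - ν)) k)
    + (∫ ν in (0 : ℝ)..C.tau j, (cf.h2 j ν *ᵥ B.v0 (j + 1) (s - ν)) k)
    + (∫ ν in (0 : ℝ)..C.tauPrev j, (cf.h3 j ν *ᵥ B.v0 j (s - ν)) k)

/-- Right-hand side of the integral-delay equation of `α_j(s,x)` in terms of `α_j(·,0)`. -/
def DelayCoeff.eqA (cf : C.DelayCoeff) (B : C.Signals) (j : ℕ) (s x : ℝ) :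
    Fin (C.n j) → ℝ := fun k =>
  B.a0 j (s - x / C.lam j k) k
    + ∑ q with k < q, ∫ ν in (0 : ℝ)..(x / C.lam j k), cf.Gt j x ν k q * B.a0 j (s - ν) q

/-- Right-hand side of the integral-delay equation of `v_j(s,0)`. -/
def DelayCoeff.eqV0 (cf : C.DelayCoeff) (B : C.Signals) (j : ℕ) (s : ℝ) :
    Fin (C.m j) → ℝ := fun l =>
  (C.R j *ᵥ B.a1 j (s - 1 / C.mu j l)) l + (C.Rc j *ᵥ B.v0 (j + 1) (s - 1 / C.mu j l)) l
    + (∫ ν in (0 : ℝ)..C.tau j, (cf.g1 j ν *ᵥ B.a0 j (s - ν)) l)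
    + (∫ ν in (0 : ℝ)..C.tau j, (cf.g2 j ν *ᵥ B.v0 (j + 1) (s - ν)) l)

/-- `Ḡ_j(x) = K^{vv}(x,1) Λ⁻ R_{j,j} - K^{vu}(x,1) Λ⁺`. -/
def Kernels.Gbar (ker : C.Kernels) (j : ℕ) (x : ℝ) : Matrix (Fin (C.m j)) (Fin (C.n j)) ℝ :=
  (ker.K j x 1).toBlocks₂₂ * Matrix.diagonal (C.mu j) * C.R j
    - (ker.K j x 1).toBlocks₂₁ * Matrix.diagonal (C.lam j)

/-- `f̄_j(x) = K^{vv}(x,1) Λ⁻ R_{j,j+1}`. -/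
def Kernels.fbar (ker : C.Kernels) (j : ℕ) (x : ℝ) :
    Matrix (Fin (C.m j)) (Fin (C.m (j + 1))) ℝ :=
  (ker.K j x 1).toBlocks₂₂ * Matrix.diagonal (C.mu j) * C.Rc j

/-- `u_j(s,1) = α_j(s,1) - ∫_0^{1/λ_j^1} F_j(1,y) v_{j+1}(s-y,0) dy`. -/
def Kernels.uOne (ker : C.Kernels) (B : C.Signals) (j : ℕ) (s : ℝ) : Fin (C.n j) → ℝ := fun k =>
  B.a1 j s k - ∫ y in (0 : ℝ)..(1 / C.lam1 j), (ker.F j 1 y *ᵥ B.v0 (j + 1) (s - y)) k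

/-- `β_j(s,x)` in terms of the boundary signals, by the method of characteristics. -/
def Kernels.eqB (ker : C.Kernels) (B : C.Signals) (j : ℕ) (s x : ℝ) : Fin (C.m j) → ℝ := fun l =>
  (C.R j *ᵥ ker.uOne B j (s - (1 - x) / C.mu j l)) l
    + (C.Rc j *ᵥ B.v0 (j + 1) (s - (1 - x) / C.mu j l)) l
    + (∫ ν in (0 : ℝ)..((1 - x) / C.mu j l),
        (ker.Gbar j (x + C.mu j l * ν) *ᵥ ker.uOne B j (s - ν)) l)
    + (∫ ν in (0 : ℝ)..((1 - x) / C.mu j l),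
        (ker.fbar j (x + C.mu j l * ν) *ᵥ B.v0 (j + 1) (s - ν)) l)

/-- `(α_j(s,x), β_j(s,x))` reconstructed from the boundary signals. -/
def reconstructTarget (ker : C.Kernels) (cf : C.DelayCoeff) (B : C.Signals) (j : ℕ) (s x : ℝ) :
    C.Idx j → ℝ :=
  Sum.elim (cf.eqA B j s x) (ker.eqB B j s x)

/-- The inverse transformation, applied to a profile `z y = (α_j(s,y), β_j(s,y))`:
`z(x) + ∫_0^{1/λ_j^1} H_j(x,y) v_{j+1}(s-y,0) dy + ∫_x^1 L_j(x,y) z(y) dy`. -/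
def DelayCoeff.inverse (cf : C.DelayCoeff) (B : C.Signals) (j : ℕ) (s : ℝ)
    (z : ℝ → C.Idx j → ℝ) (x : ℝ) : C.Idx j → ℝ := fun a =>
  z x a + (∫ y in (0 : ℝ)..(1 / C.lam1 j), (cf.H j x y *ᵥ B.v0 (j + 1) (s - y)) a)
    + ∫ y in x..1, (cf.L j x y *ᵥ z y) a

/-- `(u_j(s,x), v_j(s,x))` reconstructed from the boundary signals. -/
def reconstructState (ker : C.Kernels) (cf : C.DelayCoeff) (B : C.Signals) (j : ℕ) (s x : ℝ) :
    C.Idx j → ℝ :=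
  cf.inverse B j s (fun y => reconstructTarget ker cf B j s y) x

/-- The time-delay representation of the network, along the solution `w` with control `U`: for
times larger than `max_r τ_r` the boundary signals satisfy the integral-delay equations, and the
states are recovered from them. -/
structure DelayRepresentation (ker : C.Kernels) (cf : C.DelayCoeff)
    (U : ℝ → Fin (C.n 0) → ℝ) (w : C.State) : Prop where
  a0_first : ∀ s, C.tauMax < s →
    (ker.signals w).a0 0 s = cf.eqA0 (ker.signals w) 0 (U s) s
  a0_next : ∀ j, j + 1 < C.N → ∀ s, C.tauMax < s →
    (ker.signals w).a0 (j + 1) s =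
      cf.eqA0 (ker.signals w) (j + 1) (C.Qc j *ᵥ (ker.signals w).a1 j s) s
  v0 : ∀ j < C.N, ∀ s, C.tauMax < s → (ker.signals w).v0 j s = cf.eqV0 (ker.signals w) j s
  target : ∀ j < C.N, ∀ s, C.tauMax < s → ∀ x ∈ Icc (0 : ℝ) 1,
    ker.target w j s x = reconstructTarget ker cf (ker.signals w) j s x
  state : ∀ j < C.N, ∀ s, C.tauMax < s → ∀ x ∈ Icc (0 : ℝ) 1,
    w j s x = cf.inverse (ker.signals w) j s (fun y => ker.target w j s y) x

/-- `P` consists of the predictors `P_{α_j^0}(t,s)`, `P_{α_j^1}(t,s)`, `P_{v_j^0}(t,s)`, `j ≥ i`,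
computed at time `t` from the state trajectory `w` and the virtual input `V = Û_i`, as functions of
`s ∈ [t - max_r τ_r - horizon i, t]`: for `s ≤ t - horizon i` they are values of the state known at
time `t`, and for `s > t - horizon i` they obey the integral-delay recursion, in which
`Q_{i,i-1} P_{α_{i-1}^1}(t,s)` is replaced by `V s`.  (`α_j(σ,1)` is defined for
`σ ≥ 1 / λ_j^1` only.) -/
structure IsPrediction (ker : C.Kernels) (cf : C.DelayCoeff) (i : ℕ) (w : C.State)
    (V : ℝ → Fin (C.n i) → ℝ) (t : ℝ) (P : C.Signals) : Prop where
  a0_integrable : ∀ j, i ≤ j → j < C.N → ∀ k,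
    IntegrableOn (fun s => P.a0 j s k) (Icc (t - C.tauMax - C.horizon i) t)
  v0_integrable : ∀ j, i ≤ j → j < C.N → ∀ l,
    IntegrableOn (fun s => P.v0 j s l) (Icc (t - C.tauMax - C.horizon i) t)
  v0_end : ∀ s ∈ Icc (t - C.tauMax - C.horizon i) t, P.v0 C.N s = 0
  a0_past : ∀ j, i ≤ j → j < C.N →
    ∀ s ∈ Icc (t - C.tauMax - C.horizon i) (t - C.horizon i),
      P.a0 j s = (ker.signals w).a0 j (s + C.horizon i)
  a1_past : ∀ j, i ≤ j → j < C.N →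
    ∀ s ∈ Icc (t - C.tauMax - C.horizon i) (t - C.horizon i), 1 / C.lam1 j ≤ s + C.horizon i →
      P.a1 j s = (ker.signals w).a1 j (s + C.horizon i)
  v0_past : ∀ j, i ≤ j → j < C.N →
    ∀ s ∈ Icc (t - C.tauMax - C.horizon i) (t - C.horizon i),
      P.v0 j s = (ker.signals w).v0 j (s + C.horizon i)
  a0_first : ∀ s ∈ Ioc (t - C.horizon i) t, P.a0 i s = cf.eqA0 P i (V s) s
  a0_next : ∀ j, i ≤ j → j + 1 < C.N → ∀ s ∈ Ioc (t - C.horizon i) t,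
    P.a0 (j + 1) s = cf.eqA0 P (j + 1) (C.Qc j *ᵥ P.a1 j s) s
  a1_eq : ∀ j, i ≤ j → j < C.N → ∀ s ∈ Ioc (t - C.horizon i) t, P.a1 j s = cf.eqA P j s 1
  v0_eq : ∀ j, i ≤ j → j < C.N → ∀ s ∈ Ioc (t - C.horizon i) t, P.v0 j s = cf.eqV0 P j s

/-- The predictors in `P` are exact: they are the boundary signals `horizon i` ahead of time. -/
def IsExact (ker : C.Kernels) (i : ℕ) (w : C.State) (t : ℝ) (P : C.Signals) : Prop :=
  ∀ j, i ≤ j → j < C.N → ∀ s ∈ Icc (t - C.tauMax - C.horizon i) t,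
    P.a0 j s = (ker.signals w).a0 j (s + C.horizon i) ∧
    (1 / C.lam1 j ≤ s + C.horizon i → P.a1 j s = (ker.signals w).a1 j (s + C.horizon i)) ∧
    P.v0 j s = (ker.signals w).v0 j (s + C.horizon i)

/-- A predictor for the subsystems `j ≥ i` maps a state trajectory and a virtual input signal to
predicted values at `(j, t, x)`. -/
abbrev Predictor (C : HyperbolicChain) (i : ℕ) : Type :=
  C.State → (ℝ → Fin (C.n i) → ℝ) → C.State

/-- The value of the predictor at time `t` depends only on the values, at times in `[0,t]`, of the
states of the subsystems `j ≥ i` and of the virtual input. -/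
def Causal (i : ℕ) (Pr : C.Predictor i) : Prop :=
  ∀ (t : ℝ) (w w' : C.State) (V V' : ℝ → Fin (C.n i) → ℝ),
    (∀ j, i ≤ j → j < C.N → ∀ s ∈ Icc 0 t, ∀ x ∈ Icc (0 : ℝ) 1, w j s x = w' j s x) →
    (∀ s ∈ Icc 0 t, V s = V' s) →
    ∀ j, i ≤ j → j < C.N → ∀ x ∈ Icc (0 : ℝ) 1, Pr w V j t x = Pr w' V' j t x

end HyperbolicChain

end

/-- A bounded measurable real function. -/
def BdMeas {α : Type*} [MeasurableSpace α] (f : α → ℝ) : Prop :=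
  Measurable f ∧ ∃ M : ℝ, ∀ x, |f x| ≤ M

namespace BdMeas

variable {α β : Type*} [MeasurableSpace α] [MeasurableSpace β] {f g : α → ℝ}

lemma exists_pos_bound (hf : BdMeas f) : ∃ M : ℝ, 0 < M ∧ ∀ x, |f x| ≤ M := by
  obtain ⟨M, hM⟩ := hf.2
  exact ⟨max M 1, lt_max_of_lt_right one_pos, fun x => (hM x).trans (le_max_left _ _)⟩

lemma const (c : ℝ) : BdMeas (fun _ : α => c) := ⟨measurable_const, |c|, fun _ => le_rfl⟩

lemma neg (hf : BdMeas f) : BdMeas (fun x => - f x) := by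
  obtain ⟨M, hM⟩ := hf.2
  exact ⟨hf.1.neg, M, fun x => by simpa using hM x⟩

lemma add (hf : BdMeas f) (hg : BdMeas g) : BdMeas (fun x => f x + g x) := by
  obtain ⟨M, hM⟩ := hf.2
  obtain ⟨M', hM'⟩ := hg.2
  exact ⟨hf.1.add hg.1, M + M', fun x => (abs_add_le _ _).trans (add_le_add (hM x) (hM' x))⟩

lemma sub (hf : BdMeas f) (hg : BdMeas g) : BdMeas (fun x => f x - g x) := by
  simpa only [sub_eq_add_neg] using hf.add hg.neg

lemma mul (hf : BdMeas f) (hg : BdMeas g) : BdMeas (fun x => f x * g x) := by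
  obtain ⟨M, h0, hM⟩ := hf.exists_pos_bound
  obtain ⟨M', hM'⟩ := hg.2
  refine ⟨hf.1.mul hg.1, M * M', fun x => ?_⟩
  rw [abs_mul]
  exact mul_le_mul (hM x) (hM' x) (abs_nonneg _) h0.le

lemma const_mul (c : ℝ) (hf : BdMeas f) : BdMeas (fun x => c * f x) := (const c).mul hf

lemma sum {ι : Type*} (s : Finset ι) {f : ι → α → ℝ} (hf : ∀ i ∈ s, BdMeas (f i)) :
    BdMeas (fun x => ∑ i ∈ s, f i x) := by
  classical
  induction s using Finset.induction_on with
  | empty => simpa using const 0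
  | insert i s hi ih =>
    simp only [Finset.sum_insert hi]
    exact (hf i (Finset.mem_insert_self _ _)).add
      (ih fun j hj => hf j (Finset.mem_insert_of_mem hj))

lemma comp (hf : BdMeas f) {e : β → α} (he : Measurable e) : BdMeas (fun y => f (e y)) := by
  obtain ⟨M, hM⟩ := hf.2
  exact ⟨hf.1.comp he, M, fun y => hM _⟩

lemma comp₂ {f : ℝ → ℝ → ℝ} (hf : BdMeas (fun p : ℝ × ℝ => f p.1 p.2)) {e e' : β → ℝ}
    (he : Measurable e) (he' : Measurable e') : BdMeas (fun y => f (e y) (e' y)) :=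
  hf.comp (he.prodMk he')

lemma ite_zero (hf : BdMeas f) {p : α → Prop} [DecidablePred p] (hp : MeasurableSet {x | p x}) :
    BdMeas (fun x => if p x then f x else 0) := by
  obtain ⟨M, h0, hM⟩ := hf.exists_pos_bound
  refine ⟨Measurable.ite hp hf.1 measurable_const, M, fun x => ?_⟩
  dsimp only
  split_ifs
  · exact hM x
  · simpa using h0.le

lemma of_eqOn_zero {s : Set α} (hf : Measurable f) {M : ℝ}
    (hM : ∀ x ∈ s, |f x| ≤ M) (h0 : ∀ x ∉ s, f x = 0) : BdMeas f := by
  refine ⟨hf, max M 0, fun x => ?_⟩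
  by_cases hx : x ∈ s
  · exact (hM x hx).trans (le_max_left _ _)
  · simp [h0 x hx]

lemma intervalIntegrable {f : ℝ → ℝ} (hf : BdMeas f) (a b : ℝ) :
    IntervalIntegrable f volume a b := by
  obtain ⟨M, hM⟩ := hf.2
  refine (intervalIntegrable_const (c := M)).mono_fun' hf.1.aestronglyMeasurable ?_
  exact Filter.Eventually.of_forall fun x => by simpa using hM x

lemma integrable {f : ℝ → ℝ} (hf : BdMeas f) {a b : ℝ} (h0 : ∀ x ∉ Icc a b, f x = 0) :
    Integrable f := by
  obtain ⟨M, hM⟩ := hf.2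
  have : IntegrableOn f (Icc a b) :=
    Integrable.mono' (integrableOn_const (C := M) (by simp)) hf.1.aestronglyMeasurable
      (Filter.Eventually.of_forall fun x => by simpa using hM x)
  exact this.integrable_of_forall_notMem_eq_zero h0

/-- Integrals over a bounded set, depending on a parameter. -/
lemma integral {f : α → ℝ → ℝ} (hf : BdMeas (fun p : α × ℝ => f p.1 p.2)) {a b : ℝ}
    (h0 : ∀ x, ∀ y ∉ Icc a b, f x y = 0) : BdMeas (fun x => ∫ y, f x y) := by
  obtain ⟨M, hM0, hM⟩ := hf.exists_pos_bound
  refine ⟨?_, M * (volume (Icc a b)).toReal, fun x => ?_⟩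
  · exact (StronglyMeasurable.integral_prod_right (f := f) hf.1.stronglyMeasurable).measurable
  · dsimp only
    rw [← setIntegral_eq_integral_of_forall_compl_eq_zero (h0 x), ← Real.norm_eq_abs]
    exact norm_setIntegral_le_of_norm_le_const (by simp) fun y _ => hM (x, y)

lemma intervalIntegral {f : α → ℝ → ℝ} (hf : BdMeas (fun p : α × ℝ => f p.1 p.2)) (a b : ℝ) :
    BdMeas (fun x => ∫ y in a..b, f x y) := by
  have key : ∀ c d : ℝ, BdMeas (fun x => ∫ y in Ioc c d, f x y) := by
    intro c d
    have := BdMeas.integral (f := fun x y => (Ioc c d).indicator (f x) y) (a := c) (b := d) ?_ ?_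
    · simpa only [integral_indicator measurableSet_Ioc] using this
    · have h := hf.ite_zero (p := fun p => p.2 ∈ Ioc c d) (measurable_snd measurableSet_Ioc)
      convert h using 2 with p
      by_cases hp : p.2 ∈ Ioc c d <;> simp only [indicator, hp, if_true, if_false]
    · intro x y hy
      exact indicator_of_notMem (fun h => hy (Ioc_subset_Icc_self h)) _
  exact (key a b).sub (key b a)

lemma intervalIntegral_swap {f : ℝ → ℝ → ℝ} (hf : BdMeas (fun p : ℝ × ℝ => f p.1 p.2))
    {a b c d : ℝ} (hab : a ≤ b) (hcd : c ≤ d) :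
    ∫ x in a..b, ∫ y in c..d, f x y = ∫ y in c..d, ∫ x in a..b, f x y := by
  simp only [intervalIntegral.integral_of_le hab, intervalIntegral.integral_of_le hcd]
  obtain ⟨M, hM⟩ := hf.2
  refine integral_integral_swap (Integrable.mono' (integrable_const M) hf.1.aestronglyMeasurable
    (Filter.Eventually.of_forall fun x => by simpa [Function.uncurry] using hM x))

end BdMeas

lemma intervalIntegral_eq_integral_of_eq_zero {f : ℝ → ℝ} {a b : ℝ} (hab : a ≤ b)
    (h0 : ∀ x ∉ Icc a b, f x = 0) : ∫ x in a..b, f x = ∫ x, f x := by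
  rw [intervalIntegral.integral_of_le hab, ← integral_Icc_eq_integral_Ioc]
  exact setIntegral_eq_integral_of_forall_compl_eq_zero h0

lemma intervalIntegral_eq_intervalIntegral_of_eq_zero {f g : ℝ → ℝ} {a b c d : ℝ}
    (hca : c ≤ a) (hab : a ≤ b) (hbd : b ≤ d) (hfg : ∀ x ∈ Icc a b, f x = g x)
    (h0 : ∀ x ∉ Icc a b, g x = 0) : ∫ x in a..b, f x = ∫ x in c..d, g x := by
  rw [intervalIntegral_eq_integral_of_eq_zero (hca.trans (hab.trans hbd))
    (fun x hx => h0 x fun h => hx ⟨hca.trans h.1, h.2.trans hbd⟩),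
    ← intervalIntegral_eq_integral_of_eq_zero hab h0]
  exact intervalIntegral.integral_congr fun x hx => hfg x (by rwa [uIcc_of_le hab] at hx)

/-- The product rule for functions given as integrals of bounded functions. -/
lemma mul_sub_mul_eq_integral {p q p' q' : ℝ → ℝ} {a b : ℝ} (hab : a ≤ b)
    (hp' : IntervalIntegrable p' volume a b) (hq' : IntervalIntegrable q' volume a b)
    (hp : ∀ s ∈ Icc a b, p s - p a = ∫ r in a..s, p' r)
    (hq : ∀ s ∈ Icc a b, q s - q a = ∫ r in a..s, q' r) :
    p b * q b - p a * q a = ∫ r in a..b, (p' r * q r + p r * q' r) := by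
  have ab : a ∈ uIcc a b := by simp
  have hac : ∀ {u u' : ℝ → ℝ}, IntervalIntegrable u' volume a b →
      (∀ s ∈ Icc a b, u s - u a = ∫ r in a..s, u' r) →
      AbsolutelyContinuousOnInterval (fun s => u a + ∫ r in a..s, u' r) a b ∧
      (∀ s ∈ uIcc a b, u a + ∫ r in a..s, u' r = u s) ∧
      ∀ᵐ s, s ∈ uIcc a b → deriv (fun s => u a + ∫ r in a..s, u' r) s = u' s := by
    intro u u' hu' hu
    refine ⟨?_, ?_, ?_⟩
    · have hc : AbsolutelyContinuousOnInterval (fun _ : ℝ => u a) a b :=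
        ((LipschitzWith.const (u a)).lipschitzOnWith (s := uIcc a b)).absolutelyContinuousOnInterval
      exact hc.fun_add (hu'.absolutelyContinuousOnInterval_intervalIntegral ab)
    · intro s hs
      rw [uIcc_of_le hab] at hs
      linarith [hu s hs]
    · filter_upwards [hu'.ae_hasDerivAt_integral] with s hs hs'
      exact ((hs hs' a ab).const_add (u a)).deriv
  obtain ⟨p1, p2, p3⟩ := hac hp' hp
  obtain ⟨q1, q2, q3⟩ := hac hq' hq
  have key := p1.integral_deriv_mul_eq_sub q1
  simp only [p2 b (by simp), p2 a ab, q2 b (by simp), q2 a ab] at key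
  rw [← key]
  apply intervalIntegral.integral_congr_ae
  filter_upwards [p3, q3] with s h1 h2 hs
  have hs' := uIoc_subset_uIcc hs
  rw [h1 hs', h2 hs', p2 s hs', q2 s hs']

set_option maxHeartbeats 1000000 in
/-- Divergence theorem on the trapezoid `0 ≤ r ≤ h`, `A + m r ≤ η ≤ B + n r` for a function that is
only absolutely continuous in `r`. -/
theorem integral_moving_interval {φ ψ : ℝ → ℝ → ℝ} {A B m n h : ℝ} (hh : 0 ≤ h) (hAB : A ≤ B)
    (hABh : A + m * h ≤ B + n * h) (hφ : BdMeas (fun p : ℝ × ℝ => φ p.1 p.2))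
    (hψ : BdMeas (fun p : ℝ × ℝ => ψ p.1 p.2))
    (hinc : ∀ η r₁ r₂, 0 ≤ r₁ → r₁ ≤ r₂ → r₂ ≤ h → A + m * r₁ ≤ η → η ≤ B + n * r₁ →
      A + m * r₂ ≤ η → η ≤ B + n * r₂ → φ r₂ η - φ r₁ η = ∫ r in r₁..r₂, ψ r η) :
    (∫ η in (A + m * h)..(B + n * h), φ h η) - ∫ η in A..B, φ 0 η =
      (∫ r in (0 : ℝ)..h, ∫ η in (A + m * r)..(B + n * r), ψ r η)
        + n * (∫ r in (0 : ℝ)..h, φ r (B + n * r)) - m * ∫ r in (0 : ℝ)..h, φ r (A + m * r) := by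
  classical
  set T : ℝ → Set ℝ := fun η => {r | r ∈ Icc 0 h ∧ A + m * r ≤ η ∧ η ≤ B + n * r} with hT
  set U : ℝ → ℝ := fun η => sSup (T η) with hU
  set V : ℝ → ℝ := fun η => sInf (T η) with hV
  set p₀ := min A (A + m * h) with hp₀
  set p₁ := max B (B + n * h) with hp₁
  have hle : ∀ r ∈ Icc 0 h, A + m * r ≤ B + n * r := by
    intro r hr
    rcases hh.eq_or_lt with rfl | hpos
    · have : r = 0 := le_antisymm hr.2 hr.1
      simpa [this] using hAB
    · have h1 : 0 ≤ (h - r) * (B - A) := mul_nonneg (by linarith [hr.2]) (by linarith)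
      have h2 : 0 ≤ r * (B + n * h - (A + m * h)) := mul_nonneg hr.1 (by linarith)
      have h3 : 0 ≤ h * (B + n * r - (A + m * r)) := by nlinarith
      have := nonneg_of_mul_nonneg_right h3 hpos
      linarith
  have hlow : ∀ r ∈ Icc 0 h, p₀ ≤ A + m * r := by
    intro r hr
    rcases le_total 0 m with hm | hm
    · exact (min_le_left _ _).trans (by nlinarith [hr.1])
    · exact (min_le_right _ _).trans (by nlinarith [hr.2])
  have hupp : ∀ r ∈ Icc 0 h, B + n * r ≤ p₁ := by
    intro r hr
    rcases le_total 0 n with hm | hm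
    · exact le_trans (by nlinarith [hr.2]) (le_max_right _ _)
    · exact le_trans (by nlinarith [hr.1]) (le_max_left _ _)
  have hbdd : ∀ η, BddAbove (T η) := fun η => ⟨h, fun r hr => hr.1.2⟩
  have hbdd' : ∀ η, BddBelow (T η) := fun η => ⟨0, fun r hr => hr.1.1⟩
  have hconv : ∀ η, (T η).OrdConnected := by
    intro η
    have e : T η = Icc 0 h ∩ ({r | m * r ≤ η - A} ∩ {r | η - B ≤ n * r}) := by
      ext r; simp only [hT, mem_ofPred_eq, mem_inter_iff]
      constructor
      · rintro ⟨h1, h2, h3⟩; exact ⟨h1, by linarith, by linarith⟩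
      · rintro ⟨h1, h2, h3⟩; exact ⟨h1, by linarith, by linarith⟩
    have hc : Convex ℝ (T η) := by
      rw [e]
      exact (convex_Icc 0 h).inter
        ((convex_halfSpace_le (IsLinearMap.isLinearMap_smul m) _).inter
        (convex_halfSpace_ge (IsLinearMap.isLinearMap_smul n) _))
    exact hc.ordConnected
  have hclosed : ∀ η, IsClosed (T η) := by
    intro η
    simp only [hT, Set.ofPred_and]
    exact isClosed_Icc.inter ((isClosed_le (by fun_prop) (by fun_prop)).inter
      (isClosed_le (by fun_prop) (by fun_prop)))
  have hTeq : ∀ η, (T η).Nonempty → T η = Icc (V η) (U η) := by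
    intro η hne
    have hc : IsCompact (T η) := isCompact_Icc.of_isClosed_subset (hclosed η) fun r hr => hr.1
    exact eq_Icc_of_connected_compact ⟨hne, (hconv η).isPreconnected⟩ hc
  have hexit : 0 < m → ∀ r ∈ Icc 0 h, IsGreatest (T (A + m * r)) r := fun hm r hr =>
    ⟨⟨hr, le_rfl, hle r hr⟩, fun r' hr' => by
      have := hr'.2.1
      exact le_of_mul_le_mul_left (by linarith) hm⟩
  have hentry : m < 0 → ∀ r ∈ Icc 0 h, IsLeast (T (A + m * r)) r := fun hm r hr =>
    ⟨⟨hr, le_rfl, hle r hr⟩, fun r' hr' => by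
      have := hr'.2.1
      nlinarith⟩
  have hexit' : n < 0 → ∀ r ∈ Icc 0 h, IsGreatest (T (B + n * r)) r := fun hm r hr =>
    ⟨⟨hr, hle r hr, le_rfl⟩, fun r' hr' => by
      have := hr'.2.2
      nlinarith⟩
  have hentry' : 0 < n → ∀ r ∈ Icc 0 h, IsLeast (T (B + n * r)) r := fun hm r hr =>
    ⟨⟨hr, hle r hr, le_rfl⟩, fun r' hr' => by
      have := hr'.2.2
      exact le_of_mul_le_mul_left (by linarith) hm⟩
  have hfin : ∀ η ∈ Icc (A + m * h) (B + n * h), IsGreatest (T η) h := fun η hη =>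
    ⟨⟨⟨hh, le_rfl⟩, hη.1, hη.2⟩, fun r' hr' => hr'.1.2⟩
  have hini : ∀ η ∈ Icc A B, IsLeast (T η) 0 := fun η hη =>
    ⟨⟨⟨le_rfl, hh⟩, by simpa using hη.1, by simpa using hη.2⟩, fun r' hr' => hr'.1.1⟩
  -- integration along a moving endpoint
  have hsub : ∀ (A m : ℝ) (u : ℝ → ℝ), 0 ≤ h → m ≠ 0 →
      (∀ r ∈ Icc 0 h, u (A + m * r) = r) →
      IntervalIntegrable (fun η => φ (u η) η) volume A (A + m * h) ∧
      ∫ η in A..(A + m * h), φ (u η) η = m * ∫ r in (0 : ℝ)..h, φ r (A + m * r) := by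
    intro A m u hh hm hu
    have hg : BdMeas (fun η => φ ((η - A) / m) η) :=
      hφ.comp₂ (by fun_prop) measurable_id
    have hmem : ∀ η ∈ uIcc A (A + m * h), u η = (η - A) / m := by
      intro η hη
      have h1 : (η - A) / m ∈ Icc 0 h := by
        rcases lt_or_gt_of_ne hm with hm' | hm'
        · rw [uIcc_of_ge (by nlinarith)] at hη
          exact ⟨div_nonneg_of_nonpos (by linarith [hη.2]) hm'.le,
            (div_le_iff_of_neg hm').2 (by linarith [hη.1])⟩
        · rw [uIcc_of_le (by nlinarith)] at hη
          exact ⟨div_nonneg (by linarith [hη.1]) hm'.le,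
            (div_le_iff₀ hm').2 (by linarith [hη.2])⟩
      have h2 : A + m * ((η - A) / m) = η := by field_simp; ring
      have := hu _ h1
      rwa [h2] at this
    have hcongr : ∀ η ∈ uIcc A (A + m * h), φ ((η - A) / m) η = φ (u η) η := fun η hη => by
      rw [hmem η hη]
    refine ⟨(hg.intervalIntegrable _ _).congr fun η hη => hcongr η (uIoc_subset_uIcc hη), ?_⟩
    rw [← intervalIntegral.integral_congr hcongr]
    have := intervalIntegral.smul_integral_comp_add_mul (a := 0) (b := h)
      (fun η => φ ((η - A) / m) η) m A
    simp only [mul_zero, add_zero, smul_eq_mul] at this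
    rw [← this]
    congr 1
    refine intervalIntegral.integral_congr fun r _ => ?_
    simp [hm]
  -- the values at the upper and at the lower end of the slices
  have Upiece : ∀ η t, IsGreatest (T η) t → U η = t := fun η t ht => ht.csSup_eq
  have Vpiece : ∀ η t, IsLeast (T η) t → V η = t := fun η t ht => ht.csInf_eq
  have hm0 : A + m * h ∈ Icc p₀ p₁ :=
    ⟨min_le_right _ _, hABh.trans (le_max_right _ _)⟩
  have huI : ∀ {a b : ℝ} {u : ℝ → ℝ} {t : ℝ}, a ≤ b → (∀ η ∈ Icc a b, u η = t) →
      IntervalIntegrable (fun η => φ (u η) η) volume a b ∧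
      ∫ η in a..b, φ (u η) η = ∫ η in a..b, φ t η := by
    intro a b u t hab hu
    have hg : BdMeas (fun η => φ t η) := hφ.comp₂ measurable_const measurable_id
    have hc : ∀ η ∈ uIcc a b, φ t η = φ (u η) η := fun η hη => by
      rw [hu η (by rwa [uIcc_of_le hab] at hη)]
    exact ⟨(hg.intervalIntegrable _ _).congr fun η hη => hc η (uIoc_subset_uIcc hη),
      (intervalIntegral.integral_congr hc).symm⟩
  have hleft : IntervalIntegrable (fun η => φ (U η) η) volume p₀ (A + m * h) ∧
      IntervalIntegrable (fun η => φ (V η) η) volume p₀ A ∧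
      (∫ η in p₀..(A + m * h), φ (U η) η) - ∫ η in p₀..A, φ (V η) η =
        m * ∫ r in (0 : ℝ)..h, φ r (A + m * r) := by
    rcases lt_trichotomy m 0 with hm | hm | hm
    · have e : p₀ = A + m * h := min_eq_right (by nlinarith)
      obtain ⟨h1, h2⟩ := hsub A m V hh hm.ne fun r hr => Vpiece _ _ (hentry hm r hr)
      rw [e, ← h2, intervalIntegral.integral_same, intervalIntegral.integral_symm A]
      exact ⟨.refl, h1.symm, by ring⟩
    · simp [hp₀, hm]
    · have e : p₀ = A := min_eq_left (by nlinarith)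
      obtain ⟨h1, h2⟩ := hsub A m U hh hm.ne' fun r hr => Upiece _ _ (hexit hm r hr)
      rw [e, ← h2, intervalIntegral.integral_same]
      exact ⟨h1, .refl, by ring⟩
  have hright : IntervalIntegrable (fun η => φ (U η) η) volume (B + n * h) p₁ ∧
      IntervalIntegrable (fun η => φ (V η) η) volume B p₁ ∧
      (∫ η in (B + n * h)..p₁, φ (U η) η) - ∫ η in B..p₁, φ (V η) η =
        - (n * ∫ r in (0 : ℝ)..h, φ r (B + n * r)) := by
    rcases lt_trichotomy n 0 with hm | hm | hm
    · have e : p₁ = B := max_eq_left (by nlinarith)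
      obtain ⟨h1, h2⟩ := hsub B n U hh hm.ne fun r hr => Upiece _ _ (hexit' hm r hr)
      rw [e, ← h2, intervalIntegral.integral_same, intervalIntegral.integral_symm B]
      exact ⟨h1.symm, .refl, by ring⟩
    · simp [hp₁, hm]
    · have e : p₁ = B + n * h := max_eq_right (by nlinarith)
      obtain ⟨h1, h2⟩ := hsub B n V hh hm.ne' fun r hr => Vpiece _ _ (hentry' hm r hr)
      rw [e, ← h2, intervalIntegral.integral_same]
      exact ⟨.refl, h1, by ring⟩
  obtain ⟨hUm, hUm'⟩ := huI hABh fun η hη => Upiece η h (hfin η hη)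
  obtain ⟨hVm, hVm'⟩ := huI hAB fun η hη => Vpiece η 0 (hini η hη)
  have hUint := (hleft.1.trans hUm).trans hright.1
  have hVint := (hleft.2.1.trans hVm).trans hright.2.1
  have hUsum : ∫ η in p₀..p₁, φ (U η) η = (∫ η in p₀..(A + m * h), φ (U η) η) +
      (∫ η in (A + m * h)..(B + n * h), φ h η) + ∫ η in (B + n * h)..p₁, φ (U η) η := by
    rw [← hUm', intervalIntegral.integral_add_adjacent_intervals hleft.1 hUm,
      intervalIntegral.integral_add_adjacent_intervals (hleft.1.trans hUm) hright.1]
  have hVsum : ∫ η in p₀..p₁, φ (V η) η = (∫ η in p₀..A, φ (V η) η) +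
      (∫ η in A..B, φ 0 η) + ∫ η in B..p₁, φ (V η) η := by
    rw [← hVm', intervalIntegral.integral_add_adjacent_intervals hleft.2.1 hVm,
      intervalIntegral.integral_add_adjacent_intervals (hleft.2.1.trans hVm) hright.2.1]
  -- the slices
  set χ : ℝ → ℝ → ℝ := fun r η => if A + m * r ≤ η ∧ η ≤ B + n * r then ψ r η else 0 with hχ
  have hχm : MeasurableSet {p : ℝ × ℝ | A + m * p.1 ≤ p.2 ∧ p.2 ≤ B + n * p.1} := by
    rw [Set.ofPred_and]
    exact (measurableSet_le (by fun_prop) (by fun_prop)).inter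
      (measurableSet_le (by fun_prop) (by fun_prop))
  have hχbd : BdMeas (fun p : ℝ × ℝ => χ p.1 p.2) :=
    hψ.ite_zero (p := fun p => A + m * p.1 ≤ p.2 ∧ p.2 ≤ B + n * p.1)
      hχm
  have hne : ∀ η ∈ Icc p₀ p₁, (T η).Nonempty := by
    intro η hη
    rcases lt_or_ge η (A + m * h) with h1 | h1
    · have hm : 0 < m := by
        by_contra! hm
        have : p₀ = A + m * h := min_eq_right (by nlinarith)
        linarith [hη.1]
      have e : p₀ = A := min_eq_left (by nlinarith)
      have h2 : A + m * ((η - A) / m) = η := by field_simp; ring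
      refine ⟨(η - A) / m, ?_⟩
      have := (hexit hm ((η - A) / m) ⟨div_nonneg (by linarith [hη.1]) hm.le,
        (div_le_iff₀ hm).2 (by linarith)⟩).1
      rwa [h2] at this
    rcases le_or_gt η (B + n * h) with h1' | h1'
    · exact ⟨h, (hfin η ⟨h1, h1'⟩).1⟩
    · have hm : n < 0 := by
        by_contra! hm
        have : p₁ = B + n * h := max_eq_right (by nlinarith)
        linarith [hη.2]
      have e : p₁ = B := max_eq_left (by nlinarith)
      have h2 : B + n * ((η - B) / n) = η := by rw [mul_div_cancel₀ _ hm.ne]; ring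
      refine ⟨(η - B) / n, ?_⟩
      have := (hexit' hm ((η - B) / n) ⟨div_nonneg_of_nonpos (by linarith [hη.2]) hm.le,
        (div_le_iff_of_neg hm).2 (by linarith)⟩).1
      rwa [h2] at this
  have hslice : ∀ η ∈ Icc p₀ p₁, ∫ r in (0 : ℝ)..h, χ r η = φ (U η) η - φ (V η) η := by
    intro η hη
    have hI := hTeq η (hne η hη)
    have hVU : V η ≤ U η := by
      rw [← nonempty_Icc, ← hI]; exact hne η hη
    have hVm : V η ∈ T η := by rw [hI]; exact left_mem_Icc.2 hVU
    have hUm : U η ∈ T η := by rw [hI]; exact right_mem_Icc.2 hVU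
    rw [hinc η (V η) (U η) hVm.1.1 hVU hUm.1.2 hVm.2.1 hVm.2.2 hUm.2.1 hUm.2.2]
    have e1 : ∫ r in (0 : ℝ)..h, χ r η =
        ∫ r in (0 : ℝ)..h, (if r ∈ Icc (V η) (U η) then ψ r η else 0) := by
      refine intervalIntegral.integral_congr fun r hr => ?_
      rw [uIcc_of_le hh] at hr
      simp only [hχ, ← hI]
      congr 1
      simp only [hT, mem_ofPred_eq, hr, true_and]
    rw [e1]
    refine (intervalIntegral_eq_intervalIntegral_of_eq_zero hVm.1.1 hVU hUm.1.2
      (fun r hr => ?_) fun r hr => ?_).symm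
    · rw [if_pos hr]
    · rw [if_neg hr]
  have hp : p₀ ≤ p₁ := hm0.1.trans hm0.2
  have hmain : ∫ r in (0 : ℝ)..h, ∫ η in (A + m * r)..(B + n * r), ψ r η =
      (∫ η in p₀..p₁, φ (U η) η) - ∫ η in p₀..p₁, φ (V η) η := by
    have e1 : ∫ r in (0 : ℝ)..h, ∫ η in (A + m * r)..(B + n * r), ψ r η =
        ∫ r in (0 : ℝ)..h, ∫ η in p₀..p₁, χ r η := by
      refine intervalIntegral.integral_congr fun r hr => ?_
      rw [uIcc_of_le hh] at hr
      refine intervalIntegral_eq_intervalIntegral_of_eq_zero (hlow r hr) (hle r hr) (hupp r hr)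
        (fun η hη => ?_) fun η hη => ?_
      · exact (if_pos hη).symm
      · exact if_neg hη
    rw [e1, hχbd.intervalIntegral_swap hh hp, ← intervalIntegral.integral_sub hUint hVint]
    refine intervalIntegral.integral_congr fun η hη => ?_
    rw [uIcc_of_le hp] at hη
    exact hslice η hη
  rw [hmain, hUsum, hVsum]
  linarith [hleft.2.2, hright.2.2]

/-- Reynolds' transport theorem on the moving interval `[A + l r, B + u r]` for a product of two
functions that are absolutely continuous along the lines of slope `c`. -/
theorem integral_mul_moving_interval {p p' q q' : ℝ → ℝ → ℝ} {A B l u c h : ℝ} (hh : 0 ≤ h)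
    (hAB : A ≤ B) (hABh : A + l * h ≤ B + u * h)
    (hp : BdMeas (fun z : ℝ × ℝ => p z.1 z.2)) (hp' : BdMeas (fun z : ℝ × ℝ => p' z.1 z.2))
    (hq : BdMeas (fun z : ℝ × ℝ => q z.1 z.2)) (hq' : BdMeas (fun z : ℝ × ℝ => q' z.1 z.2))
    (hpc : ∀ r y s, 0 ≤ r → 0 ≤ s → r + s ≤ h → A + l * r ≤ y → y ≤ B + u * r →
      A + l * (r + s) ≤ y + c * s → y + c * s ≤ B + u * (r + s) →
      p (r + s) (y + c * s) - p r y = ∫ σ in (0 : ℝ)..s, p' (r + σ) (y + c * σ))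
    (hqc : ∀ r y s, 0 ≤ r → 0 ≤ s → r + s ≤ h → A + l * r ≤ y → y ≤ B + u * r →
      A + l * (r + s) ≤ y + c * s → y + c * s ≤ B + u * (r + s) →
      q (r + s) (y + c * s) - q r y = ∫ σ in (0 : ℝ)..s, q' (r + σ) (y + c * σ)) :
    (∫ y in (A + l * h)..(B + u * h), p h y * q h y) - ∫ y in A..B, p 0 y * q 0 y =
      (∫ r in (0 : ℝ)..h, ∫ y in (A + l * r)..(B + u * r), (p' r y * q r y + p r y * q' r y))
        + (u - c) * (∫ r in (0 : ℝ)..h, p r (B + u * r) * q r (B + u * r))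
        - (l - c) * ∫ r in (0 : ℝ)..h, p r (A + l * r) * q r (A + l * r) := by
  have hshift : ∀ {f : ℝ → ℝ → ℝ}, BdMeas (fun z : ℝ × ℝ => f z.1 z.2) →
      BdMeas (fun z : ℝ × ℝ => f z.1 (z.2 + c * z.1)) := fun hf =>
    hf.comp₂ measurable_fst (by fun_prop)
  have key := integral_moving_interval (φ := fun r η => p r (η + c * r) * q r (η + c * r))
    (ψ := fun r η => p' r (η + c * r) * q r (η + c * r) + p r (η + c * r) * q' r (η + c * r))
    (m := l - c) (n := u - c) hh hAB (by linarith) ((hshift hp).mul (hshift hq))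
    (((hshift hp').mul (hshift hq)).add ((hshift hp).mul (hshift hq'))) ?_
  · have hcov : ∀ (f : ℝ → ℝ) (r : ℝ),
        ∫ η in (A + (l - c) * r)..(B + (u - c) * r), f (η + c * r) =
          ∫ y in (A + l * r)..(B + u * r), f y := by
      intro f r
      rw [intervalIntegral.integral_comp_add_right]
      congr 1 <;> ring
    have e1 := hcov (fun y => p h y * q h y) h
    have e2 := fun r => hcov (fun y => p' r y * q r y + p r y * q' r y) r
    have e3 : ∀ r, B + (u - c) * r + c * r = B + u * r := fun r => by ring
    have e4 : ∀ r, A + (l - c) * r + c * r = A + l * r := fun r => by ring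
    simp only [e1, e2, e3, e4, mul_zero, add_zero] at key
    exact key
  · intro η r₁ r₂ h0 h12 h2 ha hb ha' hb'
    have hline : ∀ {f f' : ℝ → ℝ → ℝ},
        (∀ r y s, 0 ≤ r → 0 ≤ s → r + s ≤ h → A + l * r ≤ y → y ≤ B + u * r →
          A + l * (r + s) ≤ y + c * s → y + c * s ≤ B + u * (r + s) →
          f (r + s) (y + c * s) - f r y = ∫ σ in (0 : ℝ)..s, f' (r + σ) (y + c * σ)) →
        ∀ s ∈ Icc r₁ r₂, f s (η + c * s) - f r₁ (η + c * r₁) =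
          ∫ r in r₁..s, f' r (η + c * r) := by
      intro f f' hf s hs
      have hconv : ∀ {X Y a b : ℝ}, X + (a - b) * r₁ ≤ Y → X + (a - b) * r₂ ≤ Y →
          X + (a - b) * s ≤ Y := by
        intro X Y a b h1 h2
        rcases le_total 0 (a - b) with h | h
        · nlinarith [hs.2]
        · nlinarith [hs.1]
      have hc1 := hconv ha ha'
      have hc2 : - B + (c - u) * s ≤ - η := hconv (by linarith) (by linarith)
      have := hf r₁ (η + c * r₁) (s - r₁) h0 (by linarith [hs.1]) (by linarith [hs.2])
        (by linarith) (by linarith) (by ring_nf at hc1 ⊢; linarith)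
        (by ring_nf at hc2 ⊢; linarith)
      have e1 : r₁ + (s - r₁) = s := by ring
      have e2 : η + c * r₁ + c * (s - r₁) = η + c * s := by ring
      rw [e1, e2] at this
      rw [this]
      have h3 := intervalIntegral.integral_comp_add_left (a := 0) (b := s - r₁)
        (fun r => f' r (η + c * r)) r₁
      rw [add_zero, e1] at h3
      rw [← h3]
      refine intervalIntegral.integral_congr fun σ _ => ?_
      congr 1
      ring
    have hint : ∀ {f : ℝ → ℝ → ℝ}, BdMeas (fun z : ℝ × ℝ => f z.1 z.2) →
        IntervalIntegrable (fun r => f r (η + c * r)) volume r₁ r₂ := fun hf =>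
      (hf.comp₂ measurable_id (by fun_prop)).intervalIntegrable _ _
    exact mul_sub_mul_eq_integral h12 (hint hp') (hint hq') (hline hpc) (hline hqc)

namespace HyperbolicChain

/-- The Volterra transformation `z = w + ∫ K w` by a kernel satisfying the kernel equations removes
the source term of the transport equations, up to a term with coefficient `Gf` and a boundary
term. -/
theorem volterra_transport {I : Type*} [Fintype I] {c : I → ℝ}
    {K : ℝ → ℝ → Matrix I I ℝ} {S Gf : ℝ → Matrix I I ℝ} {W : ℝ → ℝ → I → ℝ} {a : I} {h x₀ : ℝ}
    (hh : 0 ≤ h) (hx₀ : x₀ ∈ Icc (0 : ℝ) 1) (hxh : x₀ + c a * h ∈ Icc (0 : ℝ) 1)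
    (hK : ∀ a b, BdMeas (fun z : ℝ × ℝ => K z.1 z.2 a b))
    (hS : ∀ a b, BdMeas (fun x => S x a b)) (hG : ∀ a b, BdMeas (fun x => Gf x a b))
    (hW : ∀ b, BdMeas (fun z : ℝ × ℝ => W z.1 z.2 b))
    (hK0 : ∀ x y, (x, y) ∉ triK → K x y = 0)
    (hKpde : ∀ b x y s, (x, y) ∈ triK → 0 ≤ s → (x + c a * s, y + c b * s) ∈ triK →
      K (x + c a * s) (y + c b * s) a b - K x y a b =
        ∫ σ in (0 : ℝ)..s, (-(∑ d, K (x + c a * σ) (y + c b * σ) a d * S (y + c b * σ) d b) +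
          ∑ d, Gf (x + c a * σ) a d * K (x + c a * σ) (y + c b * σ) d b))
    (hKdiag : ∀ x ∈ Ioo (0 : ℝ) 1, ∀ b, (c a - c b) * K x x a b = S x a b - Gf x a b)
    (hWpde : ∀ b r y s, 0 ≤ r → 0 ≤ s → r + s ≤ h → y ∈ Icc (0 : ℝ) 1 →
      y + c b * s ∈ Icc (0 : ℝ) 1 → W (r + s) (y + c b * s) b - W r y b =
        ∫ σ in (0 : ℝ)..s, ∑ d, S (y + c b * σ) b d * W (r + σ) (y + c b * σ) d)
    (hca : c a ≠ 0) :
    (W h (x₀ + c a * h) a + ∫ y in (0 : ℝ)..1, ∑ b, K (x₀ + c a * h) y a b * W h y b)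
      - (W 0 x₀ a + ∫ y in (0 : ℝ)..1, ∑ b, K x₀ y a b * W 0 y b) =
    ∫ r in (0 : ℝ)..h, ((∑ d, Gf (x₀ + c a * r) a d *
        (W r (x₀ + c a * r) d + ∫ y in (0 : ℝ)..1, ∑ b, K (x₀ + c a * r) y d b * W r y b))
      - ∑ b, c b * (K (x₀ + c a * r) 1 a b * W r 1 b)) := by
  have hx : ∀ r ∈ Icc 0 h, x₀ + c a * r ∈ Icc (0 : ℝ) 1 := by
    intro r hr
    rcases le_total 0 (c a) with hc | hc
    · exact ⟨by nlinarith [hx₀.1, hr.1], by nlinarith [hxh.2, hr.2]⟩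
    · exact ⟨by nlinarith [hxh.1, hr.2], by nlinarith [hx₀.2, hr.1]⟩
  have hx' : ∀ r ∈ Ioo 0 h, x₀ + c a * r ∈ Ioo (0 : ℝ) 1 := by
    intro r hr
    rcases lt_or_gt_of_ne hca with hc | hc
    · exact ⟨by nlinarith [hxh.1, hr.2], by nlinarith [hx₀.2, hr.1]⟩
    · exact ⟨by nlinarith [hx₀.1, hr.1], by nlinarith [hxh.2, hr.2]⟩
  set ψ : I → ℝ → ℝ → ℝ := fun b r y =>
    (-(∑ d, K (x₀ + c a * r) y a d * S y d b) +
      ∑ d, Gf (x₀ + c a * r) a d * K (x₀ + c a * r) y d b) * W r y b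
      + K (x₀ + c a * r) y a b * ∑ d, S y b d * W r y d with hψ
  have hKr : ∀ a' b, BdMeas (fun z : ℝ × ℝ => K (x₀ + c a * z.1) z.2 a' b) := fun a' b =>
    (hK a' b).comp₂ (f := fun x y => K x y a' b) (by fun_prop) measurable_snd
  have hSr : ∀ a' b, BdMeas (fun z : ℝ × ℝ => S z.2 a' b) := fun a' b =>
    (hS a' b).comp measurable_snd
  have hGr : ∀ a' b, BdMeas (fun z : ℝ × ℝ => Gf (x₀ + c a * z.1) a' b) := fun a' b =>
    (hG a' b).comp (e := fun z : ℝ × ℝ => x₀ + c a * z.1) (by fun_prop)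
  have hp' : ∀ b, BdMeas (fun z : ℝ × ℝ =>
      -(∑ d, K (x₀ + c a * z.1) z.2 a d * S z.2 d b) +
      ∑ d, Gf (x₀ + c a * z.1) a d * K (x₀ + c a * z.1) z.2 d b) := fun b =>
    (BdMeas.sum _ fun d _ => (hKr a d).mul (hSr d b)).neg.add
      (BdMeas.sum _ fun d _ => (hGr a d).mul (hKr d b))
  have hq' : ∀ b, BdMeas (fun z : ℝ × ℝ => ∑ d, S z.2 b d * W z.1 z.2 d) := fun b =>
    BdMeas.sum _ fun d _ => (hSr b d).mul (hW d)
  have hψbd : ∀ b, BdMeas (fun z : ℝ × ℝ => ψ b z.1 z.2) := fun b =>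
    ((hp' b).mul (hW b)).add ((hKr a b).mul (hq' b))
  have hψ0 : ∀ b r y, (x₀ + c a * r, y) ∉ triK → ψ b r y = 0 := by
    intro b r y hy
    simp [hψ, hK0 _ _ hy]
  have hcut : ∀ (f : ℝ → ℝ) (x : ℝ), x ∈ Icc (0 : ℝ) 1 → (∀ y, (x, y) ∉ triK → f y = 0) →
      ∫ y in x..1, f y = ∫ y in (0 : ℝ)..1, f y := by
    intro f x hx hf
    refine intervalIntegral_eq_intervalIntegral_of_eq_zero hx.1 hx.2 le_rfl (fun _ _ => rfl)
      fun y hy => hf y fun h => hy ⟨h.2.1, h.2.2⟩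
  -- one component
  have hcomp : ∀ b, (∫ y in (0 : ℝ)..1, K (x₀ + c a * h) y a b * W h y b)
      - ∫ y in (0 : ℝ)..1, K x₀ y a b * W 0 y b =
      ∫ r in (0 : ℝ)..h, ((∫ y in (0 : ℝ)..1, ψ b r y)
        - c b * (K (x₀ + c a * r) 1 a b * W r 1 b)
        - (c a - c b) * (K (x₀ + c a * r) (x₀ + c a * r) a b * W r (x₀ + c a * r) b)) := by
    intro b
    have key := integral_mul_moving_interval (p := fun r y => K (x₀ + c a * r) y a b)
      (p' := fun r y => -(∑ d, K (x₀ + c a * r) y a d * S y d b) +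
        ∑ d, Gf (x₀ + c a * r) a d * K (x₀ + c a * r) y d b)
      (q := fun r y => W r y b) (q' := fun r y => ∑ d, S y b d * W r y d)
      (A := x₀) (B := 1) (l := c a) (u := 0) (c := c b) hh hx₀.2 (by linarith [hxh.2])
      (hKr a b) (hp' b) (hW b) (hq' b) ?_ ?_
    · simp only [mul_zero, add_zero, zero_mul, zero_sub] at key
      rw [hcut _ _ hx₀ fun y hy => by simp [hK0 _ _ hy],
        hcut _ _ hxh fun y hy => by simp [hK0 _ _ hy]] at key
      rw [key]
      have e1 : ∫ r in (0 : ℝ)..h, ∫ y in (x₀ + c a * r)..1, ψ b r y =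
          ∫ r in (0 : ℝ)..h, ∫ y in (0 : ℝ)..1, ψ b r y := by
        refine intervalIntegral.integral_congr fun r hr => ?_
        rw [uIcc_of_le hh] at hr
        exact hcut _ _ (hx r hr) fun y hy => hψ0 b r y hy
      have i1 : BdMeas (fun r => ∫ y in (0 : ℝ)..1, ψ b r y) := (hψbd b).intervalIntegral 0 1
      have i2 : BdMeas (fun r => K (x₀ + c a * r) 1 a b * W r 1 b) :=
        ((hK a b).comp₂ (f := fun x y => K x y a b) (by fun_prop) measurable_const).mul
          ((hW b).comp₂ (f := fun x y => W x y b) measurable_id measurable_const)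
      have i3 : BdMeas (fun r => K (x₀ + c a * r) (x₀ + c a * r) a b * W r (x₀ + c a * r) b) :=
        ((hK a b).comp₂ (f := fun x y => K x y a b) (by fun_prop) (by fun_prop)).mul
          ((hW b).comp₂ (f := fun x y => W x y b) measurable_id (by fun_prop))
      rw [e1, intervalIntegral.integral_sub
        ((i1.sub (i2.const_mul _)).intervalIntegrable _ _) ((i3.const_mul _).intervalIntegrable _ _),
        intervalIntegral.integral_sub (i1.intervalIntegrable _ _)
          ((i2.const_mul _).intervalIntegrable _ _),
        intervalIntegral.integral_const_mul, intervalIntegral.integral_const_mul]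
      ring
    · intro r y s hr hs hrs h1 h2 h3 h4
      have e1 : x₀ + c a * (r + s) = (x₀ + c a * r) + c a * s := by ring
      have m1 := hx r ⟨hr, by linarith⟩
      have m2 := hx (r + s) ⟨by linarith, hrs⟩
      have := hKpde b (x₀ + c a * r) y s ⟨m1.1, h1, by linarith⟩ hs
        ⟨by dsimp only; rw [← e1]; exact m2.1, by dsimp only; rw [← e1]; exact h3,
          by dsimp only; linarith⟩
      rw [e1, this]
      refine intervalIntegral.integral_congr fun σ _ => ?_
      have e2 : x₀ + c a * (r + σ) = (x₀ + c a * r) + c a * σ := by ring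
      simp only [e2]
    · intro r y s hr hs hrs h1 h2 h3 h4
      have m1 := hx r ⟨hr, by linarith⟩
      have m2 := hx (r + s) ⟨by linarith, hrs⟩
      exact hWpde b r y s hr hs hrs ⟨m1.1.trans h1, by linarith⟩ ⟨m2.1.trans h3, by linarith⟩
  have hWa : W h (x₀ + c a * h) a - W 0 x₀ a =
      ∫ r in (0 : ℝ)..h, ∑ d, S (x₀ + c a * r) a d * W r (x₀ + c a * r) d := by
    have := hWpde a 0 x₀ h le_rfl hh (by simp) hx₀ hxh
    simpa only [zero_add] using this
  have hKW : ∀ d r b, BdMeas (fun y => K (x₀ + c a * r) y d b * W r y b) := fun d r b =>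
    ((hK d b).comp₂ (f := fun x y => K x y d b) measurable_const measurable_id).mul
      ((hW b).comp₂ (f := fun x y => W x y b) measurable_const measurable_id)
  have hsplit : ∀ r, ∫ y in (0 : ℝ)..1, ∑ b, K (x₀ + c a * r) y a b * W r y b =
      ∑ b, ∫ y in (0 : ℝ)..1, K (x₀ + c a * r) y a b * W r y b := fun r =>
    intervalIntegral.integral_finsetSum fun b _ => (hKW a r b).intervalIntegrable _ _
  have hs0 := hsplit 0
  simp only [mul_zero, add_zero] at hs0
  rw [hsplit h, hs0]
  have hE : ∀ b, BdMeas (fun r => (∫ y in (0 : ℝ)..1, ψ b r y)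
        - c b * (K (x₀ + c a * r) 1 a b * W r 1 b)
        - (c a - c b) * (K (x₀ + c a * r) (x₀ + c a * r) a b * W r (x₀ + c a * r) b)) := fun b =>
    (((hψbd b).intervalIntegral 0 1).sub
      ((((hK a b).comp₂ (f := fun x y => K x y a b) (by fun_prop) measurable_const).mul
      ((hW b).comp₂ (f := fun x y => W x y b) measurable_id measurable_const)).const_mul _)).sub
      ((((hK a b).comp₂ (f := fun x y => K x y a b) (by fun_prop) (by fun_prop)).mul
          ((hW b).comp₂ (f := fun x y => W x y b) measurable_id (by fun_prop))).const_mul _)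
  have hSW : BdMeas (fun r => ∑ d, S (x₀ + c a * r) a d * W r (x₀ + c a * r) d) :=
    BdMeas.sum _ fun d _ => ((hS a d).comp (e := fun r => x₀ + c a * r) (by fun_prop)).mul
      ((hW d).comp₂ (f := fun x y => W x y d) measurable_id (by fun_prop))
  have htot : (W h (x₀ + c a * h) a + ∑ b, ∫ y in (0 : ℝ)..1, K (x₀ + c a * h) y a b * W h y b)
      - (W 0 x₀ a + ∑ b, ∫ y in (0 : ℝ)..1, K x₀ y a b * W 0 y b) =
      ∫ r in (0 : ℝ)..h, ((∑ d, S (x₀ + c a * r) a d * W r (x₀ + c a * r) d) +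
        ∑ b, ((∫ y in (0 : ℝ)..1, ψ b r y)
        - c b * (K (x₀ + c a * r) 1 a b * W r 1 b)
        - (c a - c b) * (K (x₀ + c a * r) (x₀ + c a * r) a b * W r (x₀ + c a * r) b))) := by
    rw [intervalIntegral.integral_add (hSW.intervalIntegrable _ _)
      ((BdMeas.sum _ fun b _ => hE b).intervalIntegrable _ _), ← hWa,
      intervalIntegral.integral_finsetSum fun b _ => (hE b).intervalIntegrable _ _,
      ← Finset.sum_congr rfl fun b _ => hcomp b, Finset.sum_sub_distrib]
    ring
  rw [htot]
  refine intervalIntegral.integral_congr_Ioo_of_le hh fun r hr => ?_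
  have hψsum : ∑ b, ∫ y in (0 : ℝ)..1, ψ b r y = ∑ d, Gf (x₀ + c a * r) a d *
      ∫ y in (0 : ℝ)..1, ∑ b, K (x₀ + c a * r) y d b * W r y b := by
    have i1 : ∀ b, BdMeas (fun y => ψ b r y) := fun b =>
      (hψbd b).comp₂ (f := ψ b) measurable_const measurable_id
    rw [← intervalIntegral.integral_finsetSum fun b _ => (i1 b).intervalIntegrable _ _]
    simp only [← intervalIntegral.integral_const_mul]
    rw [← intervalIntegral.integral_finsetSum fun d _ =>
      ((BdMeas.sum _ fun b _ => hKW d r b).const_mul _).intervalIntegrable _ _]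
    refine intervalIntegral.integral_congr fun y _ => ?_
    simp only [hψ, add_mul, neg_mul, Finset.sum_add_distrib, Finset.sum_neg_distrib,
      Finset.sum_mul, Finset.mul_sum]
    have e1 : ∑ x, ∑ i, K (x₀ + c a * r) y a i * S y i x * W r y x =
        ∑ x, ∑ i, K (x₀ + c a * r) y a x * (S y x i * W r y i) := by
      rw [Finset.sum_comm]
      simp only [mul_assoc]
    have e2 : ∑ x, ∑ i, Gf (x₀ + c a * r) a i * K (x₀ + c a * r) y i x * W r y x =
        ∑ x, ∑ i, Gf (x₀ + c a * r) a x * (K (x₀ + c a * r) y x i * W r y i) := by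
      rw [Finset.sum_comm]
      simp only [mul_assoc]
    rw [e1, e2]
    ring
  have hdiag : ∑ b, (c a - c b) * (K (x₀ + c a * r) (x₀ + c a * r) a b * W r (x₀ + c a * r) b) =
      (∑ d, S (x₀ + c a * r) a d * W r (x₀ + c a * r) d) -
        ∑ d, Gf (x₀ + c a * r) a d * W r (x₀ + c a * r) d := by
    rw [← Finset.sum_sub_distrib]
    refine Finset.sum_congr rfl fun b _ => ?_
    rw [← mul_assoc, hKdiag _ (hx' r hr) b, sub_mul]
  rw [Finset.sum_sub_distrib, Finset.sum_sub_distrib, hψsum, hdiag]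
  simp only [mul_add, Finset.sum_add_distrib]
  ring

/-- The distributed-delay term of the transformation is transported with the same coefficient
`G`, up to a boundary term. -/
theorem delay_transport {I J : Type*} [Fintype I] [Fintype J] {F : ℝ → ℝ → Matrix I J ℝ}
    {G : ℝ → Matrix I I ℝ} {v : ℝ → J → ℝ} {k : I} {lam₁ c h x₀ : ℝ} (hh : 0 ≤ h)
    (hlam₁ : 0 < lam₁) (hc : 0 < c)
    (hx₀ : x₀ ∈ Icc (0 : ℝ) 1) (hxh : x₀ + c * h ∈ Icc (0 : ℝ) 1)
    (hF : ∀ d l, BdMeas (fun z : ℝ × ℝ => F z.1 z.2 d l)) (hG : ∀ d e, BdMeas (fun x => G x d e))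
    (hv : ∀ l, BdMeas (fun t => v t l))
    (hF0 : ∀ x y, ¬ (0 ≤ y ∧ y ≤ x / lam₁) → F x y = 0)
    (hFpde : ∀ l x y s, x ∈ Icc (0 : ℝ) 1 → 0 ≤ y → y ≤ x / lam₁ → 0 ≤ s →
      x + c * s ∈ Icc (0 : ℝ) 1 → y + s ≤ (x + c * s) / lam₁ →
      F (x + c * s) (y + s) k l - F x y k l =
        ∫ σ in (0 : ℝ)..s, ∑ d, G (x + c * σ) k d * F (x + c * σ) (y + σ) d l)
    (hFside : c ≠ lam₁ → ∀ x ∈ Ioo (0 : ℝ) 1, ∀ l, F x (x / lam₁) k l = 0) :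
    (∫ y in (0 : ℝ)..(1 / lam₁), ∑ l, F (x₀ + c * h) y k l * v (h - y) l)
      - (∫ y in (0 : ℝ)..(1 / lam₁), ∑ l, F x₀ y k l * v (- y) l) =
    ∫ r in (0 : ℝ)..h, ((∑ d, G (x₀ + c * r) k d *
        ∫ y in (0 : ℝ)..(1 / lam₁), ∑ l, F (x₀ + c * r) y d l * v (r - y) l)
      + ∑ l, F (x₀ + c * r) 0 k l * v r l) := by
  have hx : ∀ r ∈ Icc 0 h, x₀ + c * r ∈ Icc (0 : ℝ) 1 := by
    intro r hr
    exact ⟨by nlinarith [hx₀.1, hr.1], by nlinarith [hxh.2, hr.2]⟩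
  have hx' : ∀ r ∈ Ioo 0 h, x₀ + c * r ∈ Ioo (0 : ℝ) 1 := by
    intro r hr
    exact ⟨by nlinarith [hx₀.1, hr.1], by nlinarith [hxh.2, hr.2]⟩
  have hFr : ∀ d l, BdMeas (fun z : ℝ × ℝ => F (x₀ + c * z.1) z.2 d l) := fun d l =>
    (hF d l).comp₂ (f := fun x y => F x y d l) (by fun_prop) measurable_snd
  have hGr : ∀ d e, BdMeas (fun z : ℝ × ℝ => G (x₀ + c * z.1) d e) := fun d e =>
    (hG d e).comp (e := fun z : ℝ × ℝ => x₀ + c * z.1) (by fun_prop)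
  have hvr : ∀ l, BdMeas (fun z : ℝ × ℝ => v (z.1 - z.2) l) := fun l =>
    (hv l).comp (e := fun z : ℝ × ℝ => z.1 - z.2) (by fun_prop)
  have hp' : ∀ l, BdMeas (fun z : ℝ × ℝ =>
      ∑ d, G (x₀ + c * z.1) k d * F (x₀ + c * z.1) z.2 d l) := fun l =>
    BdMeas.sum _ fun d _ => (hGr k d).mul (hFr d l)
  set ψ : J → ℝ → ℝ → ℝ := fun l r y =>
    (∑ d, G (x₀ + c * r) k d * F (x₀ + c * r) y d l) * v (r - y) l with hψ
  have hψbd : ∀ l, BdMeas (fun z : ℝ × ℝ => ψ l z.1 z.2) := fun l => (hp' l).mul (hvr l)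
  have hcut : ∀ (f : ℝ → ℝ) (x : ℝ), x ∈ Icc (0 : ℝ) 1 →
      (∀ y, ¬ (0 ≤ y ∧ y ≤ x / lam₁) → f y = 0) →
      ∫ y in (0 : ℝ)..(x / lam₁), f y = ∫ y in (0 : ℝ)..(1 / lam₁), f y := by
    intro f x hx hf
    exact intervalIntegral_eq_intervalIntegral_of_eq_zero le_rfl (div_nonneg hx.1 hlam₁.le)
      (by gcongr; exact hx.2) (fun _ _ => rfl) fun y hy => hf y hy
  have hF0r : ∀ l r, BdMeas (fun y => F (x₀ + c * r) y k l * v (r - y) l) := fun l r =>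
    ((hF k l).comp₂ (f := fun x y => F x y k l) measurable_const measurable_id).mul
      ((hv l).comp (e := fun y => r - y) (by fun_prop))
  have i2 : ∀ l, BdMeas (fun r => F (x₀ + c * r) 0 k l * v r l) := fun l =>
    ((hF k l).comp₂ (f := fun x y => F x y k l) (by fun_prop) measurable_const).mul (hv l)
  have hcomp : ∀ l, (∫ y in (0 : ℝ)..(1 / lam₁), F (x₀ + c * h) y k l * v (h - y) l)
      - (∫ y in (0 : ℝ)..(1 / lam₁), F x₀ y k l * v (- y) l) =
      ∫ r in (0 : ℝ)..h, ((∫ y in (0 : ℝ)..(1 / lam₁), ψ l r y)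
        + F (x₀ + c * r) 0 k l * v r l) := by
    intro l
    have eB : ∀ r, x₀ / lam₁ + c / lam₁ * r = (x₀ + c * r) / lam₁ := fun r => by ring
    have key := integral_mul_moving_interval (p := fun r y => F (x₀ + c * r) y k l)
      (p' := fun r y => ∑ d, G (x₀ + c * r) k d * F (x₀ + c * r) y d l)
      (q := fun r y => v (r - y) l) (q' := fun _ _ => 0)
      (A := 0) (B := x₀ / lam₁) (l := 0) (u := c / lam₁) (c := 1) hh
      (div_nonneg hx₀.1 hlam₁.le) (by rw [eB, zero_mul, add_zero]; exact div_nonneg hxh.1 hlam₁.le)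
      (hFr k l) (hp' l) (hvr l) (BdMeas.const 0) ?_ ?_
    · simp only [mul_zero, add_zero, zero_mul, zero_sub, eB, sub_zero] at key
      rw [hcut _ _ hx₀ fun y hy => by simp [hF0 _ _ hy],
        hcut _ _ hxh fun y hy => by simp [hF0 _ _ hy]] at key
      rw [key]
      have e1 : ∫ r in (0 : ℝ)..h, ∫ y in (0 : ℝ)..((x₀ + c * r) / lam₁), ψ l r y =
          ∫ r in (0 : ℝ)..h, ∫ y in (0 : ℝ)..(1 / lam₁), ψ l r y := by
        refine intervalIntegral.integral_congr fun r hr => ?_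
        rw [uIcc_of_le hh] at hr
        exact hcut _ _ (hx r hr) fun y hy => by simp [hψ, hF0 _ _ hy]
      have e2 : (c / lam₁ - 1) * (∫ r in (0 : ℝ)..h, F (x₀ + c * r) ((x₀ + c * r) / lam₁) k l *
          v (r - (x₀ + c * r) / lam₁) l) = 0 := by
        by_cases hcl : c = lam₁
        · rw [hcl, div_self hlam₁.ne']; ring
        · rw [intervalIntegral.integral_congr_Ioo_of_le (g := fun _ => 0) hh fun r hr => by
            simp [hFside hcl _ (hx' r hr) l]]
          simp
      rw [e1, e2, intervalIntegral.integral_add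
        (((hψbd l).intervalIntegral 0 _).intervalIntegrable _ _) ((i2 l).intervalIntegrable _ _)]
      ring
    · intro r y s hr hs hrs h1 h2 h3 h4
      have e1 : x₀ + c * (r + s) = (x₀ + c * r) + c * s := by ring
      have m1 := hx r ⟨hr, by linarith⟩
      have m2 := hx (r + s) ⟨by linarith, hrs⟩
      rw [eB] at h2 h4
      rw [e1] at m2 h4
      have := hFpde l (x₀ + c * r) y s m1 (by linarith) h2 hs m2 (by linarith)
      rw [e1, one_mul, this]
      refine intervalIntegral.integral_congr fun σ _ => ?_
      have e2 : x₀ + c * (r + σ) = (x₀ + c * r) + c * σ := by ring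
      simp only [e2, one_mul]
    · intro r y s _ _ _ _ _ _ _
      simp
  have hsplit : ∀ r, ∫ y in (0 : ℝ)..(1 / lam₁), ∑ l, F (x₀ + c * r) y k l * v (r - y) l =
      ∑ l, ∫ y in (0 : ℝ)..(1 / lam₁), F (x₀ + c * r) y k l * v (r - y) l := fun r =>
    intervalIntegral.integral_finsetSum fun l _ => (hF0r l r).intervalIntegrable _ _
  have hs0 := hsplit 0
  simp only [mul_zero, add_zero, zero_sub] at hs0
  rw [hsplit h, hs0, ← Finset.sum_sub_distrib, Finset.sum_congr rfl fun l _ => hcomp l,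
    ← intervalIntegral.integral_finsetSum fun l _ =>
      (((hψbd l).intervalIntegral 0 _).add (i2 l)).intervalIntegrable _ _]
  refine intervalIntegral.integral_congr fun r _ => ?_
  simp only [Finset.sum_add_distrib]
  congr 1
  have i3 : ∀ d, BdMeas (fun y => ∑ l, F (x₀ + c * r) y d l * v (r - y) l) := fun d =>
    BdMeas.sum _ fun l _ =>
      ((hF d l).comp₂ (f := fun x y => F x y d l) measurable_const measurable_id).mul
        ((hv l).comp (e := fun y => r - y) (by fun_prop))
  have i4 : ∀ l, BdMeas (fun y => ψ l r y) := fun l =>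
    (hψbd l).comp₂ (f := ψ l) measurable_const measurable_id
  rw [← intervalIntegral.integral_finsetSum fun l _ => (i4 l).intervalIntegrable _ _]
  simp only [← intervalIntegral.integral_const_mul]
  rw [← intervalIntegral.integral_finsetSum fun d _ =>
    ((i3 d).const_mul _).intervalIntegrable _ _]
  refine intervalIntegral.integral_congr fun y _ => ?_
  simp only [hψ, Finset.sum_mul, Finset.mul_sum]
  rw [Finset.sum_comm]
  simp only [mul_assoc]

end HyperbolicChain

namespace HyperbolicChain

/-- Terms of the Neumann series of the resolvent of a matrix Volterra kernel. -/
noncomputable def neumannTerm {I : Type*} [Fintype I] (K : ℝ → ℝ → Matrix I I ℝ) :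
    ℕ → ℝ → ℝ → I → I → ℝ
  | 0 => fun x y a b => - K x y a b
  | n + 1 => fun x y a b => - ∫ ξ in (0 : ℝ)..1, ∑ c, neumannTerm K n x ξ a c * K ξ y c b

section
variable {I : Type*} [Fintype I] {K : ℝ → ℝ → Matrix I I ℝ}

lemma mem_triK_trans {x y z : ℝ} (h1 : (x, y) ∈ triK) (h2 : (y, z) ∈ triK) : (x, z) ∈ triK :=
  ⟨h1.1, h1.2.1.trans h2.2.1, h2.2.2⟩

lemma neumannTerm_eq_zero (hK0 : ∀ x y, (x, y) ∉ triK → K x y = 0) (n : ℕ) :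
    ∀ x y, (x, y) ∉ triK → ∀ a b, neumannTerm K n x y a b = 0 := by
  induction n with
  | zero => intro x y h a b; simp [neumannTerm, hK0 x y h]
  | succ n ih =>
    intro x y h a b
    simp only [neumannTerm, neg_eq_zero]
    rw [intervalIntegral.integral_congr (g := fun _ => 0), intervalIntegral.integral_zero]
    intro ξ _
    refine Finset.sum_eq_zero fun c _ => ?_
    by_cases h1 : (x, ξ) ∈ triK
    · have h2 : (ξ, y) ∉ triK := fun h2 => h (mem_triK_trans h1 h2)
      simp [hK0 _ _ h2]
    · simp [ih _ _ h1]

lemma neumannTerm_bdMeas (hK : ∀ a b, BdMeas (fun z : ℝ × ℝ => K z.1 z.2 a b)) (n : ℕ) :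
    ∀ a b, BdMeas (fun z : ℝ × ℝ => neumannTerm K n z.1 z.2 a b) := by
  induction n with
  | zero => intro a b; exact (hK a b).neg
  | succ n ih =>
    intro a b
    refine BdMeas.neg (BdMeas.intervalIntegral
      (f := fun (z : ℝ × ℝ) ξ => ∑ c, neumannTerm K n z.1 ξ a c * K ξ z.2 c b) ?_ 0 1)
    refine BdMeas.sum _ fun c _ => BdMeas.mul ?_ ?_
    · exact (ih a c).comp₂ (f := fun x y => neumannTerm K n x y a c) (by fun_prop) (by fun_prop)
    · exact (hK c b).comp₂ (f := fun x y => K x y c b) (by fun_prop) (by fun_prop)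

lemma abs_neumannTerm_le {M γ : ℝ} (hM : 0 ≤ M) (hγ : 0 < γ)
    (hγM : 2 * (Fintype.card I * M) ≤ γ) (hKM : ∀ x y a b, |K x y a b| ≤ M)
    (hK0 : ∀ x y, (x, y) ∉ triK → K x y = 0) (n : ℕ) :
    ∀ x y, (x, y) ∈ triK → ∀ a b,
      |neumannTerm K n x y a b| ≤ M * (1 / 2) ^ n * Real.exp (γ * (y - x)) := by
  induction n with
  | zero =>
    intro x y h a b
    have h1 : 1 ≤ Real.exp (γ * (y - x)) :=
      Real.one_le_exp (mul_nonneg hγ.le (sub_nonneg.2 h.2.1))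
    simp only [neumannTerm, abs_neg, pow_zero, mul_one]
    exact (hKM x y a b).trans (le_mul_of_one_le_right hM h1)
  | succ n ih =>
    intro x y h a b
    simp only [neumannTerm, abs_neg]
    have hcut : ∫ ξ in (0 : ℝ)..1, ∑ c, neumannTerm K n x ξ a c * K ξ y c b =
        ∫ ξ in x..y, ∑ c, neumannTerm K n x ξ a c * K ξ y c b := by
      refine (intervalIntegral_eq_intervalIntegral_of_eq_zero h.1 h.2.1 h.2.2
        (fun _ _ => rfl) fun ξ hξ => Finset.sum_eq_zero fun c _ => ?_).symm
      by_cases h1 : x ≤ ξ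
      · have h2 : (ξ, y) ∉ triK := fun h2 => hξ ⟨h1, h2.2.1⟩
        simp [hK0 _ _ h2]
      · have h2 : (x, ξ) ∉ triK := fun h2 => h1 h2.2.1
        simp [neumannTerm_eq_zero hK0 n _ _ h2]
    rw [hcut]
    set N : ℝ := Fintype.card I * (M * (1 / 2) ^ n * M) with hN
    have hN0 : 0 ≤ N := by positivity
    have hderiv : ∀ ξ ∈ uIcc x y, HasDerivAt (fun ξ => N / γ * Real.exp (γ * (ξ - x)))
        (N * Real.exp (γ * (ξ - x))) ξ := by
      intro ξ _
      have h1 : HasDerivAt (fun ξ => γ * (ξ - x)) (γ * 1) ξ :=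
        ((hasDerivAt_id ξ).sub_const x).const_mul γ
      refine (h1.exp.const_mul (N / γ)).congr_deriv ?_
      field_simp
    have hint : IntervalIntegrable (fun ξ => N * Real.exp (γ * (ξ - x))) volume x y :=
      (by fun_prop : Continuous fun ξ => N * Real.exp (γ * (ξ - x))).intervalIntegrable _ _
    have hle := intervalIntegral.norm_integral_le_of_norm_le h.2.1
      (f := fun ξ => ∑ c, neumannTerm K n x ξ a c * K ξ y c b)
      (g := fun ξ => N * Real.exp (γ * (ξ - x))) (μ := volume) ?_ hint
    · rw [Real.norm_eq_abs, intervalIntegral.integral_eq_sub_of_hasDerivAt hderiv hint] at hle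
      have h0 : 0 ≤ N / γ * Real.exp (γ * (x - x)) := by positivity
      have h1 : N / γ ≤ M * (1 / 2) ^ (n + 1) := by
        rw [div_le_iff₀ hγ, hN, pow_succ]
        have : (0 : ℝ) ≤ M * (1 / 2) ^ n := by positivity
        nlinarith
      have h2 := mul_le_mul_of_nonneg_right h1 (Real.exp_pos (γ * (y - x))).le
      linarith
    · refine Filter.Eventually.of_forall fun ξ hξ => ?_
      have m1 : (x, ξ) ∈ triK := ⟨h.1, hξ.1.le, hξ.2.trans h.2.2⟩
      rw [Real.norm_eq_abs]
      refine (Finset.abs_sum_le_sum_abs _ _).trans ?_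
      refine (Finset.sum_le_card_nsmul _ _
        (M * (1 / 2) ^ n * Real.exp (γ * (ξ - x)) * M) fun c _ => ?_).trans (le_of_eq ?_)
      · rw [abs_mul]
        exact mul_le_mul (ih x ξ m1 a c) (hKM ξ y c b) (abs_nonneg _) (by positivity)
      · rw [hN, nsmul_eq_mul, Finset.card_univ]
        ring

/-- Resolvent of a bounded measurable matrix Volterra kernel. -/
theorem exists_resolvent (hK : ∀ a b, BdMeas (fun z : ℝ × ℝ => K z.1 z.2 a b))
    (hK0 : ∀ x y, (x, y) ∉ triK → K x y = 0) :
    ∃ R : ℝ → ℝ → Matrix I I ℝ, (∀ a b, BdMeas (fun z : ℝ × ℝ => R z.1 z.2 a b)) ∧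
      (∀ x y, (x, y) ∉ triK → R x y = 0) ∧
      ∀ x y a b, R x y a b + K x y a b + ∫ ξ in (0 : ℝ)..1, ∑ c, R x ξ a c * K ξ y c b = 0 := by
  obtain ⟨M, hM, hKM⟩ : ∃ M : ℝ, 0 ≤ M ∧ ∀ x y a b, |K x y a b| ≤ M := by
    choose M hM0 hM using fun a b => (hK a b).exists_pos_bound
    refine ⟨∑ a, ∑ b, M a b, by
      exact Finset.sum_nonneg fun a _ => Finset.sum_nonneg fun b _ => (hM0 a b).le, ?_⟩
    intro x y a b
    refine (hM a b (x, y)).trans ?_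
    refine (Finset.single_le_sum (f := M a) (fun b _ => (hM0 a b).le)
      (Finset.mem_univ b)).trans ?_
    exact Finset.single_le_sum (f := fun a => ∑ b, M a b)
      (fun a _ => Finset.sum_nonneg fun b _ => (hM0 a b).le) (Finset.mem_univ a)
  set γ : ℝ := 2 * (Fintype.card I * M) + 1 with hγ
  have hγ0 : 0 < γ := by positivity
  set B : ℝ := M * Real.exp γ with hB
  have hB0 : 0 ≤ B := by positivity
  have hbound : ∀ n x y a b, |neumannTerm K n x y a b| ≤ B * (1 / 2) ^ n := by
    intro n x y a b
    by_cases h : (x, y) ∈ triK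
    · refine (abs_neumannTerm_le hM hγ0 (by linarith) hKM hK0 n x y h a b).trans ?_
      have h1 : Real.exp (γ * (y - x)) ≤ Real.exp γ := by
        refine Real.exp_le_exp.2 ?_
        have : y - x ≤ 1 := by linarith [h.1, h.2.2]
        nlinarith
      have h2 : 0 ≤ M * (1 / 2) ^ n := by positivity
      calc M * (1 / 2) ^ n * Real.exp (γ * (y - x)) ≤ M * (1 / 2) ^ n * Real.exp γ :=
            mul_le_mul_of_nonneg_left h1 h2
        _ = B * (1 / 2) ^ n := by rw [hB]; ring
    · rw [neumannTerm_eq_zero hK0 n x y h, abs_zero]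
      positivity
  have hgeom : Summable fun n : ℕ => B * (1 / 2 : ℝ) ^ n :=
    (summable_geometric_of_lt_one (by norm_num) (by norm_num)).mul_left B
  have hsum : ∀ x y a b, Summable fun n => neumannTerm K n x y a b := fun x y a b =>
    Summable.of_norm_bounded hgeom fun n => hbound n x y a b
  refine ⟨fun x y a b => ∑' n, neumannTerm K n x y a b, fun a b => ⟨?_, ?_⟩, ?_, ?_⟩
  · refine measurable_of_tendsto_metrizable
      (f := fun N (z : ℝ × ℝ) => ∑ n ∈ Finset.range N, neumannTerm K n z.1 z.2 a b)
      (fun N => Finset.measurable_sum _ fun n _ => (neumannTerm_bdMeas hK n a b).1) ?_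
    rw [tendsto_pi_nhds]
    exact fun z => (hsum z.1 z.2 a b).hasSum.tendsto_sum_nat
  · refine ⟨∑' n : ℕ, B * (1 / 2 : ℝ) ^ n, fun z => ?_⟩
    exact tsum_of_norm_bounded (f := fun n => neumannTerm K n z.1 z.2 a b) hgeom.hasSum
      fun n => hbound n z.1 z.2 a b
  · intro x y h
    ext a b
    simp [neumannTerm_eq_zero hK0 _ x y h]
  · intro x y a b
    have hswap : HasSum (fun n => ∫ ξ in (0 : ℝ)..1, ∑ c, neumannTerm K n x ξ a c * K ξ y c b)
        (∫ ξ in (0 : ℝ)..1, ∑ c, (∑' n, neumannTerm K n x ξ a c) * K ξ y c b) := by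
      refine intervalIntegral.hasSum_integral_of_dominated_convergence
        (fun n _ => Fintype.card I * (B * (1 / 2) ^ n * M)) (fun n => ?_) (fun n => ?_) ?_ ?_ ?_
      · refine (BdMeas.sum (f := fun c ξ => neumannTerm K n x ξ a c * K ξ y c b) _
          fun c _ => ?_).1.aestronglyMeasurable
        exact ((neumannTerm_bdMeas hK n a c).comp₂ (f := fun x y => neumannTerm K n x y a c)
          measurable_const measurable_id).mul
          ((hK c b).comp₂ (f := fun x y => K x y c b) measurable_id measurable_const)
      · refine Filter.Eventually.of_forall fun ξ _ => ?_
        rw [Real.norm_eq_abs]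
        refine (Finset.abs_sum_le_sum_abs _ _).trans ?_
        refine (Finset.sum_le_card_nsmul _ _ (B * (1 / 2) ^ n * M) fun c _ => ?_).trans
          (le_of_eq ?_)
        · rw [abs_mul]
          exact mul_le_mul (hbound n x ξ a c) (hKM ξ y c b) (abs_nonneg _) (by positivity)
        · rw [nsmul_eq_mul, Finset.card_univ]
      · refine Filter.Eventually.of_forall fun ξ _ => ?_
        exact (hgeom.mul_right M).mul_left _
      · exact intervalIntegrable_const
      · refine Filter.Eventually.of_forall fun ξ _ => ?_
        exact hasSum_sum fun c _ => (hsum x ξ a c).hasSum.mul_right _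
    have h1 := (hsum x y a b).tsum_eq_zero_add
    have h2 : ∑' n, neumannTerm K (n + 1) x y a b =
        - ∫ ξ in (0 : ℝ)..1, ∑ c, (∑' n, neumannTerm K n x ξ a c) * K ξ y c b := by
      rw [← hswap.tsum_eq, ← tsum_neg]
      rfl
    dsimp only
    rw [h1, h2]
    simp only [neumannTerm]
    ring

/-- Inversion of a Volterra equation by means of the resolvent. -/
theorem volterra_inverse {R : ℝ → ℝ → Matrix I I ℝ} {w g : ℝ → I → ℝ}
    (hK : ∀ a b, BdMeas (fun z : ℝ × ℝ => K z.1 z.2 a b))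
    (hR : ∀ a b, BdMeas (fun z : ℝ × ℝ => R z.1 z.2 a b))
    (hRK : ∀ x y a b, R x y a b + K x y a b + ∫ ξ in (0 : ℝ)..1, ∑ c, R x ξ a c * K ξ y c b = 0)
    (hw : ∀ a, BdMeas (fun x => w x a))
    (hg : ∀ x ∈ Icc (0 : ℝ) 1, ∀ a, g x a = w x a + ∫ y in (0 : ℝ)..1, ∑ b, K x y a b * w y b)
    {x : ℝ} (hx : x ∈ Icc (0 : ℝ) 1) (a : I) :
    w x a = g x a + ∫ y in (0 : ℝ)..1, ∑ b, R x y a b * g y b := by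
  have hKs : ∀ x a b, BdMeas (fun y => K x y a b) := fun x a b =>
    (hK a b).comp₂ (f := fun x y => K x y a b) measurable_const measurable_id
  have hRs : ∀ x a b, BdMeas (fun y => R x y a b) := fun x a b =>
    (hR a b).comp₂ (f := fun x y => R x y a b) measurable_const measurable_id
  have hKw : ∀ b, BdMeas (fun y => ∫ ξ in (0 : ℝ)..1, ∑ c, K y ξ b c * w ξ c) := fun b =>
    BdMeas.intervalIntegral (f := fun y ξ => ∑ c, K y ξ b c * w ξ c)
      (BdMeas.sum _ fun c _ => (hK b c).mul ((hw c).comp measurable_snd)) 0 1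
  have e1 : ∫ y in (0 : ℝ)..1, ∑ b, R x y a b * g y b =
      (∫ y in (0 : ℝ)..1, ∑ b, R x y a b * w y b) +
        ∫ y in (0 : ℝ)..1, ∑ b, R x y a b * ∫ ξ in (0 : ℝ)..1, ∑ c, K y ξ b c * w ξ c := by
    rw [← intervalIntegral.integral_add
      ((BdMeas.sum _ fun b _ => (hRs x a b).mul (hw b)).intervalIntegrable _ _)
      ((BdMeas.sum _ fun b _ => (hRs x a b).mul (hKw b)).intervalIntegrable _ _)]
    refine intervalIntegral.integral_congr fun y hy => ?_
    rw [uIcc_of_le zero_le_one] at hy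
    simp only [hg y hy, mul_add, Finset.sum_add_distrib]
  have e2 : ∫ y in (0 : ℝ)..1, ∑ b, R x y a b * ∫ ξ in (0 : ℝ)..1, ∑ c, K y ξ b c * w ξ c =
      ∫ y in (0 : ℝ)..1, ∫ ξ in (0 : ℝ)..1, ∑ c, ∑ b, R x y a b * K y ξ b c * w ξ c := by
    refine intervalIntegral.integral_congr fun y _ => ?_
    simp only [← intervalIntegral.integral_const_mul]
    rw [← intervalIntegral.integral_finsetSum fun b _ =>
      ((BdMeas.sum _ fun c _ => (hKs y b c).mul (hw c)).const_mul _).intervalIntegrable _ _]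
    refine intervalIntegral.integral_congr fun ξ _ => ?_
    simp only [Finset.mul_sum]
    rw [Finset.sum_comm]
    simp only [mul_assoc]
  have e3 : ∫ y in (0 : ℝ)..1, ∫ ξ in (0 : ℝ)..1, ∑ c, ∑ b, R x y a b * K y ξ b c * w ξ c =
      ∫ ξ in (0 : ℝ)..1, ∑ c, (∫ y in (0 : ℝ)..1, ∑ b, R x y a b * K y ξ b c) * w ξ c := by
    rw [BdMeas.intervalIntegral_swap (f := fun y ξ => ∑ c, ∑ b, R x y a b * K y ξ b c * w ξ c)
      (BdMeas.sum _ fun c _ => BdMeas.sum _ fun b _ =>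
        (((hRs x a b).comp measurable_fst).mul (hK b c)).mul ((hw c).comp measurable_snd))
      zero_le_one zero_le_one]
    refine intervalIntegral.integral_congr fun ξ _ => ?_
    have hb : ∀ b c, BdMeas (fun y => R x y a b * K y ξ b c) := fun b c =>
      (hRs x a b).mul ((hK b c).comp₂ (f := fun x y => K x y b c) measurable_id measurable_const)
    rw [intervalIntegral.integral_finsetSum fun c _ => (BdMeas.sum _ fun b _ =>
      (hb b c).mul (BdMeas.const (w ξ c))).intervalIntegrable _ _]
    refine Finset.sum_congr rfl fun c _ => ?_
    rw [← intervalIntegral.integral_mul_const]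
    simp only [Finset.sum_mul]
  have e4 : ∫ ξ in (0 : ℝ)..1, ∑ c, (∫ y in (0 : ℝ)..1, ∑ b, R x y a b * K y ξ b c) * w ξ c =
      - (∫ y in (0 : ℝ)..1, ∑ b, R x y a b * w y b) - ∫ y in (0 : ℝ)..1, ∑ b, K x y a b * w y b := by
    rw [← intervalIntegral.integral_neg, ← intervalIntegral.integral_sub
      ((BdMeas.sum _ fun b _ => (hRs x a b).mul (hw b)).neg.intervalIntegrable _ _)
      ((BdMeas.sum _ fun b _ => (hKs x a b).mul (hw b)).intervalIntegrable _ _)]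
    refine intervalIntegral.integral_congr fun ξ _ => ?_
    rw [← Finset.sum_neg_distrib, ← Finset.sum_sub_distrib]
    refine Finset.sum_congr rfl fun c _ => ?_
    have := hRK x ξ a c
    have h2 : ∫ y in (0 : ℝ)..1, ∑ b, R x y a b * K y ξ b c = - R x ξ a c - K x ξ a c := by
      linarith
    rw [h2]
    ring
  rw [e1, e2, e3, e4, hg x hx a]
  ring

end

end HyperbolicChain

/-! ### Distributed delays -/

section DistributedDelay

variable {Ω X : Type*} [Fintype X] {S : Ω → X → ℝ → ℝ} {Tm : Ω → ℝ}

/-- The functional `Φ ω s x` of the signals `S ω` is a distributed delay with a bounded measurable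
kernel (depending on `x`), supported in `[0, T₀]`, for times `s ∈ [T₀, Tm ω]`. -/
def IsDistDelay (S : Ω → X → ℝ → ℝ) (Tm : Ω → ℝ) (T₀ : ℝ) (Φ : Ω → ℝ → ℝ → ℝ) : Prop :=
  ∃ k : X → ℝ → ℝ → ℝ, (∀ q, BdMeas (fun p : ℝ × ℝ => k q p.1 p.2)) ∧
    (∀ q x ν, ν ∉ Icc 0 T₀ → k q x ν = 0) ∧
    ∀ ω s, T₀ ≤ s → s ≤ Tm ω → ∀ x ∈ Icc (0 : ℝ) 1,
      Φ ω s x = ∑ q, ∫ ν, k q x ν * S ω q (s - ν)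

/-- `Φ` is bounded and measurable in `x`, and its integrals against bounded measurable kernels are
distributed delays. -/
def IsSmoothing (S : Ω → X → ℝ → ℝ) (Tm : Ω → ℝ) (T₀ : ℝ) (Φ : Ω → ℝ → ℝ → ℝ) : Prop :=
  (∀ ω s, BdMeas (Φ ω s)) ∧ ∀ c : ℝ → ℝ → ℝ, BdMeas (fun p : ℝ × ℝ => c p.1 p.2) →
    IsDistDelay S Tm T₀ (fun ω s x => ∫ y in (0 : ℝ)..1, c x y * Φ ω s y)

lemma BdMeas.kernel_mul_integrable {k S : ℝ → ℝ} (hk : BdMeas k) (hS : BdMeas S) {T₀ : ℝ} (s : ℝ)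
    (h0 : ∀ ν ∉ Icc 0 T₀, k ν = 0) : Integrable (fun ν => k ν * S (s - ν)) :=
  (hk.mul (hS.comp (e := fun ν => s - ν) (by fun_prop))).integrable (a := 0) (b := T₀)
    fun ν hν => by simp [h0 ν hν]

/-- Change of variables in the integral of a pointwise delay. -/
lemma intervalIntegral_point_eq (c S : ℝ → ℝ) (s : ℝ) {Y d₀ d₁ : ℝ} (hY : 0 ≤ Y) (hd₁ : d₁ ≠ 0) :
    ∫ y in (0 : ℝ)..Y, c y * S (s - (d₀ + d₁ * y)) =
      ∫ ν, (|d₁⁻¹| * (if (ν - d₀) / d₁ ∈ Icc 0 Y then c ((ν - d₀) / d₁) else 0)) * S (s - ν) := by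
  have h1 := Measure.integral_comp_mul_left (fun ν =>
    (if (ν + d₀ - d₀) / d₁ ∈ Icc 0 Y then c ((ν + d₀ - d₀) / d₁) else 0) * S (s - (ν + d₀))) d₁
  rw [integral_add_right_eq_self (fun ν => (if (ν - d₀) / d₁ ∈ Icc 0 Y then c ((ν - d₀) / d₁)
    else 0) * S (s - ν)), smul_eq_mul, ← integral_const_mul] at h1
  simp only [mul_assoc]
  rw [← h1]
  rw [← intervalIntegral_eq_integral_of_eq_zero hY]
  · refine intervalIntegral.integral_congr fun y hy => ?_
    rw [uIcc_of_le hY] at hy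
    have e : (d₁ * y + d₀ - d₀) / d₁ = y := by field_simp; ring
    simp only [add_comm d₀]
    rw [e, if_pos hy]
  · intro y hy
    have e : (d₁ * y + d₀ - d₀) / d₁ = y := by field_simp; ring
    simp only [e, if_neg hy, zero_mul]

/-- Fubini's theorem for a convolution kernel. -/
lemma intervalIntegral_conv_eq {c S : ℝ → ℝ} {k : ℝ → ℝ → ℝ} (hc : BdMeas c) (hS : BdMeas S)
    (hk : BdMeas (fun p : ℝ × ℝ => k p.1 p.2)) (s : ℝ) {Y T₁ : ℝ} (hY : 0 ≤ Y) (hT₁ : 0 ≤ T₁)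
    (hsupp : ∀ y ∈ Icc 0 Y, ∀ ν ∉ Icc 0 T₁, k y (ν - y) = 0) :
    ∫ y in (0 : ℝ)..Y, c y * ∫ ν, k y ν * S (s - y - ν) =
      ∫ ν, (∫ y in (0 : ℝ)..Y, c y * k y (ν - y)) * S (s - ν) := by
  have hbd : BdMeas (fun z : ℝ × ℝ => c z.1 * (k z.1 (z.2 - z.1) * S (s - z.2))) :=
    (hc.comp measurable_fst).mul ((hk.comp₂ (f := k) measurable_fst (by fun_prop)).mul
      (hS.comp (e := fun z : ℝ × ℝ => s - z.2) (by fun_prop)))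
  have e1 : ∫ y in (0 : ℝ)..Y, c y * ∫ ν, k y ν * S (s - y - ν) =
      ∫ y in (0 : ℝ)..Y, ∫ ν in (0 : ℝ)..T₁, c y * (k y (ν - y) * S (s - ν)) := by
    refine intervalIntegral.integral_congr fun y hy => ?_
    rw [uIcc_of_le hY] at hy
    rw [intervalIntegral.integral_const_mul, intervalIntegral_eq_integral_of_eq_zero hT₁
      fun ν hν => by simp [hsupp y hy ν hν]]
    rw [← integral_sub_right_eq_self (fun ν => k y ν * S (s - y - ν)) y]
    congr 2
    ext ν
    congr 2
    ring
  rw [e1, hbd.intervalIntegral_swap hY hT₁, intervalIntegral_eq_integral_of_eq_zero hT₁]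
  · congr 1
    ext ν
    rw [← intervalIntegral.integral_mul_const]
    simp only [mul_assoc]
  · intro ν hν
    rw [intervalIntegral.integral_congr (g := fun _ => 0), intervalIntegral.integral_zero]
    intro y hy
    rw [uIcc_of_le hY] at hy
    simp [hsupp y hy ν hν]

namespace IsDistDelay

variable {T₀ T₁ : ℝ} {Φ Ψ : Ω → ℝ → ℝ → ℝ}

lemma mono (h : IsDistDelay S Tm T₀ Φ) (hT : T₀ ≤ T₁) : IsDistDelay S Tm T₁ Φ := by
  obtain ⟨k, hk, hk0, hΦ⟩ := h
  exact ⟨k, hk, fun q x ν hν => hk0 q x ν fun h => hν ⟨h.1, h.2.trans hT⟩,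
    fun ω s hs hs' => hΦ ω s (hT.trans hs) hs'⟩

lemma congr (h : IsDistDelay S Tm T₀ Φ)
    (hΦΨ : ∀ ω s, T₀ ≤ s → s ≤ Tm ω → ∀ x ∈ Icc (0 : ℝ) 1, Ψ ω s x = Φ ω s x) :
    IsDistDelay S Tm T₀ Ψ := by
  obtain ⟨k, hk, hk0, hΦ⟩ := h
  exact ⟨k, hk, hk0, fun ω s hs hs' x hx => (hΦΨ ω s hs hs' x hx).trans (hΦ ω s hs hs' x hx)⟩

lemma zero : IsDistDelay S Tm T₀ (fun _ _ _ => 0) :=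
  ⟨fun _ _ _ => 0, fun _ => BdMeas.const 0, fun _ _ _ _ => rfl, fun _ _ _ _ _ _ => by simp⟩

lemma add (hS : ∀ ω q, BdMeas (S ω q)) (hΦ : IsDistDelay S Tm T₀ Φ) (hΨ : IsDistDelay S Tm T₀ Ψ) :
    IsDistDelay S Tm T₀ (fun ω s x => Φ ω s x + Ψ ω s x) := by
  obtain ⟨k, hk, hk0, hΦ⟩ := hΦ
  obtain ⟨l, hl, hl0, hΨ⟩ := hΨ
  refine ⟨fun q x ν => k q x ν + l q x ν, fun q => (hk q).add (hl q),
    fun q x ν hν => by simp [hk0 q x ν hν, hl0 q x ν hν], fun ω s hs hs' x hx => ?_⟩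
  dsimp only
  rw [hΦ ω s hs hs' x hx, hΨ ω s hs hs' x hx, ← Finset.sum_add_distrib]
  refine Finset.sum_congr rfl fun q _ => ?_
  have i1 : BdMeas (k q x) := (hk q).comp₂ (f := k q) measurable_const measurable_id
  have i2 : BdMeas (l q x) := (hl q).comp₂ (f := l q) measurable_const measurable_id
  rw [← integral_add (i1.kernel_mul_integrable (hS ω q) s (hk0 q x))
    (i2.kernel_mul_integrable (hS ω q) s (hl0 q x))]
  simp only [add_mul]

lemma const_mul (hΦ : IsDistDelay S Tm T₀ Φ) (c : ℝ) :
    IsDistDelay S Tm T₀ (fun ω s x => c * Φ ω s x) := by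
  obtain ⟨k, hk, hk0, hΦ⟩ := hΦ
  refine ⟨fun q x ν => c * k q x ν, fun q => (hk q).const_mul c,
    fun q x ν hν => by simp [hk0 q x ν hν], fun ω s hs hs' x hx => ?_⟩
  dsimp only
  rw [hΦ ω s hs hs' x hx, Finset.mul_sum]
  refine Finset.sum_congr rfl fun q _ => ?_
  simp only [mul_assoc]
  rw [integral_const_mul]

lemma sum (hS : ∀ ω q, BdMeas (S ω q)) {ι : Type*} (s : Finset ι) {Φ : ι → Ω → ℝ → ℝ → ℝ}
    (h : ∀ i ∈ s, IsDistDelay S Tm T₀ (Φ i)) :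
    IsDistDelay S Tm T₀ (fun ω t x => ∑ i ∈ s, Φ i ω t x) := by
  classical
  induction s using Finset.induction_on with
  | empty => simpa using zero
  | insert i s hi ih =>
    simp only [Finset.sum_insert hi]
    exact (h i (Finset.mem_insert_self _ _)).add hS
      (ih fun j hj => h j (Finset.mem_insert_of_mem hj))

lemma single {k : ℝ → ℝ → ℝ} (hk : BdMeas (fun p : ℝ × ℝ => k p.1 p.2))
    (hk0 : ∀ x ν, ν ∉ Icc 0 T₀ → k x ν = 0) (q : X) :
    IsDistDelay S Tm T₀ (fun ω s x => ∫ ν, k x ν * S ω q (s - ν)) := by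
  classical
  refine ⟨fun q' x ν => if q' = q then k x ν else 0, fun q' => ?_, fun q' x ν hν => ?_,
    fun ω s _ _ x _ => ?_⟩
  · by_cases h : q' = q
    · simpa [h] using hk
    · simpa [h] using BdMeas.const 0
  · by_cases h : q' = q
    · simpa [h] using hk0 x ν hν
    · simp [h]
  · rw [Finset.sum_eq_single q]
    · simp
    · intro q' _ h; simp [h]
    · simp

/-- Integral of a pointwise delay that depends affinely on the variable of integration. -/
lemma integral_point {c : ℝ → ℝ → ℝ} (hc : BdMeas (fun p : ℝ × ℝ => c p.1 p.2)) {Y d₀ d₁ : ℝ}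
    (hY : 0 ≤ Y) (hd₁ : d₁ ≠ 0) (hd : ∀ y ∈ Icc 0 Y, d₀ + d₁ * y ∈ Icc 0 T₀) (q : X) :
    IsDistDelay S Tm T₀ (fun ω s x => ∫ y in (0 : ℝ)..Y, c x y * S ω q (s - (d₀ + d₁ * y))) := by
  classical
  have hm : MeasurableSet {p : ℝ × ℝ | (p.2 - d₀) / d₁ ∈ Icc 0 Y} :=
    (show Measurable fun p : ℝ × ℝ => (p.2 - d₀) / d₁ by fun_prop) measurableSet_Icc
  have hk : BdMeas (fun p : ℝ × ℝ => |d₁⁻¹| *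
      (if (p.2 - d₀) / d₁ ∈ Icc 0 Y then c p.1 ((p.2 - d₀) / d₁) else 0)) :=
    ((hc.comp₂ (e := fun p : ℝ × ℝ => p.1) (e' := fun p : ℝ × ℝ => (p.2 - d₀) / d₁)
      measurable_fst (by fun_prop)).ite_zero hm).const_mul _
  refine (single (S := S) (Tm := Tm) (T₀ := T₀) (k := fun x ν => |d₁⁻¹| *
    (if (ν - d₀) / d₁ ∈ Icc 0 Y then c x ((ν - d₀) / d₁) else 0)) hk ?_ q).congr ?_
  · intro x ν hν
    rw [if_neg, mul_zero]
    intro h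
    have := hd _ h
    rw [mul_div_cancel₀ _ hd₁] at this
    exact hν (by simpa using this)
  · intro ω s _ _ x _
    simpa only using intervalIntegral_point_eq (c x) (S ω q) s hY hd₁

/-- Delaying a distributed delay. -/
lemma shift (hΦ : IsDistDelay S Tm T₀ Φ) {d e : ℝ → ℝ} (hd : Measurable d) (he : Measurable e)
    {D : ℝ} (hdD : ∀ x ∈ Icc (0 : ℝ) 1, d x ∈ Icc 0 D)
    (he1 : ∀ x ∈ Icc (0 : ℝ) 1, e x ∈ Icc (0 : ℝ) 1) :
    IsDistDelay S Tm (T₀ + D) (fun ω s x => Φ ω (s - d x) (e x)) := by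
  classical
  obtain ⟨k, hk, hk0, hΦ⟩ := hΦ
  refine ⟨fun q x ν => if x ∈ Icc (0 : ℝ) 1 then k q (e x) (ν - d x) else 0, fun q => ?_,
    fun q x ν hν => ?_, fun ω s hs hs' x hx => ?_⟩
  · exact ((hk q).comp₂ (f := k q) (e := fun p : ℝ × ℝ => e p.1)
      (e' := fun p : ℝ × ℝ => p.2 - d p.1) (by fun_prop) (by fun_prop)).ite_zero
      (p := fun p : ℝ × ℝ => p.1 ∈ Icc (0 : ℝ) 1) (measurable_fst measurableSet_Icc)
  · dsimp only
    split_ifs with hx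
    · refine hk0 q _ _ fun h => hν ⟨?_, ?_⟩
      · linarith [h.1, (hdD x hx).1]
      · linarith [h.2, (hdD x hx).2]
    · rfl
  · dsimp only
    rw [hΦ ω (s - d x) (by linarith [(hdD x hx).2]) (by linarith [(hdD x hx).1]) _ (he1 x hx)]
    refine Finset.sum_congr rfl fun q _ => ?_
    simp only [if_pos hx]
    rw [← integral_sub_right_eq_self (fun ν => k q (e x) ν * S ω q (s - d x - ν)) (d x)]
    congr 1
    ext ν
    congr 2
    ring

/-- Integrating a delayed distributed delay. -/
lemma integral_shift (hS : ∀ ω q, BdMeas (S ω q)) (hΦ : IsDistDelay S Tm T₀ Φ) {c : ℝ → ℝ → ℝ}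
    (hc : BdMeas (fun p : ℝ × ℝ => c p.1 p.2)) {d e : ℝ → ℝ} (hd : Measurable d)
    (he : Measurable e) {D Y : ℝ} (hY : 0 ≤ Y) (hT : 0 ≤ T₀ + D)
    (hdD : ∀ y ∈ Icc (0 : ℝ) Y, d y ∈ Icc 0 D)
    (he1 : ∀ y ∈ Icc (0 : ℝ) Y, e y ∈ Icc (0 : ℝ) 1) :
    IsDistDelay S Tm (T₀ + D)
      (fun ω s x => ∫ y in (0 : ℝ)..Y, c x y * Φ ω (s - d y) (e y)) := by
  obtain ⟨k, hk, hk0, hΦ⟩ := hΦ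
  have hsupp : ∀ q y ν, y ∈ Icc 0 Y → ν ∉ Icc 0 (T₀ + D) → k q (e y) (ν - d y) = 0 := by
    intro q y ν hy hν
    refine hk0 q _ _ fun h => hν ⟨?_, ?_⟩
    · linarith [h.1, (hdD y hy).1]
    · linarith [h.2, (hdD y hy).2]
  refine ⟨fun q x ν => ∫ y in (0 : ℝ)..Y, c x y * k q (e y) (ν - d y), fun q => ?_,
    fun q x ν hν => ?_, fun ω s hs hs' x hx => ?_⟩
  · refine BdMeas.intervalIntegral (f := fun (p : ℝ × ℝ) y => c p.1 y * k q (e y) (p.2 - d y))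
      ?_ 0 Y
    exact (hc.comp₂ (f := c) (e := fun z : (ℝ × ℝ) × ℝ => z.1.1)
        (e' := fun z : (ℝ × ℝ) × ℝ => z.2) (by fun_prop) (by fun_prop)).mul
      ((hk q).comp₂ (f := k q) (e := fun z : (ℝ × ℝ) × ℝ => e z.2)
        (e' := fun z : (ℝ × ℝ) × ℝ => z.1.2 - d z.2) (by fun_prop) (by fun_prop))
  · dsimp only
    rw [intervalIntegral.integral_congr (g := fun _ => 0), intervalIntegral.integral_zero]
    intro y hy
    rw [uIcc_of_le hY] at hy
    simp [hsupp q y ν hy hν]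
  · have hbd : ∀ q, BdMeas (fun z : ℝ × ℝ =>
        c x z.1 * (k q (e z.1) (z.2 - d z.1) * S ω q (s - z.2))) := fun q =>
      (hc.comp₂ (f := c) (e := fun z : ℝ × ℝ => x) (e' := fun z : ℝ × ℝ => z.1)
        (by fun_prop) (by fun_prop)).mul
      (((hk q).comp₂ (f := k q) (e := fun z : ℝ × ℝ => e z.1)
        (e' := fun z : ℝ × ℝ => z.2 - d z.1) (by fun_prop) (by fun_prop)).mul
        ((hS ω q).comp (e := fun z : ℝ × ℝ => s - z.2) (by fun_prop)))
    have e1 : ∫ y in (0 : ℝ)..Y, c x y * Φ ω (s - d y) (e y) =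
        ∫ y in (0 : ℝ)..Y, ∑ q, ∫ ν in (0 : ℝ)..(T₀ + D),
          c x y * (k q (e y) (ν - d y) * S ω q (s - ν)) := by
      refine intervalIntegral.integral_congr fun y hy => ?_
      rw [uIcc_of_le hY] at hy
      rw [hΦ ω (s - d y) (by linarith [(hdD y hy).2]) (by linarith [(hdD y hy).1]) _ (he1 y hy),
        Finset.mul_sum]
      refine Finset.sum_congr rfl fun q _ => ?_
      rw [intervalIntegral.integral_const_mul]
      congr 1
      rw [intervalIntegral_eq_integral_of_eq_zero hT fun ν hν => by
        simp [hsupp q y ν hy hν]]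
      rw [← integral_sub_right_eq_self (fun ν => k q (e y) ν * S ω q (s - d y - ν)) (d y)]
      congr 1
      ext ν
      congr 2
      ring
    dsimp only
    rw [e1, intervalIntegral.integral_finsetSum fun q _ =>
      ((hbd q).intervalIntegral 0 (T₀ + D)).intervalIntegrable _ _]
    refine Finset.sum_congr rfl fun q _ => ?_
    rw [(hbd q).intervalIntegral_swap hY hT]
    rw [intervalIntegral_eq_integral_of_eq_zero hT]
    · congr 1
      ext ν
      rw [← intervalIntegral.integral_mul_const]
      simp only [mul_assoc]
    · intro ν hν
      rw [intervalIntegral.integral_congr (g := fun _ => 0), intervalIntegral.integral_zero]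
      intro y hy
      rw [uIcc_of_le hY] at hy
      simp [hsupp q y ν hy hν]

lemma isSmoothing (hS : ∀ ω q, BdMeas (S ω q)) (hT : 0 ≤ T₀) (hΦ : IsDistDelay S Tm T₀ Φ)
    (hb : ∀ ω s, BdMeas (Φ ω s)) : IsSmoothing S Tm T₀ Φ := by
  refine ⟨hb, fun c hc => ?_⟩
  have := hΦ.integral_shift hS hc (d := fun _ => 0) (e := id) measurable_const measurable_id
    (D := 0) (Y := 1) zero_le_one (by simpa using hT) (fun _ _ => by simp) fun _ hy => hy
  simpa using this

end IsDistDelay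

namespace IsSmoothing

variable {T₀ T₁ : ℝ} {Φ Ψ : Ω → ℝ → ℝ → ℝ}

lemma mono (h : IsSmoothing S Tm T₀ Φ) (hT : T₀ ≤ T₁) : IsSmoothing S Tm T₁ Φ :=
  ⟨h.1, fun c hc => (h.2 c hc).mono hT⟩

lemma congr (h : IsSmoothing S Tm T₀ Φ) (hb : ∀ ω s, BdMeas (Ψ ω s))
    (hΦΨ : ∀ ω s, T₀ ≤ s → s ≤ Tm ω → ∀ x ∈ Icc (0 : ℝ) 1, Ψ ω s x = Φ ω s x) :
    IsSmoothing S Tm T₀ Ψ := by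
  refine ⟨hb, fun c hc => (h.2 c hc).congr fun ω s hs hs' x _ => ?_⟩
  refine intervalIntegral.integral_congr fun y hy => ?_
  rw [uIcc_of_le zero_le_one] at hy
  simp only [hΦΨ ω s hs hs' y hy]

lemma add (hS : ∀ ω q, BdMeas (S ω q)) (hΦ : IsSmoothing S Tm T₀ Φ) (hΨ : IsSmoothing S Tm T₀ Ψ) :
    IsSmoothing S Tm T₀ (fun ω s x => Φ ω s x + Ψ ω s x) := by
  refine ⟨fun ω s => (hΦ.1 ω s).add (hΨ.1 ω s), fun c hc =>
    ((hΦ.2 c hc).add hS (hΨ.2 c hc)).congr fun ω s _ _ x _ => ?_⟩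
  have i : BdMeas (c x) := hc.comp₂ (f := c) measurable_const measurable_id
  rw [← intervalIntegral.integral_add ((i.mul (hΦ.1 ω s)).intervalIntegrable _ _)
    ((i.mul (hΨ.1 ω s)).intervalIntegrable _ _)]
  simp only [mul_add]

lemma const_mul (hΦ : IsSmoothing S Tm T₀ Φ) (a : ℝ) :
    IsSmoothing S Tm T₀ (fun ω s x => a * Φ ω s x) := by
  refine ⟨fun ω s => (hΦ.1 ω s).const_mul a, fun c hc =>
    ((hΦ.2 c hc).const_mul a).congr fun ω s _ _ x _ => ?_⟩
  rw [← intervalIntegral.integral_const_mul]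
  refine intervalIntegral.integral_congr fun y _ => ?_
  dsimp only
  ring

lemma sum (hS : ∀ ω q, BdMeas (S ω q)) {ι : Type*} (s : Finset ι) {Φ : ι → Ω → ℝ → ℝ → ℝ}
    (h : ∀ i ∈ s, IsSmoothing S Tm T₀ (Φ i)) :
    IsSmoothing S Tm T₀ (fun ω t x => ∑ i ∈ s, Φ i ω t x) := by
  classical
  induction s using Finset.induction_on with
  | empty =>
    refine ⟨fun _ _ => by simpa using BdMeas.const 0, fun c _ => ?_⟩
    simpa using IsDistDelay.zero
  | insert i s hi ih =>
    simp only [Finset.sum_insert hi]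
    exact (h i (Finset.mem_insert_self _ _)).add hS
      (ih fun j hj => h j (Finset.mem_insert_of_mem hj))

/-- Pointwise delays depending affinely on `x`. -/
lemma point (hS : ∀ ω q, BdMeas (S ω q)) {d₀ d₁ : ℝ} (hd₁ : d₁ ≠ 0)
    (hd : ∀ y ∈ Icc (0 : ℝ) 1, d₀ + d₁ * y ∈ Icc 0 T₀) (q : X) :
    IsSmoothing S Tm T₀ (fun ω s x => S ω q (s - (d₀ + d₁ * x))) :=
  ⟨fun ω s => (hS ω q).comp (e := fun x => s - (d₀ + d₁ * x)) (by fun_prop), fun _ hc =>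
    IsDistDelay.integral_point hc zero_le_one hd₁ hd q⟩

end IsSmoothing

end DistributedDelay

/-- Solution of a triangular system of transport equations: each component is a pointwise delay of
its boundary value, plus distributed delays of the boundary values of the faster components. -/
theorem exists_triangular_kernel {n : ℕ} {lam : Fin n → ℝ} {lam₁ : ℝ} (hlam₁ : 0 < lam₁)
    (hle : ∀ k, lam₁ ≤ lam k) (hmono : StrictMono lam) {G : ℝ → Matrix (Fin n) (Fin n) ℝ}
    (hG : ∀ k q, BdMeas (fun x => G x k q)) :
    ∃ g : Fin n → Fin n → ℝ → ℝ → ℝ, (∀ k q, BdMeas (fun p : ℝ × ℝ => g k q p.1 p.2)) ∧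
      (∀ k q x ν, ν ∉ Icc 0 (x / lam k) → g k q x ν = 0) ∧
      ∀ (z : ℝ → ℝ → Fin n → ℝ) (T : ℝ), (∀ k, BdMeas (fun p : ℝ × ℝ => z p.1 p.2 k)) →
        (∀ k, ∀ x ∈ Icc (0 : ℝ) 1, ∀ s, x / lam₁ ≤ s → s ≤ T →
          z s x k = z (s - x / lam k) 0 k + ∫ r in (0 : ℝ)..(x / lam k),
            ∑ q with k < q, G (x - lam k * r) k q * z (s - r) (x - lam k * r) q) →
        ∀ k, ∀ x ∈ Icc (0 : ℝ) 1, ∀ s, x / lam₁ ≤ s → s ≤ T →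
          z s x k = z (s - x / lam k) 0 k +
            ∑ q with k < q, ∫ ν, g k q x ν * z (s - ν) 0 q := by
  have hpos : ∀ k, 0 < lam k := fun k => hlam₁.trans_le (hle k)
  suffices H : ∀ k, ∃ g : Fin n → ℝ → ℝ → ℝ, (∀ q, BdMeas (fun p : ℝ × ℝ => g q p.1 p.2)) ∧
      (∀ q x ν, ν ∉ Icc 0 (x / lam k) → g q x ν = 0) ∧
      ∀ (z : ℝ → ℝ → Fin n → ℝ) (T : ℝ), (∀ k, BdMeas (fun p : ℝ × ℝ => z p.1 p.2 k)) →
        (∀ k, ∀ x ∈ Icc (0 : ℝ) 1, ∀ s, x / lam₁ ≤ s → s ≤ T →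
          z s x k = z (s - x / lam k) 0 k + ∫ r in (0 : ℝ)..(x / lam k),
            ∑ q with k < q, G (x - lam k * r) k q * z (s - r) (x - lam k * r) q) →
        ∀ x ∈ Icc (0 : ℝ) 1, ∀ s, x / lam₁ ≤ s → s ≤ T →
          z s x k = z (s - x / lam k) 0 k +
            ∑ q with k < q, ∫ ν, g q x ν * z (s - ν) 0 q by
    choose g h1 h2 h3 using H
    exact ⟨g, h1, h2, fun z T hz heq k => h3 k z T hz heq⟩
  intro k
  induction k using WellFoundedGT.induction with
  | ind k ih =>
  choose! g hg hg0 hgz using ih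
  set θ : Fin n → ℝ := fun q => 1 - lam k / lam q with hθ
  have hθpos : ∀ q, k < q → 0 < θ q := fun q hq =>
    sub_pos.2 ((div_lt_one (hpos q)).2 (hmono hq))
  -- kernels of the two contributions of the component `q`
  set A : Fin n → ℝ → ℝ → ℝ := fun q x ν => |(θ q)⁻¹| *
    (if (ν - x / lam q) / θ q ∈ Icc 0 (x / lam k) then
      G (x - lam k * ((ν - x / lam q) / θ q)) k q else 0) with hA
  set B : Fin n → Fin n → ℝ → ℝ → ℝ := fun q q' x ν => ∫ r in (0 : ℝ)..(1 / lam k),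
    (if r ∈ Icc 0 (x / lam k) then
      G (x - lam k * r) k q * g q q' (x - lam k * r) (ν - r) else 0) with hB
  have hAbd : ∀ q, BdMeas (fun p : ℝ × ℝ => A q p.1 p.2) := by
    intro q
    have hm : MeasurableSet {p : ℝ × ℝ |
        (p.2 - p.1 / lam q) / θ q ∈ Icc 0 (p.1 / lam k)} := by
      simp only [mem_Icc, Set.ofPred_and]
      exact (measurableSet_le (by fun_prop) (by fun_prop)).inter
        (measurableSet_le (by fun_prop) (by fun_prop))
    exact (((hG k q).comp (e := fun p : ℝ × ℝ => p.1 - lam k * ((p.2 - p.1 / lam q) / θ q))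
      (by fun_prop)).ite_zero hm).const_mul _
  have hBbd : ∀ q q', k < q → BdMeas (fun p : ℝ × ℝ => B q q' p.1 p.2) := by
    intro q q' hq
    refine BdMeas.intervalIntegral (f := fun (p : ℝ × ℝ) r => if r ∈ Icc 0 (p.1 / lam k) then
      G (p.1 - lam k * r) k q * g q q' (p.1 - lam k * r) (p.2 - r) else 0) ?_ 0 (1 / lam k)
    refine BdMeas.ite_zero (p := fun z : (ℝ × ℝ) × ℝ => z.2 ∈ Icc 0 (z.1.1 / lam k)) (BdMeas.mul ?_ ?_) ?_
    · exact (hG k q).comp (e := fun z : (ℝ × ℝ) × ℝ => z.1.1 - lam k * z.2) (by fun_prop)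
    · exact (hg q hq q').comp₂ (f := g q q') (e := fun z : (ℝ × ℝ) × ℝ => z.1.1 - lam k * z.2)
        (e' := fun z : (ℝ × ℝ) × ℝ => z.1.2 - z.2) (by fun_prop) (by fun_prop)
    · simp only [mem_Icc, Set.ofPred_and]
      exact (measurableSet_le (by fun_prop) (by fun_prop)).inter
        (measurableSet_le (by fun_prop) (by fun_prop))
  have hdelay : ∀ q, k < q → ∀ x r, r ≤ x / lam k → r + (x - lam k * r) / lam q ≤ x / lam k := by
    intro q hq x r hr
    have h1 : r + (x - lam k * r) / lam q = x / lam q + θ q * r := by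
      rw [hθ]; field_simp; ring
    have h2 : x / lam k = x / lam q + θ q * (x / lam k) := by
      have := (hpos k).ne'
      have := (hpos q).ne'
      rw [hθ]; field_simp; ring
    rw [h1, h2]
    have := mul_le_mul_of_nonneg_left hr (hθpos q hq).le
    linarith
  have hA0 : ∀ q, k < q → ∀ x ν, ν ∉ Icc 0 (x / lam k) → A q x ν = 0 := by
    intro q hq x ν hν
    simp only [hA]
    rw [if_neg, mul_zero]
    intro h
    have hx : 0 ≤ x := by
      have := h.1.trans h.2
      rwa [le_div_iff₀ (hpos k), zero_mul] at this
    set r := (ν - x / lam q) / θ q with hr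
    have e : ν = r + (x - lam k * r) / lam q := by
      have h1 : θ q * r = ν - x / lam q := by rw [hr, mul_div_cancel₀ _ (hθpos q hq).ne']
      have h2 : r + (x - lam k * r) / lam q = x / lam q + θ q * r := by
        rw [hθ]; field_simp; ring
      rw [h2, h1]; ring
    refine hν ⟨?_, ?_⟩
    · have h1 : x - lam k * r ≥ 0 := by
        have := (le_div_iff₀ (hpos k)).1 h.2
        linarith
      rw [e]
      exact add_nonneg h.1 (div_nonneg h1 (hpos q).le)
    · rw [e]; exact hdelay q hq x r h.2
  have hgsupp : ∀ q, k < q → ∀ q' x r ν, 0 ≤ r → r ≤ x / lam k → ν ∉ Icc 0 (x / lam k) →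
      g q q' (x - lam k * r) (ν - r) = 0 := by
    intro q hq q' x r ν hr hrx hν
    refine hg0 q hq q' _ _ fun h => hν ⟨by linarith [h.1], ?_⟩
    have := hdelay q hq x r hrx
    linarith [h.2]
  have hB0 : ∀ q, k < q → ∀ q' x ν, ν ∉ Icc 0 (x / lam k) → B q q' x ν = 0 := by
    intro q hq q' x ν hν
    simp only [hB]
    rw [intervalIntegral.integral_congr (g := fun _ => 0), intervalIntegral.integral_zero]
    intro r hr
    rw [uIcc_of_le (one_div_nonneg.2 (hpos k).le)] at hr
    dsimp only
    split_ifs with h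
    · rw [hgsupp q hq q' x r ν hr.1 h.2 hν, mul_zero]
    · rfl
  refine ⟨fun q' x ν => (if k < q' then A q' x ν else 0) +
    ∑ q with k < q, (if q < q' then B q q' x ν else 0), fun q' => ?_, fun q' x ν hν => ?_, ?_⟩
  · refine BdMeas.add ?_ (BdMeas.sum _ fun q hq => ?_)
    · by_cases h : k < q'
      · simpa only [if_pos h] using hAbd q'
      · simpa only [if_neg h] using BdMeas.const 0
    · by_cases h : q < q'
      · simpa only [if_pos h] using hBbd q q' (Finset.mem_filter.1 hq).2
      · simpa only [if_neg h] using BdMeas.const 0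
  · have h1 : (if k < q' then A q' x ν else 0) = 0 := by
      split_ifs with h
      · exact hA0 q' h x ν hν
      · rfl
    dsimp only
    rw [h1, zero_add]
    refine Finset.sum_eq_zero fun q hq => ?_
    split_ifs with h
    · exact hB0 q (Finset.mem_filter.1 hq).2 q' x ν hν
    · rfl
  · intro z T hz heq x hx s hs hsT
    have hY : 0 ≤ x / lam k := div_nonneg hx.1 (hpos k).le
    have hz0 : ∀ q, BdMeas (fun t => z t 0 q) := fun q =>
      (hz q).comp₂ (f := fun t x => z t x q) measurable_id measurable_const
    have hGr : ∀ q, BdMeas (fun r => G (x - lam k * r) k q) := fun q =>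
      (hG k q).comp (e := fun r => x - lam k * r) (by fun_prop)
    have hzr : ∀ q, BdMeas (fun r => z (s - r) (x - lam k * r) q) := fun q =>
      (hz q).comp₂ (f := fun t x => z t x q) (by fun_prop) (by fun_prop)
    have hcomp : ∀ q, k < q → ∫ r in (0 : ℝ)..(x / lam k),
        G (x - lam k * r) k q * z (s - r) (x - lam k * r) q =
        (∫ ν, A q x ν * z (s - ν) 0 q) +
          ∑ q' with q < q', ∫ ν, B q q' x ν * z (s - ν) 0 q' := by
      intro q hq
      have e1 : ∫ r in (0 : ℝ)..(x / lam k),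
          G (x - lam k * r) k q * z (s - r) (x - lam k * r) q =
          ∫ r in (0 : ℝ)..(x / lam k),
            (G (x - lam k * r) k q * z (s - (x / lam q + θ q * r)) 0 q +
              ∑ q' with q < q', G (x - lam k * r) k q *
                ∫ ν, g q q' (x - lam k * r) ν * z (s - r - ν) 0 q') := by
        refine intervalIntegral.integral_congr fun r hr => ?_
        rw [uIcc_of_le hY] at hr
        have hm : x - lam k * r ∈ Icc (0 : ℝ) 1 := by
          have h1 := (le_div_iff₀ (hpos k)).1 hr.2
          have h2 := mul_nonneg (hpos k).le hr.1
          exact ⟨by linarith, by linarith [hx.2]⟩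
        have h3 : (x - lam k * r) / lam₁ ≤ s - r := by
          have h4 : (x - lam k * r) / lam₁ ≤ x / lam₁ - r := by
            rw [sub_div, sub_le_sub_iff_left, mul_div_right_comm]
            exact le_mul_of_one_le_left hr.1 ((one_le_div hlam₁).2 (hle k))
          linarith
        rw [hgz q hq z T hz heq _ hm (s - r) h3 (by linarith [hr.1]), mul_add, Finset.mul_sum]
        congr 3
        rw [hθ]
        have := (hpos q).ne'
        field_simp
        ring
      have i1 : BdMeas (fun r => G (x - lam k * r) k q * z (s - (x / lam q + θ q * r)) 0 q) :=
        (hGr q).mul ((hz0 q).comp (e := fun r => s - (x / lam q + θ q * r)) (by fun_prop))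
      have hgr : ∀ q', BdMeas (fun p : ℝ × ℝ =>
          (if p.1 ∈ Icc 0 (x / lam k) then g q q' (x - lam k * p.1) p.2 else 0)) := fun q' =>
        ((hg q hq q').comp₂ (f := g q q') (e := fun p : ℝ × ℝ => x - lam k * p.1)
          (by fun_prop) measurable_snd).ite_zero (p := fun p : ℝ × ℝ => p.1 ∈ Icc 0 (x / lam k))
          (measurable_fst measurableSet_Icc)
      have i2 : ∀ q', IntervalIntegrable (fun r => G (x - lam k * r) k q *
          ∫ ν, g q q' (x - lam k * r) ν * z (s - r - ν) 0 q') volume 0 (x / lam k) := by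
        intro q'
        have hb : BdMeas (fun r => G (x - lam k * r) k q * ∫ ν,
            (if r ∈ Icc 0 (x / lam k) then g q q' (x - lam k * r) ν else 0) *
              z (s - r - ν) 0 q') := by
          refine (hGr q).mul (BdMeas.integral (a := 0) (b := x / lam k) (f := fun r ν =>
            (if r ∈ Icc 0 (x / lam k) then g q q' (x - lam k * r) ν else 0) *
              z (s - r - ν) 0 q') ((hgr q').mul ((hz0 q').comp
              (e := fun p : ℝ × ℝ => s - p.1 - p.2) (by fun_prop))) ?_)
          intro r ν hν
          split_ifs with hr
          · have := hgsupp q hq q' x r (ν + r) hr.1 hr.2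
            rw [add_sub_cancel_right] at this
            by_cases h : ν + r ∈ Icc 0 (x / lam k)
            · rw [hg0 q hq q', zero_mul]
              intro h'
              exact hν ⟨h'.1, by linarith [h.2, hr.1]⟩
            · rw [this h, zero_mul]
          · rw [zero_mul]
        refine (hb.intervalIntegrable 0 (x / lam k)).congr fun r hr => ?_
        rw [uIoc_of_le hY] at hr
        simp only [if_pos (Ioc_subset_Icc_self hr)]
      have i3 : IntervalIntegrable (fun r => ∑ q' with q < q', G (x - lam k * r) k q *
          ∫ ν, g q q' (x - lam k * r) ν * z (s - r - ν) 0 q') volume 0 (x / lam k) := by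
        have := IntervalIntegrable.sum (Finset.univ.filter (q < ·)) fun q' _ => i2 q'
        refine this.congr fun r _ => ?_
        simp
      rw [e1, intervalIntegral.integral_add (i1.intervalIntegrable _ _)
        i3,
        intervalIntegral.integral_finsetSum fun q' _ => i2 q']
      congr 1
      · rw [intervalIntegral_point_eq (fun r => G (x - lam k * r) k q) (fun t => z t 0 q) s hY
          (hθpos q hq).ne']
      · refine Finset.sum_congr rfl fun q' _ => ?_
        have hconv := intervalIntegral_conv_eq (k := fun r ν =>
          if r ∈ Icc 0 (x / lam k) then g q q' (x - lam k * r) ν else 0) (hGr q) (hz0 q') (hgr q') s hY hY ?_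
        · have e2 : ∫ r in (0 : ℝ)..(x / lam k), G (x - lam k * r) k q *
              ∫ ν, g q q' (x - lam k * r) ν * z (s - r - ν) 0 q' =
              ∫ r in (0 : ℝ)..(x / lam k), G (x - lam k * r) k q * ∫ ν,
                (if r ∈ Icc 0 (x / lam k) then g q q' (x - lam k * r) ν else 0) *
                z (s - r - ν) 0 q' := by
            refine intervalIntegral.integral_congr fun r hr => ?_
            rw [uIcc_of_le hY] at hr
            simp only [if_pos hr]
          rw [e2, hconv]
          congr 1
          ext ν
          congr 1
          simp only [hB]
          refine intervalIntegral_eq_intervalIntegral_of_eq_zero le_rfl hY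
            (by have := hx.2; have := hpos k; gcongr) (fun r hr => ?_) fun r hr => ?_
          · simp only [if_pos hr]
          · rw [if_neg hr]
        · intro r hr ν hν
          simp only [if_pos hr]
          exact hgsupp q hq q' x r ν hr.1 hr.2 hν
    rw [heq k x hx s hs hsT, intervalIntegral.integral_finsetSum fun q _ =>
      ((hGr q).mul (hzr q)).intervalIntegrable _ _,
      Finset.sum_congr rfl fun q hq => hcomp q (Finset.mem_filter.1 hq).2,
      Finset.sum_add_distrib]
    have iA : ∀ q, k < q → Integrable (fun ν => A q x ν * z (s - ν) 0 q) := fun q hq =>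
      BdMeas.kernel_mul_integrable ((hAbd q).comp₂ (f := A q) measurable_const measurable_id)
        (hz0 q) s (hA0 q hq x)
    have iB : ∀ q, k < q → ∀ q', Integrable (fun ν => B q q' x ν * z (s - ν) 0 q') :=
      fun q hq q' => BdMeas.kernel_mul_integrable
        ((hBbd q q' hq).comp₂ (f := B q q') measurable_const measurable_id) (hz0 q') s
        (hB0 q hq q' x)
    have iB' : ∀ q, k < q → ∀ q', Integrable (fun ν =>
        (if q < q' then B q q' x ν else 0) * z (s - ν) 0 q') := by
      intro q hq q'
      by_cases h : q < q'
      · simpa only [if_pos h] using iB q hq q'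
      · simp [if_neg h]
    have hexp : ∀ q', k < q' → ∫ ν, ((if k < q' then A q' x ν else 0) +
        ∑ q with k < q, (if q < q' then B q q' x ν else 0)) * z (s - ν) 0 q' =
        (∫ ν, A q' x ν * z (s - ν) 0 q') + ∑ q with k < q,
          (if q < q' then ∫ ν, B q q' x ν * z (s - ν) 0 q' else 0) := by
      intro q' hq'
      simp only [if_pos hq', add_mul, Finset.sum_mul]
      rw [integral_add (iA q' hq') (integrable_finsetSum _ fun q hq =>
        iB' q (Finset.mem_filter.1 hq).2 q'), integral_finsetSum _ fun q hq =>
        iB' q (Finset.mem_filter.1 hq).2 q']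
      congr 1
      refine Finset.sum_congr rfl fun q _ => ?_
      split_ifs <;> simp
    rw [Finset.sum_congr rfl fun q' hq' => hexp q' (Finset.mem_filter.1 hq').2,
      Finset.sum_add_distrib, Finset.sum_comm (s := Finset.univ.filter (k < ·))]
    congr 2
    refine Finset.sum_congr rfl fun q hq => ?_
    have hkq := (Finset.mem_filter.1 hq).2
    simp only [Finset.sum_filter]
    refine Finset.sum_congr rfl fun q' _ => ?_
    by_cases h : q < q'
    · simp [h, hkq.trans h]
    · simp [h]

noncomputable section

namespace HyperbolicChain

variable {C : HyperbolicChain}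

lemma lam1_pos (C : HyperbolicChain) (j : ℕ) : 0 < C.lam1 j := C.lam_pos j _

lemma mu1_pos (C : HyperbolicChain) (j : ℕ) : 0 < C.mu1 j := C.mu_pos j _

lemma lam1_le (C : HyperbolicChain) (j : ℕ) (k : Fin (C.n j)) : C.lam1 j ≤ C.lam j k :=
  (C.lam_strictMono j).monotone (Fin.mk_le_of_le_val (Nat.zero_le _))

lemma mu1_le (C : HyperbolicChain) (j : ℕ) (l : Fin (C.m j)) : C.mu1 j ≤ C.mu j l :=
  (C.mu_strictMono j).monotone (Fin.mk_le_of_le_val (Nat.zero_le _))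

lemma speed_ne_zero (C : HyperbolicChain) (j : ℕ) (a : C.Idx j) : C.speed j a ≠ 0 := by
  cases a with
  | inl k => exact (C.lam_pos j k).ne'
  | inr l => exact neg_ne_zero.2 (C.mu_pos j l).ne'

/-! ### Truncation of the data to their domains -/

open Classical in
/-- The kernel `K_j`, extended by zero. -/
def Kernels.truncK (ker : C.Kernels) (j : ℕ) (x y : ℝ) : Matrix (C.Idx j) (C.Idx j) ℝ :=
  if (x, y) ∈ triK then ker.K j x y else 0

open Classical in
/-- The kernel `F_j`, extended by zero. -/
def Kernels.truncF (ker : C.Kernels) (j : ℕ) (x y : ℝ) :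
    Matrix (Fin (C.n j)) (Fin (C.m (j + 1))) ℝ :=
  if j + 1 < C.N ∧ (x, y) ∈ C.triF j then ker.F j x y else 0

open Classical in
/-- The in-domain coupling, extended by zero. -/
def truncSig (C : HyperbolicChain) (j : ℕ) (x : ℝ) : Matrix (C.Idx j) (C.Idx j) ℝ :=
  if x ∈ Icc (0 : ℝ) 1 then C.Sig j x else 0

open Classical in
/-- The coefficient `diag (G_j, 0)`, extended by zero. -/
def Kernels.truncG (ker : C.Kernels) (j : ℕ) (x : ℝ) : Matrix (C.Idx j) (C.Idx j) ℝ :=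
  if x ∈ Icc (0 : ℝ) 1 then ker.Gfull j x else 0

section
variable {ker : C.Kernels} {j : ℕ}

lemma truncK_of_mem {x y : ℝ} (h : (x, y) ∈ triK) : ker.truncK j x y = ker.K j x y := if_pos h

lemma truncK_of_notMem {x y : ℝ} (h : (x, y) ∉ triK) : ker.truncK j x y = 0 := if_neg h

lemma truncF_of_mem (hj : j + 1 < C.N) {x y : ℝ} (h : (x, y) ∈ C.triF j) :
    ker.truncF j x y = ker.F j x y := if_pos ⟨hj, h⟩

lemma truncF_of_notMem {x y : ℝ} (h : (x, y) ∉ C.triF j) : ker.truncF j x y = 0 :=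
  if_neg fun h' => h h'.2

lemma truncSig_of_mem {x : ℝ} (h : x ∈ Icc (0 : ℝ) 1) : C.truncSig j x = C.Sig j x := if_pos h

lemma truncG_of_mem {x : ℝ} (h : x ∈ Icc (0 : ℝ) 1) : ker.truncG j x = ker.Gfull j x := if_pos h

lemma measurableSet_triK : MeasurableSet triK := by
  unfold triK
  rw [Set.ofPred_and, Set.ofPred_and]
  exact (measurableSet_le (by fun_prop) (by fun_prop)).inter
    ((measurableSet_le (by fun_prop) (by fun_prop)).inter
      (measurableSet_le (by fun_prop) (by fun_prop)))

lemma measurableSet_triF (C : HyperbolicChain) (j : ℕ) : MeasurableSet (C.triF j) := by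
  unfold triF
  rw [Set.ofPred_and, Set.ofPred_and, Set.ofPred_and]
  exact (measurableSet_le (by fun_prop) (by fun_prop)).inter
    ((measurableSet_le (by fun_prop) (by fun_prop)).inter
    ((measurableSet_le (by fun_prop) (by fun_prop)).inter
      (measurableSet_le (by fun_prop) (by fun_prop))))

lemma diag_mem_triK {x : ℝ} (h : x ∈ Icc (0 : ℝ) 1) : (x, x) ∈ triK := ⟨h.1, le_rfl, h.2⟩

lemma right_mem_triK {x : ℝ} (h : x ∈ Icc (0 : ℝ) 1) : (x, 1) ∈ triK := ⟨h.1, h.2, le_rfl⟩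

lemma truncK_bdMeas (hker : ker.Solves) (hj : j < C.N) (a b : C.Idx j) :
    BdMeas (fun p : ℝ × ℝ => ker.truncK j p.1 p.2 a b) := by
  classical
  obtain ⟨M, hM⟩ := hker.K_bounded j hj
  refine BdMeas.of_eqOn_zero (s := triK) (M := M) ?_ (fun p hp => ?_) (fun p hp => ?_)
  · have : (fun p : ℝ × ℝ => ker.truncK j p.1 p.2 a b) =
        fun p => if p ∈ triK then ker.K j p.1 p.2 a b else 0 := by
      ext p
      unfold Kernels.truncK
      split_ifs <;> rfl
    rw [this]
    exact Measurable.ite measurableSet_triK (hker.K_measurable j hj a b) measurable_const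
  · rw [truncK_of_mem hp]; exact hM p.1 p.2 hp a b
  · rw [truncK_of_notMem hp]; rfl

lemma truncF_bdMeas (hker : ker.Solves) (k : Fin (C.n j)) (l : Fin (C.m (j + 1))) :
    BdMeas (fun p : ℝ × ℝ => ker.truncF j p.1 p.2 k l) := by
  classical
  by_cases hj : j + 1 < C.N
  · obtain ⟨M, hM⟩ := hker.F_bounded j hj
    refine BdMeas.of_eqOn_zero (s := C.triF j) (M := M) ?_ (fun p hp => ?_) (fun p hp => ?_)
    · have : (fun p : ℝ × ℝ => ker.truncF j p.1 p.2 k l) =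
          fun p => if p ∈ C.triF j then ker.F j p.1 p.2 k l else 0 := by
        ext p
        by_cases hp : p ∈ C.triF j
        · rw [if_pos hp, truncF_of_mem hj hp]
        · rw [if_neg hp, truncF_of_notMem hp]; rfl
      rw [this]
      exact Measurable.ite (C.measurableSet_triF j) (hker.F_measurable j hj k l) measurable_const
    · rw [truncF_of_mem hj hp]; exact hM p.1 p.2 hp k l
    · rw [truncF_of_notMem hp]; rfl
  · have : (fun p : ℝ × ℝ => ker.truncF j p.1 p.2 k l) = fun _ => 0 := by
      ext p
      unfold Kernels.truncF
      rw [if_neg fun h => hj h.1]; rfl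
    rw [this]
    exact BdMeas.const 0

lemma truncSig_bdMeas (a b : C.Idx j) : BdMeas (fun x => C.truncSig j x a b) := by
  classical
  obtain ⟨M, hM⟩ := isCompact_Icc.exists_bound_of_continuousOn (C.Sig_continuousOn j a b)
  refine BdMeas.of_eqOn_zero (s := Icc (0 : ℝ) 1) (M := M) ?_ (fun x hx => ?_) (fun x hx => ?_)
  · have : (fun x => C.truncSig j x a b) =
        (Icc (0 : ℝ) 1).piecewise (fun x => C.Sig j x a b) (fun _ => 0) := by
      ext x
      unfold truncSig piecewise
      split_ifs <;> rfl
    rw [this]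
    exact (C.Sig_continuousOn j a b).measurable_piecewise continuousOn_const measurableSet_Icc
  · rw [truncSig_of_mem hx]; exact hM x hx
  · unfold truncSig; rw [if_neg hx]; rfl

lemma truncG_bdMeas (hker : ker.Solves) (hj : j < C.N) (a b : C.Idx j) :
    BdMeas (fun x => ker.truncG j x a b) := by
  classical
  have h0 : ∀ x ∉ Icc (0 : ℝ) 1, ker.truncG j x = 0 := fun x hx => if_neg hx
  rcases a with k | l <;> rcases b with k' | l'
  · by_cases hk : k < k'
    · have h1 : BdMeas (fun x => C.truncSig j x (Sum.inl k) (Sum.inl k') +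
          (C.lam j k' - C.lam j k) * ker.truncK j x x (Sum.inl k) (Sum.inl k')) :=
        (truncSig_bdMeas _ _).add (((truncK_bdMeas hker hj _ _).comp₂
          (f := fun x y => ker.truncK j x y (Sum.inl k) (Sum.inl k'))
          measurable_id measurable_id).const_mul _)
      convert h1 using 2 with x
      by_cases hx : x ∈ Icc (0 : ℝ) 1
      · rw [truncG_of_mem hx, truncSig_of_mem hx, truncK_of_mem (diag_mem_triK hx)]
        simp [Kernels.Gfull, Kernels.G, hk]
      · have h2 : (x, x) ∉ triK := fun h => hx ⟨h.1, h.2.2⟩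
        rw [h0 x hx, truncK_of_notMem h2]
        unfold truncSig
        rw [if_neg hx]
        simp
    · convert BdMeas.const (α := ℝ) 0 using 2 with x
      by_cases hx : x ∈ Icc (0 : ℝ) 1
      · rw [truncG_of_mem hx]
        simp [Kernels.Gfull, Kernels.G, hk]
      · rw [h0 x hx]; rfl
  all_goals
    convert BdMeas.const (α := ℝ) 0 using 2 with x
    by_cases hx : x ∈ Icc (0 : ℝ) 1
    · rw [truncG_of_mem hx]
      simp [Kernels.Gfull]
    · rw [h0 x hx]; rfl

end

/-! ### Trajectories of one subsystem -/

/-- A bounded measurable trajectory of the subsystem `j` on `[0, T]`, driven by the downstream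
signal `vp = v_{j+1}(·, 0)`. -/
structure SubTrajectory (C : HyperbolicChain) (j : ℕ) where
  w : ℝ → ℝ → C.Idx j → ℝ
  vp : ℝ → Fin (C.m (j + 1)) → ℝ
  T : ℝ
  w_bdMeas : ∀ a, BdMeas (fun p : ℝ × ℝ => w p.1 p.2 a)
  vp_bdMeas : ∀ l, BdMeas (fun t => vp t l)
  pde : ∀ a : C.Idx j, ∀ t x h : ℝ, 0 ≤ t → x ∈ Icc (0 : ℝ) 1 → 0 ≤ h → t + h ≤ T →
    x + C.speed j a * h ∈ Icc (0 : ℝ) 1 →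
    w (t + h) (x + C.speed j a * h) a - w t x a =
      ∫ s in (0 : ℝ)..h,
        (C.Sig j (x + C.speed j a * s) *ᵥ w (t + s) (x + C.speed j a * s)) a
  right : ∀ t, 0 ≤ t → t ≤ T → ∀ l, w t 1 (Sum.inr l) =
    (∑ k, C.R j l k * w t 1 (Sum.inl k)) + ∑ l', C.Rc j l l' * vp t l'
  vp_last : C.N ≤ j + 1 → vp = 0

namespace SubTrajectory

variable {j : ℕ} (ker : C.Kernels) (ω : SubTrajectory C j)

/-- The distributed delay term of the transformation. -/
def delayTerm (s x : ℝ) : C.Idx j → ℝ :=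
  Sum.elim (fun k => ∫ y in (0 : ℝ)..(1 / C.lam1 j), ∑ l, ker.truncF j x y k l * ω.vp (s - y) l)
    (fun _ => 0)

/-- The Volterra part of the transformation. -/
def volterraTerm (s x : ℝ) (a : C.Idx j) : ℝ :=
  ∫ y in (0 : ℝ)..1, ∑ b, ker.truncK j x y a b * ω.w s y b

/-- The transformed trajectory `(α, β)`. -/
def z (s x : ℝ) (a : C.Idx j) : ℝ :=
  ω.w s x a + ω.volterraTerm ker s x a + ω.delayTerm ker s x a

variable {ker} {ω}

lemma delayTerm_bdMeas (hker : ker.Solves) (a : C.Idx j) :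
    BdMeas (fun p : ℝ × ℝ => ω.delayTerm ker p.1 p.2 a) := by
  cases a with
  | inr l => exact BdMeas.const 0
  | inl k =>
    refine BdMeas.intervalIntegral (f := fun (p : ℝ × ℝ) y =>
      ∑ l, ker.truncF j p.2 y k l * ω.vp (p.1 - y) l) (BdMeas.sum _ fun l _ => ?_) 0 _
    exact ((truncF_bdMeas hker k l).comp₂ (f := fun x y => ker.truncF j x y k l)
      (e := fun p : (ℝ × ℝ) × ℝ => p.1.2) (by fun_prop) measurable_snd).mul
      ((ω.vp_bdMeas l).comp (e := fun p : (ℝ × ℝ) × ℝ => p.1.1 - p.2) (by fun_prop))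

lemma volterraTerm_bdMeas (hker : ker.Solves) (hj : j < C.N) (a : C.Idx j) :
    BdMeas (fun p : ℝ × ℝ => ω.volterraTerm ker p.1 p.2 a) := by
  refine BdMeas.intervalIntegral (f := fun (p : ℝ × ℝ) y =>
    ∑ b, ker.truncK j p.2 y a b * ω.w p.1 y b) (BdMeas.sum _ fun b _ => ?_) 0 1
  exact ((truncK_bdMeas hker hj a b).comp₂ (f := fun x y => ker.truncK j x y a b)
    (e := fun p : (ℝ × ℝ) × ℝ => p.1.2) (by fun_prop) measurable_snd).mul
    ((ω.w_bdMeas b).comp₂ (f := fun t x => ω.w t x b)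
      (e := fun p : (ℝ × ℝ) × ℝ => p.1.1) (by fun_prop) measurable_snd)

lemma z_bdMeas (hker : ker.Solves) (hj : j < C.N) (a : C.Idx j) :
    BdMeas (fun p : ℝ × ℝ => ω.z ker p.1 p.2 a) :=
  ((ω.w_bdMeas a).add (volterraTerm_bdMeas hker hj a)).add (delayTerm_bdMeas hker a)

lemma volterra_char (hker : ker.Solves) (hj : j < C.N) (a : C.Idx j) {t x h : ℝ} (ht : 0 ≤ t)
    (hx : x ∈ Icc (0 : ℝ) 1) (hh : 0 ≤ h) (hT : t + h ≤ ω.T)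
    (hxh : x + C.speed j a * h ∈ Icc (0 : ℝ) 1) :
    (ω.w (t + h) (x + C.speed j a * h) a + ω.volterraTerm ker (t + h) (x + C.speed j a * h) a)
      - (ω.w t x a + ω.volterraTerm ker t x a) =
    ∫ r in (0 : ℝ)..h, ((∑ d, ker.truncG j (x + C.speed j a * r) a d *
        (ω.w (t + r) (x + C.speed j a * r) d +
          ω.volterraTerm ker (t + r) (x + C.speed j a * r) d))
      - ∑ b, C.speed j b * (ker.truncK j (x + C.speed j a * r) 1 a b * ω.w (t + r) 1 b)) := by
  have hseg : ∀ {u v c s σ : ℝ}, σ ∈ Icc 0 s → u ≤ v → u ≤ v + c * s → u ≤ v + c * σ := by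
    intro u v c s σ hσ h1 h2
    rcases le_total 0 c with hc | hc
    · nlinarith [hσ.1]
    · nlinarith [hσ.2]
  have key := volterra_transport (c := C.speed j) (K := ker.truncK j) (S := C.truncSig j)
    (Gf := ker.truncG j) (W := fun r y => ω.w (t + r) y) (a := a) (h := h) (x₀ := x) hh hx hxh
    (truncK_bdMeas hker hj) (truncSig_bdMeas) (truncG_bdMeas hker hj)
    (fun b => (ω.w_bdMeas b).comp₂ (f := fun t x => ω.w t x b) (e := fun p : ℝ × ℝ => t + p.1)
      (by fun_prop) measurable_snd) (fun x y h => truncK_of_notMem h) ?_ ?_ ?_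
    (C.speed_ne_zero j a)
  · simp only [add_zero] at key
    exact key
  · intro b x y s hxy hs hxys
    rw [truncK_of_mem hxy, truncK_of_mem hxys, hker.K_pde j hj a b x y s hxy hs hxys]
    refine intervalIntegral.integral_congr fun σ hσ => ?_
    rw [uIcc_of_le hs] at hσ
    have hm : (x + C.speed j a * σ, y + C.speed j b * σ) ∈ triK := by
      refine ⟨hseg hσ hxy.1 hxys.1, ?_, ?_⟩
      · have := hseg (u := 0) (v := y - x) (c := C.speed j b - C.speed j a) hσ
          (by linarith [hxy.2.1]) (by linarith [hxys.2.1])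
        dsimp only
        linarith
      · have := hseg (u := -1) (v := -y) (c := - C.speed j b) hσ
          (by linarith [hxy.2.2]) (by linarith [hxys.2.2])
        dsimp only
        linarith
    have hm1 : x + C.speed j a * σ ∈ Icc (0 : ℝ) 1 := ⟨hm.1, hm.2.1.trans hm.2.2⟩
    have hm2 : y + C.speed j b * σ ∈ Icc (0 : ℝ) 1 := ⟨hm.1.trans hm.2.1, hm.2.2⟩
    simp only [truncK_of_mem hm, truncSig_of_mem hm2, truncG_of_mem hm1, Matrix.add_apply,
      Matrix.neg_apply, Matrix.mul_apply]
  · intro x hx b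
    have hx' := Ioo_subset_Icc_self hx
    have := congrFun (congrFun (hker.K_diag j hj x hx) a) b
    rw [Matrix.sub_apply, Matrix.sub_apply, Matrix.diagonal_mul, Matrix.mul_diagonal] at this
    rw [truncK_of_mem (diag_mem_triK hx'), truncSig_of_mem hx', truncG_of_mem hx', ← this]
    ring
  · intro b r y s hr hs hrs hy hys
    have := ω.pde b (t + r) y s (by linarith) hy hs (by linarith) hys
    rw [← add_assoc, this]
    refine intervalIntegral.integral_congr fun σ hσ => ?_
    rw [uIcc_of_le hs] at hσ
    have hm : y + C.speed j b * σ ∈ Icc (0 : ℝ) 1 := by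
      refine ⟨hseg hσ hy.1 hys.1, ?_⟩
      have := hseg (u := -1) (v := -y) (c := - C.speed j b) hσ
        (by linarith [hy.2]) (by linarith [hys.2])
      linarith
    simp only [truncSig_of_mem hm, Matrix.mulVec, dotProduct, add_assoc]

lemma delay_char (hker : ker.Solves) (hj : j < C.N) (k : Fin (C.n j)) {t x h : ℝ}
    (hx : x ∈ Icc (0 : ℝ) 1) (hh : 0 ≤ h) (hxh : x + C.lam j k * h ∈ Icc (0 : ℝ) 1) :
    ω.delayTerm ker (t + h) (x + C.lam j k * h) (Sum.inl k) - ω.delayTerm ker t x (Sum.inl k) =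
    ∫ r in (0 : ℝ)..h, ((∑ d, ker.truncG j (x + C.lam j k * r) (Sum.inl k) (Sum.inl d) *
        ω.delayTerm ker (t + r) (x + C.lam j k * r) (Sum.inl d))
      + ∑ l, ker.truncF j (x + C.lam j k * r) 0 k l * ω.vp (t + r) l) := by
  by_cases hN : j + 1 < C.N
  · have hmem : ∀ {x y : ℝ}, x ∈ Icc (0 : ℝ) 1 → 0 ≤ y → y ≤ x / C.lam1 j → (x, y) ∈ C.triF j :=
      fun hx h1 h2 => ⟨hx.1, hx.2, h1, h2⟩
    have key := delay_transport (F := ker.truncF j)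
      (G := fun x => (ker.truncG j x).toBlocks₁₁) (v := fun r => ω.vp (t + r)) (k := k)
      (lam₁ := C.lam1 j) (c := C.lam j k) (h := h) (x₀ := x) hh (C.lam1_pos j) (C.lam_pos j k)
      hx hxh (truncF_bdMeas hker) (fun d e => truncG_bdMeas hker hj (Sum.inl d) (Sum.inl e))
      (fun l => (ω.vp_bdMeas l).comp (e := fun r => t + r) (by fun_prop))
      (fun x y h => truncF_of_notMem fun h' => h ⟨h'.2.2.1, h'.2.2.2⟩) ?_ ?_
    · have e1 : ∀ r y : ℝ, t + (r - y) = t + r - y := fun r y => by ring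
      have e2 : ∀ y : ℝ, t + -y = t - y := fun y => by ring
      simp only [e1, e2] at key
      exact key
    · intro l x y s hx hy hyx hs hxs hys
      have m1 := hmem hx hy hyx
      have m2 := hmem hxs (by linarith) hys
      rw [truncF_of_mem hN m1, truncF_of_mem hN m2, hker.F_pde j hN k l x y s m1 hs m2]
      refine intervalIntegral.integral_congr fun σ hσ => ?_
      rw [uIcc_of_le hs] at hσ
      have hlk := C.lam_pos j k
      have hm : x + C.lam j k * σ ∈ Icc (0 : ℝ) 1 :=
        ⟨by nlinarith [hx.1, hσ.1], by nlinarith [hxs.2, hσ.2]⟩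
      have hm2 : (x + C.lam j k * σ, y + σ) ∈ C.triF j := by
        refine hmem hm (by linarith [hσ.1]) ?_
        have h1 : σ ≤ C.lam j k * σ / C.lam1 j := by
          rw [le_div_iff₀ (C.lam1_pos j)]
          nlinarith [hσ.1, C.lam1_le j k]
        rw [add_div]
        linarith
      simp only [truncF_of_mem hN hm2, truncG_of_mem hm, Matrix.mul_apply]
      rfl
    · intro hne x hx l
      have hk : 0 < (k : ℕ) := by
        rw [Nat.pos_iff_ne_zero]
        intro h0
        apply hne
        unfold lam1
        congr 1
        exact Fin.ext h0
      have hx' := Ioo_subset_Icc_self hx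
      rw [truncF_of_mem hN (hmem hx' (div_nonneg hx'.1 (C.lam1_pos j).le) le_rfl)]
      exact hker.F_side j hN x hx k l hk
  · have h0 := ω.vp_last (not_lt.1 hN)
    simp [delayTerm, h0]

/-- The components `α` of the target system are transported with coefficient `G`. -/
lemma z_inl_char (hker : ker.Solves) (hj : j < C.N) (k : Fin (C.n j)) {t x h : ℝ} (ht : 0 ≤ t)
    (hx : x ∈ Icc (0 : ℝ) 1) (hh : 0 ≤ h) (hT : t + h ≤ ω.T)
    (hxh : x + C.lam j k * h ∈ Icc (0 : ℝ) 1) :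
    ω.z ker (t + h) (x + C.lam j k * h) (Sum.inl k) - ω.z ker t x (Sum.inl k) =
    ∫ r in (0 : ℝ)..h, ∑ d, ker.truncG j (x + C.lam j k * r) (Sum.inl k) (Sum.inl d) *
      ω.z ker (t + r) (x + C.lam j k * r) (Sum.inl d) := by
  have k1 := volterra_char (ω := ω) hker hj (Sum.inl k) ht hx hh hT hxh
  have k2 := delay_char (ω := ω) (t := t) hker hj k hx hh hxh
  have es : C.speed j (Sum.inl k) = C.lam j k := rfl
  rw [es] at k1
  have cG : ∀ d, BdMeas (fun r => ker.truncG j (x + C.lam j k * r) (Sum.inl k) d) := fun d =>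
    (truncG_bdMeas hker hj (Sum.inl k) d).comp (e := fun r => x + C.lam j k * r) (by fun_prop)
  have cw : ∀ d, BdMeas (fun r => ω.w (t + r) (x + C.lam j k * r) d) := fun d =>
    (ω.w_bdMeas d).comp₂ (f := fun t x => ω.w t x d) (by fun_prop) (by fun_prop)
  have cv : ∀ d, BdMeas (fun r => ω.volterraTerm ker (t + r) (x + C.lam j k * r) d) := fun d =>
    (volterraTerm_bdMeas hker hj d).comp₂ (f := fun t x => ω.volterraTerm ker t x d)
      (by fun_prop) (by fun_prop)
  have cd : ∀ d, BdMeas (fun r => ω.delayTerm ker (t + r) (x + C.lam j k * r) d) := fun d =>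
    (delayTerm_bdMeas hker d).comp₂ (f := fun t x => ω.delayTerm ker t x d)
      (by fun_prop) (by fun_prop)
  have cK : ∀ b, BdMeas (fun r => ker.truncK j (x + C.lam j k * r) 1 (Sum.inl k) b) := fun b =>
    (truncK_bdMeas hker hj (Sum.inl k) b).comp₂ (f := fun x y => ker.truncK j x y (Sum.inl k) b)
      (by fun_prop) measurable_const
  have cw1 : ∀ b, BdMeas (fun r => ω.w (t + r) 1 b) := fun b =>
    (ω.w_bdMeas b).comp₂ (f := fun t x => ω.w t x b) (by fun_prop) measurable_const
  have cF : ∀ l, BdMeas (fun r => ker.truncF j (x + C.lam j k * r) 0 k l) := fun l =>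
    (truncF_bdMeas hker k l).comp₂ (f := fun x y => ker.truncF j x y k l)
      (by fun_prop) measurable_const
  have cvp : ∀ l, BdMeas (fun r => ω.vp (t + r) l) := fun l =>
    (ω.vp_bdMeas l).comp (e := fun r => t + r) (by fun_prop)
  have hsum : ω.z ker (t + h) (x + C.lam j k * h) (Sum.inl k) - ω.z ker t x (Sum.inl k) =
      ((ω.w (t + h) (x + C.lam j k * h) (Sum.inl k) +
        ω.volterraTerm ker (t + h) (x + C.lam j k * h) (Sum.inl k))
      - (ω.w t x (Sum.inl k) + ω.volterraTerm ker t x (Sum.inl k))) +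
      (ω.delayTerm ker (t + h) (x + C.lam j k * h) (Sum.inl k) -
        ω.delayTerm ker t x (Sum.inl k)) := by
    unfold z; ring
  rw [hsum, k1, k2, ← intervalIntegral.integral_add
    (((BdMeas.sum _ fun d _ => (cG d).mul ((cw d).add (cv d))).sub
      (BdMeas.sum _ fun b _ => ((cK b).mul (cw1 b)).const_mul _)).intervalIntegrable _ _)
    (((BdMeas.sum _ fun d _ => (cG (Sum.inl d)).mul (cd (Sum.inl d))).add
      (BdMeas.sum _ fun l _ => (cF l).mul (cvp l))).intervalIntegrable _ _)]
  refine intervalIntegral.integral_congr_Ioo_of_le hh fun r hr => ?_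
  have hlk := C.lam_pos j k
  have hxr : x + C.lam j k * r ∈ Ioo (0 : ℝ) 1 :=
    ⟨by nlinarith [hx.1, hr.1], by nlinarith [hxh.2, hr.2]⟩
  have hxr' := Ioo_subset_Icc_self hxr
  set X := x + C.lam j k * r with hX
  have hright := ω.right (t + r) (by linarith [hr.1]) (by linarith [hr.2])
  have hbd : ∑ l, ker.truncF j X 0 k l * ω.vp (t + r) l =
      ∑ b, C.speed j b * (ker.truncK j X 1 (Sum.inl k) b * ω.w (t + r) 1 b) := by
    rw [truncK_of_mem (right_mem_triK hxr'), Fintype.sum_sum_type]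
    have h1 : ∀ k', ker.K j X 1 (Sum.inl k) (Sum.inl k') * C.lam j k' =
        ∑ l, ker.K j X 1 (Sum.inl k) (Sum.inr l) * C.mu j l * C.R j l k' := by
      intro k'
      have := congrFun (congrFun (hker.K_right j hj X hxr) k) k'
      rw [Matrix.mul_diagonal, Matrix.mul_apply] at this
      simp only [Matrix.mul_diagonal] at this
      exact this
    have h2 : ∑ k', C.speed j (Sum.inl k') * (ker.K j X 1 (Sum.inl k) (Sum.inl k') *
        ω.w (t + r) 1 (Sum.inl k')) = ∑ l, ker.K j X 1 (Sum.inl k) (Sum.inr l) * C.mu j l *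
          ∑ k', C.R j l k' * ω.w (t + r) 1 (Sum.inl k') := by
      have : ∀ k', C.speed j (Sum.inl k') * (ker.K j X 1 (Sum.inl k) (Sum.inl k') *
          ω.w (t + r) 1 (Sum.inl k')) = ∑ l, ker.K j X 1 (Sum.inl k) (Sum.inr l) * C.mu j l *
            C.R j l k' * ω.w (t + r) 1 (Sum.inl k') := by
        intro k'
        rw [← Finset.sum_mul, ← h1]
        simp only [speed, Sum.elim_inl]
        ring
      simp only [this, Finset.mul_sum]
      rw [Finset.sum_comm]
      simp only [mul_assoc]
    have h3 : ∑ l, C.speed j (Sum.inr l) * (ker.K j X 1 (Sum.inl k) (Sum.inr l) *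
        ω.w (t + r) 1 (Sum.inr l)) = - (∑ l, ker.K j X 1 (Sum.inl k) (Sum.inr l) * C.mu j l *
          ∑ k', C.R j l k' * ω.w (t + r) 1 (Sum.inl k')) -
          ∑ l, ker.K j X 1 (Sum.inl k) (Sum.inr l) * C.mu j l *
            ∑ l', C.Rc j l l' * ω.vp (t + r) l' := by
      rw [← Finset.sum_neg_distrib, ← Finset.sum_sub_distrib]
      refine Finset.sum_congr rfl fun l _ => ?_
      rw [hright l]
      simp only [speed, Sum.elim_inr]
      ring
    rw [h2, h3]
    by_cases hN : j + 1 < C.N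
    · have h4 : (X, (0 : ℝ)) ∈ C.triF j :=
        ⟨hxr'.1, hxr'.2, le_rfl, div_nonneg hxr'.1 (C.lam1_pos j).le⟩
      have h5 : ∀ l', ker.truncF j X 0 k l' =
          - ∑ l, ker.K j X 1 (Sum.inl k) (Sum.inr l) * C.mu j l * C.Rc j l l' := by
        intro l'
        rw [truncF_of_mem hN h4, hker.F_zero j hN X hxr, Matrix.neg_apply, Matrix.mul_apply]
        simp only [Matrix.mul_diagonal]
        rfl
      simp only [h5, neg_mul, Finset.sum_neg_distrib, Finset.sum_mul, Finset.mul_sum]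
      rw [Finset.sum_comm]
      simp only [mul_assoc]
      ring
    · have h0 := ω.vp_last (not_lt.1 hN)
      simp [h0]
  have hG0 : ∀ l, ker.truncG j X (Sum.inl k) (Sum.inr l) = 0 := by
    intro l
    rw [truncG_of_mem hxr']
    simp [Kernels.Gfull]
  rw [hbd, Fintype.sum_sum_type]
  simp only [hG0, zero_mul, Finset.sum_const_zero, add_zero, z, mul_add, Finset.sum_add_distrib]
  ring

open Classical in
/-- The coefficient `Ḡ_j`, extended by zero. -/
def _root_.HyperbolicChain.Kernels.truncGbar (ker : C.Kernels) (j : ℕ) (x : ℝ) :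
    Matrix (Fin (C.m j)) (Fin (C.n j)) ℝ :=
  if x ∈ Icc (0 : ℝ) 1 then ker.Gbar j x else 0

open Classical in
/-- The coefficient `f̄_j`, extended by zero. -/
def _root_.HyperbolicChain.Kernels.truncfbar (ker : C.Kernels) (j : ℕ) (x : ℝ) :
    Matrix (Fin (C.m j)) (Fin (C.m (j + 1))) ℝ :=
  if x ∈ Icc (0 : ℝ) 1 then ker.fbar j x else 0

lemma truncGbar_eq (ker : C.Kernels) (x : ℝ) (l : Fin (C.m j)) (k : Fin (C.n j)) :
    ker.truncGbar j x l k =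
      (∑ l', ker.truncK j x 1 (Sum.inr l) (Sum.inr l') * C.mu j l' * C.R j l' k) -
        ker.truncK j x 1 (Sum.inr l) (Sum.inl k) * C.lam j k := by
  unfold Kernels.truncGbar
  split_ifs with hx
  · rw [truncK_of_mem (right_mem_triK hx), Kernels.Gbar, Matrix.sub_apply, Matrix.mul_apply,
      Matrix.mul_diagonal]
    simp only [Matrix.mul_diagonal]
    rfl
  · rw [truncK_of_notMem fun h => hx ⟨h.1, h.2.1⟩]
    simp

lemma truncfbar_eq (ker : C.Kernels) (x : ℝ) (l : Fin (C.m j)) (l'' : Fin (C.m (j + 1))) :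
    ker.truncfbar j x l l'' =
      ∑ l', ker.truncK j x 1 (Sum.inr l) (Sum.inr l') * C.mu j l' * C.Rc j l' l'' := by
  unfold Kernels.truncfbar
  split_ifs with hx
  · rw [truncK_of_mem (right_mem_triK hx), Kernels.fbar, Matrix.mul_apply]
    simp only [Matrix.mul_diagonal]
    rfl
  · rw [truncK_of_notMem fun h => hx ⟨h.1, h.2.1⟩]
    simp

lemma truncGbar_bdMeas (hker : ker.Solves) (hj : j < C.N) (l : Fin (C.m j)) (k : Fin (C.n j)) :
    BdMeas (fun x => ker.truncGbar j x l k) := by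
  simp only [truncGbar_eq]
  have hK : ∀ b, BdMeas (fun x => ker.truncK j x 1 (Sum.inr l) b) := fun b =>
    (truncK_bdMeas hker hj (Sum.inr l) b).comp₂ (f := fun x y => ker.truncK j x y (Sum.inr l) b)
      measurable_id measurable_const
  exact (BdMeas.sum _ fun l' _ => ((hK _).mul (BdMeas.const _)).mul (BdMeas.const _)).sub
    ((hK _).mul (BdMeas.const _))

lemma truncfbar_bdMeas (hker : ker.Solves) (hj : j < C.N) (l : Fin (C.m j))
    (l'' : Fin (C.m (j + 1))) : BdMeas (fun x => ker.truncfbar j x l l'') := by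
  simp only [truncfbar_eq]
  have hK : ∀ b, BdMeas (fun x => ker.truncK j x 1 (Sum.inr l) b) := fun b =>
    (truncK_bdMeas hker hj (Sum.inr l) b).comp₂ (f := fun x y => ker.truncK j x y (Sum.inr l) b)
      measurable_id measurable_const
  exact BdMeas.sum _ fun l' _ => ((hK _).mul (BdMeas.const _)).mul (BdMeas.const _)

/-- The components `β` of the target system are transported with a source located at `x = 1`. -/
lemma z_inr_char (hker : ker.Solves) (hj : j < C.N) (l : Fin (C.m j)) {t x h : ℝ} (ht : 0 ≤ t)
    (hx : x ∈ Icc (0 : ℝ) 1) (hh : 0 ≤ h) (hT : t + h ≤ ω.T)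
    (hxh : x - C.mu j l * h ∈ Icc (0 : ℝ) 1) :
    ω.z ker (t + h) (x - C.mu j l * h) (Sum.inr l) - ω.z ker t x (Sum.inr l) =
    ∫ r in (0 : ℝ)..h, ((∑ k, ker.truncGbar j (x - C.mu j l * r) l k * ω.w (t + r) 1 (Sum.inl k))
      + ∑ l', ker.truncfbar j (x - C.mu j l * r) l l' * ω.vp (t + r) l') := by
  have es : ∀ r, x + C.speed j (Sum.inr l) * r = x - C.mu j l * r := fun r => by
    simp only [speed, Sum.elim_inr]; ring
  have k1 := volterra_char (ω := ω) hker hj (Sum.inr l) ht hx hh hT (by rwa [es])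
  simp only [es] at k1
  simp only [z, delayTerm, Sum.elim_inr, add_zero]
  rw [k1]
  refine intervalIntegral.integral_congr fun r hr => ?_
  rw [uIcc_of_le hh] at hr
  set X := x - C.mu j l * r with hX
  have hright := ω.right (t + r) (by linarith [hr.1]) (by linarith [hr.2])
  have hG0 : ∀ d, ker.truncG j X (Sum.inr l) d = 0 := by
    intro d
    unfold Kernels.truncG
    split_ifs
    · cases d <;> simp [Kernels.Gfull]
    · rfl
  simp only [hG0, zero_mul, Finset.sum_const_zero, zero_sub, truncGbar_eq, truncfbar_eq]
  rw [Fintype.sum_sum_type]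
  have h3 : ∑ b, C.speed j (Sum.inr b) * (ker.truncK j X 1 (Sum.inr l) (Sum.inr b) *
      ω.w (t + r) 1 (Sum.inr b)) =
      - (∑ b, ker.truncK j X 1 (Sum.inr l) (Sum.inr b) * C.mu j b *
          ∑ k', C.R j b k' * ω.w (t + r) 1 (Sum.inl k')) -
        ∑ b, ker.truncK j X 1 (Sum.inr l) (Sum.inr b) * C.mu j b *
            ∑ l', C.Rc j b l' * ω.vp (t + r) l' := by
    rw [← Finset.sum_neg_distrib, ← Finset.sum_sub_distrib]
    refine Finset.sum_congr rfl fun l _ => ?_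
    rw [hright l]
    simp only [speed, Sum.elim_inr]
    ring
  rw [h3]
  simp only [sub_mul, Finset.sum_sub_distrib, Finset.sum_mul, Finset.mul_sum]
  have e1 : ∑ k, ∑ b, ker.truncK j X 1 (Sum.inr l) (Sum.inr b) * C.mu j b * C.R j b k *
      ω.w (t + r) 1 (Sum.inl k) = ∑ b, ∑ k, ker.truncK j X 1 (Sum.inr l) (Sum.inr b) *
        C.mu j b * (C.R j b k * ω.w (t + r) 1 (Sum.inl k)) := by
    rw [Finset.sum_comm]
    simp only [mul_assoc]
  have e2 : ∑ l', ∑ b, ker.truncK j X 1 (Sum.inr l) (Sum.inr b) * C.mu j b * C.Rc j b l' *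
      ω.vp (t + r) l' = ∑ b, ∑ l', ker.truncK j X 1 (Sum.inr l) (Sum.inr b) *
        C.mu j b * (C.Rc j b l' * ω.vp (t + r) l') := by
    rw [Finset.sum_comm]
    simp only [mul_assoc]
  have e3 : ∑ k, C.speed j (Sum.inl k) * (ker.truncK j X 1 (Sum.inr l) (Sum.inl k) *
      ω.w (t + r) 1 (Sum.inl k)) = ∑ k, ker.truncK j X 1 (Sum.inr l) (Sum.inl k) * C.lam j k *
        ω.w (t + r) 1 (Sum.inl k) := by
    refine Finset.sum_congr rfl fun k _ => ?_
    simp only [speed, Sum.elim_inl]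
    ring
  rw [e1, e2, e3]
  ring

end SubTrajectory

end HyperbolicChain

end

/-- Matrix coefficients of a family of distributed delays of two groups of signals. -/
lemma exists_matrix_kernel {Ω A B ι : Type*} [Fintype A] [Fintype B]
    {S : Ω → A ⊕ B → ℝ → ℝ} {Tm : Ω → ℝ} {T₀ : ℝ} {Φ : ι → Ω → ℝ → ℝ → ℝ} (hT₀ : 0 ≤ T₀)
    (hS : ∀ ω q, BdMeas (S ω q)) (h : ∀ i, IsDistDelay S Tm T₀ (Φ i)) :
    ∃ (p : ℝ → Matrix ι A ℝ) (q : ℝ → Matrix ι B ℝ),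
      (∀ i a, BdMeas (fun ν => p ν i a)) ∧ (∀ i b, BdMeas (fun ν => q ν i b)) ∧
      ∀ i ω s, T₀ ≤ s → s ≤ Tm ω → Φ i ω s 0 =
        (∫ ν in (0 : ℝ)..T₀, ∑ a, p ν i a * S ω (Sum.inl a) (s - ν)) +
        ∫ ν in (0 : ℝ)..T₀, ∑ b, q ν i b * S ω (Sum.inr b) (s - ν) := by
  choose k hk hk0 hΦ using h
  have hk' : ∀ i q, BdMeas (fun ν => k i q 0 ν) := fun i q =>
    (hk i q).comp₂ (f := k i q) measurable_const measurable_id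
  refine ⟨fun ν i a => k i (Sum.inl a) 0 ν, fun ν i b => k i (Sum.inr b) 0 ν,
    fun i a => hk' i _, fun i b => hk' i _, fun i ω s hs hs' => ?_⟩
  have e : ∀ q, IntervalIntegrable (fun ν => k i q 0 ν * S ω q (s - ν)) volume 0 T₀ := fun q =>
    ((hk' i q).mul ((hS ω q).comp (e := fun ν => s - ν) (by fun_prop))).intervalIntegrable _ _
  rw [hΦ i ω s hs hs' 0 (by simp), Fintype.sum_sum_type,
    intervalIntegral.integral_finsetSum fun a _ => e _,
    intervalIntegral.integral_finsetSum fun b _ => e _]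
  congr 1 <;> refine Finset.sum_congr rfl fun q _ => ?_ <;>
    exact (intervalIntegral_eq_integral_of_eq_zero hT₀ fun ν hν => by
      simp [hk0 i _ 0 ν hν]).symm

noncomputable section

namespace HyperbolicChain

variable {C : HyperbolicChain}

namespace SubTrajectory

variable {j : ℕ} {ker : C.Kernels} {ω : SubTrajectory C j}

/-- The boundary signals `α_j(·, 0)` and `v_{j+1}(·, 0)`. -/
def signal (ker : C.Kernels) (ω : SubTrajectory C j) :
    Fin (C.n j) ⊕ Fin (C.m (j + 1)) → ℝ → ℝ :=
  Sum.elim (fun k t => ω.z ker t 0 (Sum.inl k)) (fun l t => ω.vp t l)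

lemma signal_bdMeas (hker : ker.Solves) (hj : j < C.N) (ω : SubTrajectory C j)
    (q : Fin (C.n j) ⊕ Fin (C.m (j + 1))) : BdMeas (ω.signal ker q) := by
  cases q with
  | inl k =>
    exact (z_bdMeas hker hj (Sum.inl k)).comp₂ (f := fun t x => ω.z ker t x (Sum.inl k))
      measurable_id measurable_const
  | inr l => exact ω.vp_bdMeas l

lemma exists_alpha_kernel (hker : ker.Solves) (hj : j < C.N) :
    ∃ Gt : ℝ → ℝ → Matrix (Fin (C.n j)) (Fin (C.n j)) ℝ,
      (∀ k q, BdMeas (fun p : ℝ × ℝ => Gt p.1 p.2 k q)) ∧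
      (∀ k q x ν, ν ∉ Icc 0 (x / C.lam j k) → Gt x ν k q = 0) ∧
      ∀ (ω : SubTrajectory C j) k, ∀ x ∈ Icc (0 : ℝ) 1, ∀ s, x / C.lam1 j ≤ s → s ≤ ω.T →
        ω.z ker s x (Sum.inl k) = ω.z ker (s - x / C.lam j k) 0 (Sum.inl k) +
          ∑ q with k < q, ∫ ν, Gt x ν k q * ω.z ker (s - ν) 0 (Sum.inl q) := by
  obtain ⟨g, hg, hg0, H⟩ := exists_triangular_kernel (C.lam1_pos j) (C.lam1_le j)
    (C.lam_strictMono j) (G := fun x => (ker.truncG j x).toBlocks₁₁)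
    (fun k q => truncG_bdMeas hker hj (Sum.inl k) (Sum.inl q))
  refine ⟨fun x ν k q => g k q x ν, hg, hg0, fun ω => ?_⟩
  refine H (fun t x k => ω.z ker t x (Sum.inl k)) ω.T (fun k => z_bdMeas hker hj (Sum.inl k)) ?_
  intro k x hx s hs hT
  have hlk := C.lam_pos j k
  have h0 : 0 ≤ x / C.lam j k := div_nonneg hx.1 hlk.le
  have hle : x / C.lam j k ≤ x / C.lam1 j :=
    div_le_div_of_nonneg_left hx.1 (C.lam1_pos j) (C.lam1_le j k)
  have hcancel : C.lam j k * (x / C.lam j k) = x := mul_div_cancel₀ x hlk.ne'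
  have key := z_inl_char (ω := ω) hker hj k (t := s - x / C.lam j k) (x := 0) (by linarith)
    (by simp) h0 (by linarith) (by rw [zero_add, hcancel]; exact hx)
  simp only [zero_add, hcancel, sub_add_cancel] at key
  rw [sub_eq_iff_eq_add'] at key
  rw [key]
  congr 1
  have hsub := intervalIntegral.integral_comp_sub_left (a := 0) (b := x / C.lam j k) (fun r =>
    ∑ d, ker.truncG j (C.lam j k * r) (Sum.inl k) (Sum.inl d) *
      ω.z ker (s - x / C.lam j k + r) (C.lam j k * r) (Sum.inl d)) (x / C.lam j k)
  rw [sub_self, sub_zero] at hsub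
  rw [← hsub]
  refine intervalIntegral.integral_congr fun r hr => ?_
  rw [uIcc_of_le h0] at hr
  have e1 : C.lam j k * (x / C.lam j k - r) = x - C.lam j k * r := by rw [mul_sub, hcancel]
  have e2 : s - x / C.lam j k + (x / C.lam j k - r) = s - r := by ring
  have hm : x - C.lam j k * r ∈ Icc (0 : ℝ) 1 := by
    constructor
    · have := mul_le_mul_of_nonneg_left hr.2 hlk.le
      linarith
    · nlinarith [hx.2, hr.1]
  simp only [e1, e2]
  rw [Finset.sum_filter]
  refine Finset.sum_congr rfl fun q _ => ?_
  split_ifs with hq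
  · rfl
  · rw [truncG_of_mem hm]
    simp [Kernels.Gfull, Kernels.G, hq]

lemma volterraTerm_one (ω : SubTrajectory C j) (s : ℝ) (a : C.Idx j) :
    ω.volterraTerm ker s 1 a = 0 := by
  unfold volterraTerm
  refine (intervalIntegral.integral_congr_Ioo_of_le (g := fun _ => (0 : ℝ)) zero_le_one
    fun y hy => ?_).trans intervalIntegral.integral_zero
  rw [truncK_of_notMem (fun h => absurd h.2.1 (not_le.2 hy.2))]
  simp

/-- Propagation of `β_j` from the right boundary. -/
lemma z_inr_eq (hker : ker.Solves) (hj : j < C.N) (ω : SubTrajectory C j) (l : Fin (C.m j))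
    {s x : ℝ} (hx : x ∈ Icc (0 : ℝ) 1) (hs : (1 - x) / C.mu j l ≤ s) (hT : s ≤ ω.T) :
    ω.z ker s x (Sum.inr l) =
      (∑ k, C.R j l k * ω.w (s - (1 - x) / C.mu j l) 1 (Sum.inl k)) +
      (∑ l', C.Rc j l l' * ω.vp (s - (1 - x) / C.mu j l) l') +
      ((∫ ν in (0 : ℝ)..((1 - x) / C.mu j l),
        ∑ k, ker.truncGbar j (x + C.mu j l * ν) l k * ω.w (s - ν) 1 (Sum.inl k)) +
      ∫ ν in (0 : ℝ)..((1 - x) / C.mu j l),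
        ∑ l', ker.truncfbar j (x + C.mu j l * ν) l l' * ω.vp (s - ν) l') := by
  have hml := C.mu_pos j l
  have h0 : 0 ≤ (1 - x) / C.mu j l := div_nonneg (by linarith [hx.2]) hml.le
  have hcancel : C.mu j l * ((1 - x) / C.mu j l) = 1 - x := mul_div_cancel₀ _ hml.ne'
  have key := z_inr_char (ω := ω) hker hj l (t := s - (1 - x) / C.mu j l) (x := 1) (by linarith)
    (by simp) h0 (by linarith) (by rw [hcancel, sub_sub_cancel]; exact hx)
  rw [hcancel, sub_sub_cancel, sub_add_cancel, sub_eq_iff_eq_add'] at key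
  have h1 : ω.z ker (s - (1 - x) / C.mu j l) 1 (Sum.inr l) =
      (∑ k, C.R j l k * ω.w (s - (1 - x) / C.mu j l) 1 (Sum.inl k)) +
      ∑ l', C.Rc j l l' * ω.vp (s - (1 - x) / C.mu j l) l' := by
    rw [← ω.right _ (by linarith) (by linarith) l]
    simp [z, delayTerm, volterraTerm_one]
  rw [key, h1]
  congr 1
  have hsub := intervalIntegral.integral_comp_sub_left (a := 0) (b := (1 - x) / C.mu j l) (fun r =>
    (∑ k, ker.truncGbar j (1 - C.mu j l * r) l k *
      ω.w (s - (1 - x) / C.mu j l + r) 1 (Sum.inl k))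
      + ∑ l', ker.truncfbar j (1 - C.mu j l * r) l l' * ω.vp (s - (1 - x) / C.mu j l + r) l')
    ((1 - x) / C.mu j l)
  rw [sub_self, sub_zero] at hsub
  rw [← hsub, ← intervalIntegral.integral_add]
  · refine intervalIntegral.integral_congr fun r _ => ?_
    have e1 : 1 - C.mu j l * ((1 - x) / C.mu j l - r) = x + C.mu j l * r := by
      rw [mul_sub, hcancel]; ring
    have e2 : s - (1 - x) / C.mu j l + ((1 - x) / C.mu j l - r) = s - r := by ring
    simp only [e1, e2]
  · refine (BdMeas.sum _ fun k _ => ?_).intervalIntegrable _ _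
    exact ((truncGbar_bdMeas hker hj l k).comp (e := fun ν => x + C.mu j l * ν)
      (by fun_prop)).mul ((ω.w_bdMeas (Sum.inl k)).comp₂ (f := fun t x => ω.w t x (Sum.inl k))
        (e := fun ν => s - ν) (by fun_prop) measurable_const)
  · refine (BdMeas.sum _ fun l' _ => ?_).intervalIntegrable _ _
    exact ((truncfbar_bdMeas hker hj l l').comp (e := fun ν => x + C.mu j l * ν)
      (by fun_prop)).mul ((ω.vp_bdMeas l').comp (e := fun ν => s - ν) (by fun_prop))

/-- The kernel `F_j`, completed by zero rows. -/
def _root_.HyperbolicChain.Kernels.fullF (ker : C.Kernels) (j : ℕ) (x y : ℝ) :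
    Matrix (C.Idx j) (Fin (C.m (j + 1))) ℝ :=
  fun a l => Sum.elim (fun k => ker.truncF j x y k l) (fun _ => 0) a

lemma fullF_bdMeas (hker : ker.Solves) (a : C.Idx j) (l : Fin (C.m (j + 1))) :
    BdMeas (fun p : ℝ × ℝ => ker.fullF j p.1 p.2 a l) := by
  cases a with
  | inl k => exact truncF_bdMeas hker k l
  | inr l' => exact BdMeas.const 0

lemma delayTerm_eq (ω : SubTrajectory C j) (s x : ℝ) (a : C.Idx j) :
    ω.delayTerm ker s x a =
      ∫ y in (0 : ℝ)..(1 / C.lam1 j), ∑ l, ker.fullF j x y a l * ω.vp (s - y) l := by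
  cases a with
  | inl k => rfl
  | inr l => simp [delayTerm, Kernels.fullF]

/-- The inverse transformation. -/
lemma exists_inverse_kernel (hker : ker.Solves) (hj : j < C.N) :
    ∃ (L : ℝ → ℝ → Matrix (C.Idx j) (C.Idx j) ℝ)
      (H : ℝ → ℝ → Matrix (C.Idx j) (Fin (C.m (j + 1))) ℝ),
      (∀ a b, BdMeas (fun p : ℝ × ℝ => L p.1 p.2 a b)) ∧
      (∀ x y, (x, y) ∉ triK → L x y = 0) ∧
      (∀ a l, BdMeas (fun p : ℝ × ℝ => H p.1 p.2 a l)) ∧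
      ∀ (ω : SubTrajectory C j) s, ∀ x ∈ Icc (0 : ℝ) 1, ∀ a,
        ω.w s x a = ω.z ker s x a +
          (∫ y in (0 : ℝ)..(1 / C.lam1 j), ∑ l, H x y a l * ω.vp (s - y) l) +
          ∫ y in (0 : ℝ)..1, ∑ b, L x y a b * ω.z ker s y b := by
  have hK := fun a b => truncK_bdMeas (ker := ker) hker hj a b
  obtain ⟨L, hL, hL0, hLK⟩ := exists_resolvent hK fun x y h => truncK_of_notMem h
  have hF := fun a l => fullF_bdMeas (j := j) hker a l
  have hl1 : 0 ≤ 1 / C.lam1 j := (one_div_pos.2 (C.lam1_pos j)).le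
  have hLF : ∀ a l, BdMeas (fun q : (ℝ × ℝ) × ℝ =>
      ∑ b, L q.1.1 q.2 a b * ker.fullF j q.2 q.1.2 b l) := fun a l => BdMeas.sum _ fun b _ =>
    ((hL a b).comp₂ (f := fun x y => L x y a b) (by fun_prop) (by fun_prop)).mul
      ((hF b l).comp₂ (f := fun x y => ker.fullF j x y b l) (by fun_prop) (by fun_prop))
  refine ⟨L, fun x y a l => -(ker.fullF j x y a l +
    ∫ ξ in (0 : ℝ)..1, ∑ b, L x ξ a b * ker.fullF j ξ y b l), hL, hL0, fun a l => ?_, ?_⟩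
  · exact ((hF a l).add (BdMeas.intervalIntegral (f := fun (p : ℝ × ℝ) ξ =>
      ∑ b, L p.1 ξ a b * ker.fullF j ξ p.2 b l) (hLF a l) 0 1)).neg
  intro ω s x hx a
  have hw : ∀ b, BdMeas (fun y => ω.w s y b) := fun b =>
    (ω.w_bdMeas b).comp₂ (f := fun t x => ω.w t x b) measurable_const measurable_id
  have hz : ∀ b, BdMeas (fun y => ω.z ker s y b) := fun b =>
    (z_bdMeas hker hj b).comp₂ (f := fun t x => ω.z ker t x b) measurable_const measurable_id
  have hd : ∀ b, BdMeas (fun y => ω.delayTerm ker s y b) := fun b =>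
    (delayTerm_bdMeas hker b).comp₂ (f := fun t x => ω.delayTerm ker t x b)
      measurable_const measurable_id
  have hLx : ∀ b, BdMeas (fun y => L x y a b) := fun b =>
    (hL a b).comp₂ (f := fun x y => L x y a b) measurable_const measurable_id
  have hv : ∀ l, BdMeas (fun y => ω.vp (s - y) l) := fun l =>
    (ω.vp_bdMeas l).comp (e := fun y => s - y) (by fun_prop)
  have key := volterra_inverse (g := fun y b => ω.z ker s y b - ω.delayTerm ker s y b) hK hL hLK hw
    (fun y _ b => by simp only [z, volterraTerm]; ring) hx a
  have e1 : ∫ y in (0 : ℝ)..1, ∑ b, L x y a b * (ω.z ker s y b - ω.delayTerm ker s y b) =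
      (∫ y in (0 : ℝ)..1, ∑ b, L x y a b * ω.z ker s y b) -
        ∫ y in (0 : ℝ)..1, ∑ b, L x y a b * ω.delayTerm ker s y b := by
    rw [← intervalIntegral.integral_sub
      ((BdMeas.sum _ fun b _ => (hLx b).mul (hz b)).intervalIntegrable _ _)
      ((BdMeas.sum _ fun b _ => (hLx b).mul (hd b)).intervalIntegrable _ _)]
    simp only [mul_sub, Finset.sum_sub_distrib]
  have hFc : ∀ b l, BdMeas (fun p : ℝ × ℝ =>
      L x p.1 a b * (ker.fullF j p.1 p.2 b l * ω.vp (s - p.2) l)) := fun b l =>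
    ((hLx b).comp measurable_fst).mul ((hF b l).mul ((hv l).comp measurable_snd))
  have e2 : ∫ y in (0 : ℝ)..1, ∑ b, L x y a b * ω.delayTerm ker s y b =
      ∫ y in (0 : ℝ)..(1 / C.lam1 j), ∑ l,
        (∫ ξ in (0 : ℝ)..1, ∑ b, L x ξ a b * ker.fullF j ξ y b l) * ω.vp (s - y) l := by
    have a1 : ∀ y, ∑ b, L x y a b * ω.delayTerm ker s y b =
        ∫ r in (0 : ℝ)..(1 / C.lam1 j), ∑ b, ∑ l,
          L x y a b * (ker.fullF j y r b l * ω.vp (s - r) l) := by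
      intro y
      rw [intervalIntegral.integral_finsetSum]
      · refine Finset.sum_congr rfl fun b _ => ?_
        rw [delayTerm_eq, ← intervalIntegral.integral_const_mul]
        simp only [Finset.mul_sum]
      · intro b _
        exact (BdMeas.sum _ fun l _ => (hFc b l).comp₂ (f := fun y r =>
          L x y a b * (ker.fullF j y r b l * ω.vp (s - r) l)) measurable_const
          measurable_id).intervalIntegrable _ _
    simp only [a1]
    rw [BdMeas.intervalIntegral_swap (f := fun y r => ∑ b, ∑ l,
      L x y a b * (ker.fullF j y r b l * ω.vp (s - r) l))
      (BdMeas.sum _ fun b _ => BdMeas.sum _ fun l _ => hFc b l) zero_le_one hl1]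
    refine intervalIntegral.integral_congr fun r _ => ?_
    have a2 : ∀ l, IntervalIntegrable (fun ξ => ∑ b, L x ξ a b * ker.fullF j ξ r b l *
        ω.vp (s - r) l) volume 0 1 := fun l => (BdMeas.sum _ fun b _ => ((hLx b).mul
          ((hF b l).comp₂ (f := fun x y => ker.fullF j x y b l) measurable_id
            measurable_const)).mul (BdMeas.const _)).intervalIntegrable _ _
    simp only [← intervalIntegral.integral_mul_const, Finset.sum_mul]
    rw [← intervalIntegral.integral_finsetSum fun l _ => a2 l]
    refine intervalIntegral.integral_congr fun ξ _ => ?_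
    simp only [mul_assoc]
    exact Finset.sum_comm
  have e3 : ∫ y in (0 : ℝ)..(1 / C.lam1 j), ∑ l, -(ker.fullF j x y a l +
        ∫ ξ in (0 : ℝ)..1, ∑ b, L x ξ a b * ker.fullF j ξ y b l) * ω.vp (s - y) l =
      - ω.delayTerm ker s x a - ∫ y in (0 : ℝ)..(1 / C.lam1 j), ∑ l,
        (∫ ξ in (0 : ℝ)..1, ∑ b, L x ξ a b * ker.fullF j ξ y b l) * ω.vp (s - y) l := by
    have i1 : IntervalIntegrable (fun y => ∑ l, ker.fullF j x y a l * ω.vp (s - y) l) volume 0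
        (1 / C.lam1 j) := (BdMeas.sum _ fun l _ => ((hF a l).comp₂
          (f := fun x y => ker.fullF j x y a l) measurable_const measurable_id).mul
          (hv l)).intervalIntegrable _ _
    have i2 : IntervalIntegrable (fun y => ∑ l, (∫ ξ in (0 : ℝ)..1, ∑ b, L x ξ a b *
        ker.fullF j ξ y b l) * ω.vp (s - y) l) volume 0 (1 / C.lam1 j) :=
      (BdMeas.sum _ fun l _ => (BdMeas.intervalIntegral (f := fun y ξ =>
        ∑ b, L x ξ a b * ker.fullF j ξ y b l) ((hLF a l).comp
          (e := fun q : ℝ × ℝ => ((x, q.1), q.2)) (by fun_prop)) 0 1).mul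
          (hv l)).intervalIntegrable _ _
    have i1' : IntervalIntegrable (fun y => -∑ l, ker.fullF j x y a l * ω.vp (s - y) l) volume 0
        (1 / C.lam1 j) := i1.neg
    rw [delayTerm_eq, ← intervalIntegral.integral_neg, ← intervalIntegral.integral_sub i1' i2]
    refine intervalIntegral.integral_congr fun y _ => ?_
    simp only [neg_add, add_mul, Finset.sum_add_distrib, neg_mul, Finset.sum_neg_distrib,
      sub_eq_add_neg]
  rw [e1, e2] at key
  rw [e3, key]
  ring

end SubTrajectory

end HyperbolicChain

end

noncomputable section

namespace HyperbolicChain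

variable {C : HyperbolicChain}

lemma tau_eq (C : HyperbolicChain) (j : ℕ) : C.tau j = 1 / C.lam1 j + 1 / C.mu1 j := rfl

lemma one_div_lam1_pos (C : HyperbolicChain) (j : ℕ) : 0 < 1 / C.lam1 j :=
  one_div_pos.2 (C.lam1_pos j)

lemma one_div_mu1_pos (C : HyperbolicChain) (j : ℕ) : 0 < 1 / C.mu1 j :=
  one_div_pos.2 (C.mu1_pos j)

lemma tau_pos (C : HyperbolicChain) (j : ℕ) : 0 < C.tau j :=
  add_pos (C.one_div_lam1_pos j) (C.one_div_mu1_pos j)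

lemma one_div_lam_le (C : HyperbolicChain) (j : ℕ) (k : Fin (C.n j)) :
    1 / C.lam j k ≤ 1 / C.lam1 j :=
  one_div_le_one_div_of_le (C.lam1_pos j) (C.lam1_le j k)

lemma one_div_mu_le (C : HyperbolicChain) (j : ℕ) (l : Fin (C.m j)) :
    1 / C.mu j l ≤ 1 / C.mu1 j :=
  one_div_le_one_div_of_le (C.mu1_pos j) (C.mu1_le j l)

namespace SubTrajectory

variable {j : ℕ} {ker : C.Kernels}

lemma alpha_smoothing (hker : ker.Solves) (hj : j < C.N) (k : Fin (C.n j)) :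
    IsSmoothing (signal (j := j) ker) SubTrajectory.T (1 / C.lam1 j)
      (fun ω s x => ω.z ker s x (Sum.inl k)) := by
  obtain ⟨Gt, hGt, hGt0, H⟩ := exists_alpha_kernel (C := C) hker hj
  have hlk := C.lam_pos j k
  have hS := signal_bdMeas (C := C) hker hj
  have hsupp : ∀ q x ν, ν ∉ Icc 0 (1 / C.lam1 j) →
      (if x ∈ Icc (0 : ℝ) 1 then Gt x ν k q else 0) = 0 := by
    intro q x ν hν
    split_ifs with hx
    · refine hGt0 k q x ν fun h => hν ⟨h.1, h.2.trans (le_trans ?_ (C.one_div_lam_le j k))⟩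
      exact div_le_div_of_nonneg_right hx.2 hlk.le
    · rfl
  have hk : ∀ q, BdMeas (fun p : ℝ × ℝ => if p.1 ∈ Icc (0 : ℝ) 1 then Gt p.1 p.2 k q else 0) :=
    fun q => (hGt k q).ite_zero (p := fun p : ℝ × ℝ => p.1 ∈ Icc (0 : ℝ) 1)
      (measurable_fst measurableSet_Icc)
  have hdist := fun q => (IsDistDelay.single (S := signal (j := j) ker) (Tm := SubTrajectory.T)
    (hk q) (hsupp q) (Sum.inl q)).isSmoothing hS (C.one_div_lam1_pos j).le (fun ω s =>
      BdMeas.integral (((hk q).mul ((hS ω (Sum.inl q)).comp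
        (e := fun p : ℝ × ℝ => s - p.2) (by fun_prop)))) fun x y hy => by
          rw [hsupp q x y hy, zero_mul])
  have hpt := IsSmoothing.point (S := signal (j := j) ker) (Tm := SubTrajectory.T)
    (T₀ := 1 / C.lam1 j) hS (d₀ := 0) (d₁ := 1 / C.lam j k) (one_div_pos.2 hlk).ne'
    (fun y hy => ⟨by have := mul_nonneg (one_div_pos.2 hlk).le hy.1; linarith, by
      have := mul_le_mul_of_nonneg_left hy.2 (one_div_pos.2 hlk).le
      have := C.one_div_lam_le j k
      linarith⟩) (Sum.inl k)
  refine (hpt.add hS (IsSmoothing.sum hS (Finset.univ.filter (k < ·))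
    fun q _ => hdist q)).congr (fun ω s => ?_) fun ω s hs hT x hx => ?_
  · exact (z_bdMeas hker hj (Sum.inl k)).comp₂ (f := fun t x => ω.z ker t x (Sum.inl k))
      measurable_const measurable_id
  · have h1 : x / C.lam1 j ≤ s :=
      (div_le_div_of_nonneg_right hx.2 (C.lam1_pos j).le).trans hs
    rw [H ω k x hx s h1 hT]
    have e : s - (0 + 1 / C.lam j k * x) = s - x / C.lam j k := by ring
    simp only [if_pos hx, e, signal, Sum.elim_inl]

/-- Up to distributed delays, `α_j(s, 1)` is a pointwise delay of `α_j(·, 0)`. -/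
lemma alpha_one_isDistDelay (hker : ker.Solves) (hj : j < C.N) (k : Fin (C.n j)) :
    IsDistDelay (signal (j := j) ker) SubTrajectory.T (1 / C.lam1 j)
      (fun ω s _ => ω.z ker s 1 (Sum.inl k) - ω.signal ker (Sum.inl k) (s - 1 / C.lam j k)) := by
  obtain ⟨Gt, hGt, hGt0, H⟩ := exists_alpha_kernel (C := C) hker hj
  have hS := signal_bdMeas (C := C) hker hj
  have hd := fun q => IsDistDelay.single (S := signal (j := j) ker) (Tm := SubTrajectory.T)
    (T₀ := 1 / C.lam1 j) (k := fun _ ν => Gt 1 ν k q) ((hGt k q).comp₂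
      (f := fun x ν => Gt x ν k q) measurable_const measurable_snd) (fun x ν hν =>
      hGt0 k q 1 ν fun h => hν ⟨h.1, h.2.trans (C.one_div_lam_le j k)⟩) (Sum.inl q)
  refine (IsDistDelay.sum hS (Finset.univ.filter (k < ·)) fun q _ => hd q).congr
    fun ω s hs hT x hx => ?_
  rw [H ω k 1 (by simp) s hs hT]
  simp only [signal, Sum.elim_inl, add_sub_cancel_left]

/-- `u_j(s, 1)` and `α_j(s, 1)` differ by distributed delays. -/
lemma state_one_sub_isDistDelay (hker : ker.Solves) (hj : j < C.N) (k : Fin (C.n j)) :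
    IsDistDelay (signal (j := j) ker) SubTrajectory.T (1 / C.lam1 j)
      (fun ω s _ => ω.w s 1 (Sum.inl k) - ω.z ker s 1 (Sum.inl k)) := by
  have hS := signal_bdMeas (C := C) hker hj
  have hd := fun l => (IsDistDelay.integral_point (S := signal (j := j) ker)
    (Tm := SubTrajectory.T) (T₀ := 1 / C.lam1 j) (c := fun _ y => ker.truncF j 1 y k l)
    ((truncF_bdMeas hker k l).comp₂ (f := fun x y => ker.truncF j x y k l) measurable_const
      measurable_snd) (Y := 1 / C.lam1 j) (d₀ := 0) (d₁ := 1) (C.one_div_lam1_pos j).le one_ne_zero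
      (fun y hy => by simpa using hy) (Sum.inr l)).const_mul (-1)
  refine (IsDistDelay.sum hS Finset.univ fun l _ => hd l).congr fun ω s hs hT x hx => ?_
  have i : ∀ l, IntervalIntegrable (fun y => ker.truncF j 1 y k l * ω.vp (s - y) l) volume 0
      (1 / C.lam1 j) := fun l => (((truncF_bdMeas hker k l).comp₂
      (f := fun x y => ker.truncF j x y k l) measurable_const measurable_id).mul
      ((ω.vp_bdMeas l).comp (e := fun y => s - y) (by fun_prop))).intervalIntegrable _ _
  simp only [z, volterraTerm_one, delayTerm, Sum.elim_inl, signal, Sum.elim_inr, zero_add, one_mul]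
  rw [← Finset.mul_sum, intervalIntegral.integral_finsetSum fun l _ => i l]
  ring

lemma state_one_isDistDelay (hker : ker.Solves) (hj : j < C.N) (k : Fin (C.n j)) :
    IsDistDelay (signal (j := j) ker) SubTrajectory.T (1 / C.lam1 j)
      (fun ω s _ => ω.w s 1 (Sum.inl k) - ω.signal ker (Sum.inl k) (s - 1 / C.lam j k)) :=
  ((state_one_sub_isDistDelay hker hj k).add (signal_bdMeas hker hj)
    (alpha_one_isDistDelay hker hj k)).congr fun ω s _ _ x _ => by ring

/-- Distributed delays of `u_j(·, 1)`. -/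
lemma integral_state_one_isDistDelay (hker : ker.Solves) (hj : j < C.N) (k : Fin (C.n j))
    {c : ℝ → ℝ → ℝ} (hc : BdMeas (fun p : ℝ × ℝ => c p.1 p.2)) {Y : ℝ} (hY : 0 ≤ Y) :
    IsDistDelay (signal (j := j) ker) SubTrajectory.T (1 / C.lam1 j + Y)
      (fun ω s x => ∫ y in (0 : ℝ)..Y, c x y * ω.w (s - y) 1 (Sum.inl k)) := by
  have hS := signal_bdMeas (C := C) hker hj
  have h1 := (state_one_isDistDelay hker hj k).integral_shift hS hc (d := id) (e := fun _ => 0)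
    measurable_id measurable_const (D := Y) hY
    (by linarith [C.one_div_lam1_pos j]) (fun y hy => hy) (fun _ _ => by simp)
  have h2 := IsDistDelay.integral_point (S := signal (j := j) ker) (Tm := SubTrajectory.T)
    (T₀ := 1 / C.lam1 j + Y) hc (d₀ := 1 / C.lam j k) (d₁ := 1) hY one_ne_zero (fun y hy =>
      ⟨by linarith [hy.1, one_div_pos.2 (C.lam_pos j k)],
        by linarith [hy.2, C.one_div_lam_le j k]⟩) (Sum.inl k)
  refine (h1.add hS h2).congr fun ω s _ _ x _ => ?_
  have ic : BdMeas (c x) := hc.comp₂ (f := c) measurable_const measurable_id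
  have iw : BdMeas (fun y => ω.w (s - y) 1 (Sum.inl k)) := (ω.w_bdMeas (Sum.inl k)).comp₂
    (f := fun t x => ω.w t x (Sum.inl k)) (e := fun y => s - y) (by fun_prop) measurable_const
  have is : BdMeas (fun y => ω.signal ker (Sum.inl k) (s - y - 1 / C.lam j k)) :=
    (hS ω (Sum.inl k)).comp (e := fun y => s - y - 1 / C.lam j k) (by fun_prop)
  have e : ∀ y, s - (1 / C.lam j k + 1 * y) = s - y - 1 / C.lam j k := fun y => by ring
  simp only [id, e]
  rw [← intervalIntegral.integral_add ((ic.mul (iw.sub is)).intervalIntegrable _ _)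
    ((ic.mul is).intervalIntegrable _ _)]
  refine intervalIntegral.integral_congr fun y _ => ?_
  ring

lemma integral_vp_isDistDelay (l : Fin (C.m (j + 1)))
    {c : ℝ → ℝ → ℝ} (hc : BdMeas (fun p : ℝ × ℝ => c p.1 p.2)) {Y T₀ : ℝ} (hY : 0 ≤ Y)
    (hYT : Y ≤ T₀) :
    IsDistDelay (signal (j := j) ker) SubTrajectory.T T₀
      (fun ω s x => ∫ y in (0 : ℝ)..Y, c x y * ω.vp (s - y) l) := by
  refine (IsDistDelay.integral_point (S := signal (j := j) ker) (Tm := SubTrajectory.T)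
    (T₀ := T₀) hc (d₀ := 0) (d₁ := 1) hY one_ne_zero (fun y hy =>
      ⟨by linarith [hy.1], by linarith [hy.2]⟩) (Sum.inr l)).congr fun ω s _ _ x _ => ?_
  simp only [zero_add, one_mul, signal, Sum.elim_inr]

/-- The in-domain part of the representation of `β_j`. -/
lemma beta_source_isDistDelay (hker : ker.Solves) (hj : j < C.N) (l : Fin (C.m j)) :
    IsDistDelay (signal (j := j) ker) SubTrajectory.T (C.tau j) (fun ω s x =>
      (∫ ν in (0 : ℝ)..((1 - x) / C.mu j l),
        ∑ k, ker.truncGbar j (x + C.mu j l * ν) l k * ω.w (s - ν) 1 (Sum.inl k)) +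
      ∫ ν in (0 : ℝ)..((1 - x) / C.mu j l),
        ∑ l', ker.truncfbar j (x + C.mu j l * ν) l l' * ω.vp (s - ν) l') := by
  have hml := C.mu_pos j l
  have hS := signal_bdMeas (C := C) hker hj
  have hY : 0 ≤ 1 / C.mu j l := (one_div_pos.2 hml).le
  have hYm := C.one_div_mu_le j l
  have hms : MeasurableSet {p : ℝ × ℝ | p.2 ∈ Icc 0 ((1 - p.1) / C.mu j l)} :=
    (measurableSet_le measurable_const measurable_snd).inter
      (measurableSet_le measurable_snd (by fun_prop))
  have hcG : ∀ k, BdMeas (fun p : ℝ × ℝ => if p.2 ∈ Icc 0 ((1 - p.1) / C.mu j l) then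
      ker.truncGbar j (p.1 + C.mu j l * p.2) l k else 0) := fun k =>
    ((truncGbar_bdMeas hker hj l k).comp (e := fun p : ℝ × ℝ => p.1 + C.mu j l * p.2)
      (by fun_prop)).ite_zero hms
  have hcf : ∀ l', BdMeas (fun p : ℝ × ℝ => if p.2 ∈ Icc 0 ((1 - p.1) / C.mu j l) then
      ker.truncfbar j (p.1 + C.mu j l * p.2) l l' else 0) := fun l' =>
    ((truncfbar_bdMeas hker hj l l').comp (e := fun p : ℝ × ℝ => p.1 + C.mu j l * p.2)
      (by fun_prop)).ite_zero hms
  have h1 := IsDistDelay.sum hS Finset.univ fun k _ =>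
    (integral_state_one_isDistDelay hker hj k (c := fun x y =>
      if y ∈ Icc 0 ((1 - x) / C.mu j l) then ker.truncGbar j (x + C.mu j l * y) l k else 0)
      (hcG k) hY).mono (T₁ := C.tau j) (by rw [tau_eq]; linarith)
  have h2 := IsDistDelay.sum hS Finset.univ fun l' _ =>
    integral_vp_isDistDelay (ker := ker) l' (c := fun x y =>
      if y ∈ Icc 0 ((1 - x) / C.mu j l) then ker.truncfbar j (x + C.mu j l * y) l l' else 0)
      (hcf l') hY (T₀ := C.tau j) (by rw [tau_eq]; linarith [C.one_div_lam1_pos j])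
  refine (h1.add hS h2).congr fun ω s _ _ x hx => ?_
  have h0x : 0 ≤ (1 - x) / C.mu j l := div_nonneg (by linarith [hx.2]) hml.le
  have hx1 : (1 - x) / C.mu j l ≤ 1 / C.mu j l :=
    div_le_div_of_nonneg_right (by linarith [hx.1]) hml.le
  congr 1
  · rw [← intervalIntegral.integral_finsetSum]
    · refine intervalIntegral_eq_intervalIntegral_of_eq_zero le_rfl h0x hx1 (fun ν hν => ?_)
        fun ν hν => ?_
      · simp only [if_pos hν]
      · simp only [if_neg hν, zero_mul, Finset.sum_const_zero]
    · intro k _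
      exact (((hcG k).comp (e := fun y => (x, y)) (by fun_prop)).mul
        ((ω.w_bdMeas (Sum.inl k)).comp₂ (f := fun t x => ω.w t x (Sum.inl k))
          (e := fun y => s - y) (by fun_prop) measurable_const)).intervalIntegrable _ _
  · rw [← intervalIntegral.integral_finsetSum]
    · refine intervalIntegral_eq_intervalIntegral_of_eq_zero le_rfl h0x hx1 (fun ν hν => ?_)
        fun ν hν => ?_
      · simp only [if_pos hν]
      · simp only [if_neg hν, zero_mul, Finset.sum_const_zero]
    · intro l' _
      exact (((hcf l').comp (e := fun y => (x, y)) (by fun_prop)).mul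
        ((ω.vp_bdMeas l').comp (e := fun y => s - y) (by fun_prop))).intervalIntegrable _ _

lemma beta_smoothing (hker : ker.Solves) (hj : j < C.N) (l : Fin (C.m j)) :
    IsSmoothing (signal (j := j) ker) SubTrajectory.T (C.tau j)
      (fun ω s x => ω.z ker s x (Sum.inr l)) := by
  have hml := C.mu_pos j l
  have hS := signal_bdMeas (C := C) hker hj
  have hYm := C.one_div_mu_le j l
  have hm0 := one_div_pos.2 hml
  have hz : ∀ (ω : SubTrajectory C j) s, BdMeas (fun x => ω.z ker s x (Sum.inr l)) := fun ω s =>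
    (z_bdMeas hker hj (Sum.inr l)).comp₂ (f := fun t x => ω.z ker t x (Sum.inr l))
      measurable_const measurable_id
  have hdx : ∀ x ∈ Icc (0 : ℝ) 1, (1 - x) / C.mu j l ∈ Icc 0 (1 / C.mu1 j) := fun x hx =>
    ⟨div_nonneg (by linarith [hx.2]) hml.le,
      (div_le_div_of_nonneg_right (by linarith [hx.1]) hml.le).trans hYm⟩
  have hpt : ∀ {d₀ : ℝ}, 0 ≤ d₀ → d₀ ≤ 1 / C.lam1 j → ∀ y ∈ Icc (0 : ℝ) 1,
      d₀ + 1 / C.mu j l + -(1 / C.mu j l) * y ∈ Icc 0 (C.tau j) := by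
    intro d₀ h0 h1 y hy
    rw [tau_eq]
    have := mul_nonneg hm0.le hy.1
    have := mul_le_mul_of_nonneg_left hy.2 hm0.le
    constructor <;> linarith
  have hwb : ∀ (ω : SubTrajectory C j) s k,
      BdMeas (fun x => ω.w (s - (1 - x) / C.mu j l) 1 (Sum.inl k)) := fun ω s k =>
    (ω.w_bdMeas (Sum.inl k)).comp₂ (f := fun t x => ω.w t x (Sum.inl k)) (by fun_prop)
      measurable_const
  have hsb : ∀ (ω : SubTrajectory C j) s k, BdMeas (fun x =>
      ω.signal ker (Sum.inl k) (s - (1 - x) / C.mu j l - 1 / C.lam j k)) := fun ω s k =>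
    (hS ω (Sum.inl k)).comp (e := fun x => s - (1 - x) / C.mu j l - 1 / C.lam j k) (by fun_prop)
  have hvb : ∀ (ω : SubTrajectory C j) s l',
      BdMeas (fun x => ω.vp (s - (1 - x) / C.mu j l) l') := fun ω s l' =>
    (ω.vp_bdMeas l').comp (e := fun x => s - (1 - x) / C.mu j l) (by fun_prop)
  have hU : ∀ k, IsSmoothing (signal (j := j) ker) SubTrajectory.T (C.tau j)
      (fun ω s x => C.R j l k * ω.w (s - (1 - x) / C.mu j l) 1 (Sum.inl k)) := by
    intro k
    have h1 := ((state_one_isDistDelay hker hj k).shift (d := fun x => (1 - x) / C.mu j l)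
      (e := id) (by fun_prop) measurable_id hdx fun _ h => h).isSmoothing hS (C.tau_pos j).le
      fun ω s => (hwb ω s k).sub (hsb ω s k)
    have h2 := IsSmoothing.point (S := signal (j := j) ker) (Tm := SubTrajectory.T) hS
      (neg_ne_zero.2 hm0.ne') (hpt (one_div_pos.2 (C.lam_pos j k)).le (C.one_div_lam_le j k))
      (Sum.inl k)
    refine ((IsSmoothing.add hS h1 h2).const_mul (C.R j l k)).congr
      (fun ω s => (hwb ω s k).const_mul _) fun ω s _ _ x _ => ?_
    have e : s - (1 / C.lam j k + 1 / C.mu j l + -(1 / C.mu j l) * x) =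
        s - (1 - x) / C.mu j l - 1 / C.lam j k := by ring
    rw [e]
    ring
  have hV : ∀ l', IsSmoothing (signal (j := j) ker) SubTrajectory.T (C.tau j)
      (fun ω s x => C.Rc j l l' * ω.vp (s - (1 - x) / C.mu j l) l') := by
    intro l'
    refine ((IsSmoothing.point (S := signal (j := j) ker) (Tm := SubTrajectory.T) hS
      (neg_ne_zero.2 hm0.ne') (hpt le_rfl (C.one_div_lam1_pos j).le)
      (Sum.inr l')).const_mul (C.Rc j l l')).congr (fun ω s => (hvb ω s l').const_mul _) fun ω s _ _ x _ => ?_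
    have e : s - (0 + 1 / C.mu j l + -(1 / C.mu j l) * x) = s - (1 - x) / C.mu j l := by ring
    rw [e]
    rfl
  have hUV := (IsSmoothing.sum hS Finset.univ fun k _ => hU k).add hS
    (IsSmoothing.sum hS Finset.univ fun l' _ => hV l')
  have hsrc := ((beta_source_isDistDelay hker hj l).congr (Ψ := fun ω s x => ω.z ker s x (Sum.inr l) -
      ((∑ k, C.R j l k * ω.w (s - (1 - x) / C.mu j l) 1 (Sum.inl k)) +
      (∑ l', C.Rc j l l' * ω.vp (s - (1 - x) / C.mu j l) l'))) fun ω s hs hT x hx => by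
        rw [z_inr_eq hker hj ω l hx (by
          have := (hdx x hx).2
          have := C.one_div_lam1_pos j
          rw [tau_eq] at hs
          linarith) hT]
        ring).isSmoothing hS (C.tau_pos j).le fun ω s => (hz ω s).sub
          ((BdMeas.sum _ fun k _ => (hwb ω s k).const_mul _).add
            (BdMeas.sum _ fun l' _ => (hvb ω s l').const_mul _))
  exact (hsrc.add hS hUV).congr hz fun ω s _ _ x _ => by ring

/-- Time-delay representation of one subsystem. -/
theorem exists_representation (hker : ker.Solves) (hj : j < C.N) :
    ∃ (g1 : ℝ → Matrix (Fin (C.m j)) (Fin (C.n j)) ℝ)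
      (g2 : ℝ → Matrix (Fin (C.m j)) (Fin (C.m (j + 1))) ℝ)
      (h1 : ℝ → Matrix (Fin (C.n j)) (Fin (C.n j)) ℝ)
      (h2 : ℝ → Matrix (Fin (C.n j)) (Fin (C.m (j + 1))) ℝ)
      (L : ℝ → ℝ → Matrix (C.Idx j) (C.Idx j) ℝ)
      (H : ℝ → ℝ → Matrix (C.Idx j) (Fin (C.m (j + 1))) ℝ),
      (∀ a b, BdMeas (fun ν => g1 ν a b)) ∧ (∀ a b, BdMeas (fun ν => g2 ν a b)) ∧
      (∀ a b, BdMeas (fun ν => h1 ν a b)) ∧ (∀ a b, BdMeas (fun ν => h2 ν a b)) ∧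
      (∀ a b, BdMeas (fun p : ℝ × ℝ => L p.1 p.2 a b)) ∧
      (∀ x y, (x, y) ∉ triK → L x y = 0) ∧
      (∀ a b, BdMeas (fun p : ℝ × ℝ => H p.1 p.2 a b)) ∧
      ∀ (ω : SubTrajectory C j),
        (∀ s, ∀ x ∈ Icc (0 : ℝ) 1, ∀ a, ω.w s x a = ω.z ker s x a +
          (∫ y in (0 : ℝ)..(1 / C.lam1 j), ∑ l, H x y a l * ω.vp (s - y) l) +
          ∫ y in (0 : ℝ)..1, ∑ b, L x y a b * ω.z ker s y b) ∧
        ∀ s, C.tau j ≤ s → s ≤ ω.T →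
        (∀ k, ω.z ker s 0 (Sum.inl k) = ω.w s 0 (Sum.inl k) +
          (∫ ν in (0 : ℝ)..C.tau j, ∑ q, h1 ν k q * ω.z ker (s - ν) 0 (Sum.inl q)) +
          ∫ ν in (0 : ℝ)..C.tau j, ∑ l, h2 ν k l * ω.vp (s - ν) l) ∧
        ∀ l, ω.w s 0 (Sum.inr l) =
          (∑ k, C.R j l k * ω.z ker (s - 1 / C.mu j l) 1 (Sum.inl k)) +
          (∑ l', C.Rc j l l' * ω.vp (s - 1 / C.mu j l) l') +
          (∫ ν in (0 : ℝ)..C.tau j, ∑ q, g1 ν l q * ω.z ker (s - ν) 0 (Sum.inl q)) +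
          ∫ ν in (0 : ℝ)..C.tau j, ∑ l', g2 ν l l' * ω.vp (s - ν) l' := by
  obtain ⟨L, H, hL, hL0, hH, hinv⟩ := exists_inverse_kernel (C := C) hker hj
  have hS := signal_bdMeas (C := C) hker hj
  have hz : ∀ b, IsSmoothing (signal (j := j) ker) SubTrajectory.T (C.tau j)
      (fun ω s x => ω.z ker s x b) := by
    rintro (k | l)
    · exact (alpha_smoothing hker hj k).mono (by rw [tau_eq]; linarith [C.one_div_mu1_pos j])
    · exact beta_smoothing hker hj l
  have hLx : ∀ x a b, BdMeas (fun y => L x y a b) := fun x a b =>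
    (hL a b).comp₂ (f := fun x y => L x y a b) measurable_const measurable_id
  have hHx : ∀ x a l, BdMeas (fun y => H x y a l) := fun x a l =>
    (hH a l).comp₂ (f := fun x y => H x y a l) measurable_const measurable_id
  have hdiff : ∀ a, IsDistDelay (signal (j := j) ker) SubTrajectory.T (C.tau j)
      (fun ω s x => ω.w s x a - ω.z ker s x a) := by
    intro a
    refine ((IsDistDelay.sum hS Finset.univ fun l _ => integral_vp_isDistDelay l
      (c := fun x y => H x y a l) (hH a l)
      (C.one_div_lam1_pos j).le (T₀ := C.tau j) (by
        rw [tau_eq]; linarith [C.one_div_mu1_pos j])).add hS (IsDistDelay.sum hS Finset.univ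
      fun b _ => (hz b).2 (fun x y => L x y a b) (hL a b))).congr fun ω s _ _ x hx => ?_
    rw [hinv ω s x hx a, intervalIntegral.integral_finsetSum, intervalIntegral.integral_finsetSum]
    · ring
    · exact fun b _ => ((hLx x a b).mul ((hz b).1 ω s)).intervalIntegrable _ _
    · exact fun l _ => ((hHx x a l).mul ((ω.vp_bdMeas l).comp (e := fun y => s - y)
        (by fun_prop))).intervalIntegrable _ _
  have hv0 : ∀ l, IsDistDelay (signal (j := j) ker) SubTrajectory.T (C.tau j)
      (fun ω s x => (ω.w s x (Sum.inr l) - ω.z ker s x (Sum.inr l)) +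
        ((∑ k, C.R j l k * (ω.w (s - 1 / C.mu j l) 1 (Sum.inl k) -
          ω.z ker (s - 1 / C.mu j l) 1 (Sum.inl k))) +
        ((∫ ν in (0 : ℝ)..((1 - x) / C.mu j l),
        ∑ k, ker.truncGbar j (x + C.mu j l * ν) l k * ω.w (s - ν) 1 (Sum.inl k)) +
      ∫ ν in (0 : ℝ)..((1 - x) / C.mu j l),
        ∑ l', ker.truncfbar j (x + C.mu j l * ν) l l' * ω.vp (s - ν) l'))) := by
    intro l
    refine (hdiff (Sum.inr l)).add hS ((IsDistDelay.sum hS Finset.univ fun k _ => ?_).add hS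
      (beta_source_isDistDelay hker hj l))
    exact ((state_one_sub_isDistDelay hker hj k).shift (d := fun _ => 1 / C.mu j l)
      (e := id) (by fun_prop) measurable_id (fun _ _ => ⟨(one_div_pos.2 (C.mu_pos j l)).le,
        C.one_div_mu_le j l⟩) fun _ h => h).const_mul _
  obtain ⟨h1, h2, hh1, hh2, hα⟩ := exists_matrix_kernel (C.tau_pos j).le hS
    fun k : Fin (C.n j) => (hdiff (Sum.inl k)).const_mul (-1)
  obtain ⟨g1, g2, hg1, hg2, hv⟩ := exists_matrix_kernel (C.tau_pos j).le hS hv0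
  refine ⟨g1, g2, h1, h2, L, H, hg1, hg2, hh1, hh2, hL, hL0, hH, fun ω =>
    ⟨hinv ω, fun s hs hT => ⟨fun k => ?_, fun l => ?_⟩⟩⟩
  · have := hα k ω s hs hT
    simp only [signal, Sum.elim_inl, Sum.elim_inr] at this
    linarith
  · have := hv l ω s hs hT
    simp only [signal, Sum.elim_inl, Sum.elim_inr] at this
    have h3 := z_inr_eq hker hj ω l (s := s) (x := 0) (by simp) (by
      have := C.one_div_mu_le j l
      have := C.one_div_lam1_pos j
      rw [tau_eq] at hs
      rw [sub_zero]
      linarith) hT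
    simp only [mul_sub, Finset.sum_sub_distrib] at this
    simp only [sub_zero] at this h3
    linarith

end SubTrajectory

end HyperbolicChain

end

noncomputable section

/-- The point of `[a, b]` closest to `t`. -/
def clamp (a b t : ℝ) : ℝ := max a (min b t)

lemma clamp_of_mem {a b t : ℝ} (h : t ∈ Icc a b) : clamp a b t = t := by
  rw [clamp, min_eq_right h.2, max_eq_right h.1]

lemma clamp_mem {a b : ℝ} (hab : a ≤ b) (t : ℝ) : clamp a b t ∈ Icc a b :=
  ⟨le_max_left _ _, max_le hab (min_le_left _ _)⟩

lemma continuous_clamp (a b : ℝ) : Continuous (clamp a b) := by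
  unfold clamp
  fun_prop

namespace HyperbolicChain

variable {C : HyperbolicChain}

lemma IsSolution.clamp_bdMeas {U : ℝ → Fin (C.n 0) → ℝ} {w : C.State} (hw : C.IsSolution U w)
    {j : ℕ} (hj : j < C.N) {T : ℝ} (hT : 0 ≤ T) (a : C.Idx j) :
    BdMeas (fun p : ℝ × ℝ => w j (clamp 0 T p.1) (clamp 0 1 p.2) a) := by
  have hc : ContinuousOn (fun p : ℝ × ℝ => w j p.1 p.2 a) (Icc 0 T ×ˢ Icc 0 1) :=
    ((continuous_apply a).comp_continuousOn (hw.continuousOn j hj)).mono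
      (prod_mono Icc_subset_Ici_self subset_rfl)
  have hm : ∀ p : ℝ × ℝ, (clamp 0 T p.1, clamp 0 1 p.2) ∈ Icc 0 T ×ˢ Icc (0 : ℝ) 1 := fun p =>
    ⟨clamp_mem hT _, clamp_mem zero_le_one _⟩
  obtain ⟨M, hM⟩ := (isCompact_Icc.prod isCompact_Icc).exists_bound_of_continuousOn hc
  refine ⟨(hc.comp_continuous (f := fun p : ℝ × ℝ => (clamp 0 T p.1, clamp 0 1 p.2)) ?_
    hm).measurable, M, fun p => hM _ (hm p)⟩
  exact ((continuous_clamp _ _).comp continuous_fst).prodMk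
    ((continuous_clamp _ _).comp continuous_snd)

lemma vZero_of_lt (w : C.State) {i : ℕ} (hi : i < C.N) (t : ℝ) :
    C.vZero w i t = fun l => w i t 0 (Sum.inr l) := if_pos hi

lemma vZero_of_le (w : C.State) {i : ℕ} (hi : C.N ≤ i) (t : ℝ) : C.vZero w i t = 0 :=
  if_neg (not_lt.2 hi)

lemma tau_le_tauMax (C : HyperbolicChain) {j : ℕ} (hj : j < C.N) : C.tau j ≤ C.tauMax :=
  le_ciSup (f := fun r : Fin C.N => C.tau r) (Set.finite_range _).bddAbove ⟨j, hj⟩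

/-- The restriction of a solution to one subsystem and to the times `[0, T]`. -/
def IsSolution.trajectory {U : ℝ → Fin (C.n 0) → ℝ} {w : C.State} (hw : C.IsSolution U w)
    {j : ℕ} (hj : j < C.N) {T : ℝ} (hT : 0 ≤ T) : SubTrajectory C j where
  w := fun t x => w j (clamp 0 T t) (clamp 0 1 x)
  vp := fun t => C.vZero w (j + 1) (clamp 0 T t)
  T := T
  w_bdMeas := hw.clamp_bdMeas hj hT
  vp_bdMeas := fun l => by
    by_cases hN : j + 1 < C.N
    · simp only [vZero_of_lt w hN]
      have := (hw.clamp_bdMeas hN hT (Sum.inr l)).comp (e := fun t : ℝ => (t, (0 : ℝ)))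
        (by fun_prop)
      simpa only [clamp_of_mem (show (0 : ℝ) ∈ Icc (0 : ℝ) 1 by simp)] using this
    · simp only [vZero_of_le w (not_lt.1 hN)]
      exact BdMeas.const 0
  pde := fun a t x h ht hx hh hT' hxh => by
    rw [clamp_of_mem ⟨by linarith, hT'⟩, clamp_of_mem hxh, clamp_of_mem ⟨ht, by linarith⟩,
      clamp_of_mem hx, hw.pde j hj a t x h ht hx hh hxh]
    refine intervalIntegral.integral_congr fun s hs => ?_
    rw [uIcc_of_le hh] at hs
    have hm : x + C.speed j a * s ∈ Icc (0 : ℝ) 1 := by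
      rcases le_total 0 (C.speed j a) with hc | hc
      · exact ⟨by nlinarith [hx.1, hs.1], by nlinarith [hxh.2, hs.2]⟩
      · exact ⟨by nlinarith [hxh.1, hs.2], by nlinarith [hx.2, hs.1]⟩
    simp only [clamp_of_mem hm,
      clamp_of_mem (show t + s ∈ Icc 0 T from ⟨by linarith [hs.1], by linarith [hs.2]⟩)]
  right := fun t ht hT' l => by
    rw [clamp_of_mem ⟨ht, hT'⟩, clamp_of_mem (by simp)]
    exact congrFun (hw.right j hj t ht) l
  vp_last := fun hN => by
    funext t
    exact vZero_of_le w hN _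

section

variable {U : ℝ → Fin (C.n 0) → ℝ} {w : C.State} (hw : C.IsSolution U w) {j : ℕ} (hj : j < C.N)
  {T : ℝ} (hT : 0 ≤ T) {ker : C.Kernels}

lemma trajectory_w {t x : ℝ} (ht : t ∈ Icc 0 T) (hx : x ∈ Icc (0 : ℝ) 1) :
    (hw.trajectory hj hT).w t x = w j t x := by
  simp only [IsSolution.trajectory, clamp_of_mem ht, clamp_of_mem hx]

lemma trajectory_vp {t : ℝ} (ht : t ∈ Icc 0 T) :
    (hw.trajectory hj hT).vp t = C.vZero w (j + 1) t := by
  simp only [IsSolution.trajectory, clamp_of_mem ht]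

lemma trajectory_volterraTerm {t x : ℝ} (ht : t ∈ Icc 0 T) (hx : x ∈ Icc (0 : ℝ) 1)
    (a : C.Idx j) : (hw.trajectory hj hT).volterraTerm ker t x a =
      ∫ y in x..1, (ker.K j x y *ᵥ w j t y) a := by
  refine (intervalIntegral_eq_intervalIntegral_of_eq_zero hx.1 hx.2 le_rfl (fun y hy => ?_)
    fun y hy => ?_).symm
  · rw [truncK_of_mem ⟨hx.1, hy.1, hy.2⟩, trajectory_w hw hj hT ht ⟨hx.1.trans hy.1, hy.2⟩]
    rfl
  · rw [truncK_of_notMem fun h => hy ⟨h.2.1, h.2.2⟩]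
    simp

lemma trajectory_delayTerm {t x : ℝ} (ht : t ∈ Icc 0 T) (hx : x ∈ Icc (0 : ℝ) 1)
    (hxt : x / C.lam1 j ≤ t) (k : Fin (C.n j)) :
    (hw.trajectory hj hT).delayTerm ker t x (Sum.inl k) =
      ∫ y in (0 : ℝ)..(x / C.lam1 j), (ker.F j x y *ᵥ C.vZero w (j + 1) (t - y)) k := by
  have hl := C.lam1_pos j
  by_cases hN : j + 1 < C.N
  · refine (intervalIntegral_eq_intervalIntegral_of_eq_zero le_rfl (div_nonneg hx.1 hl.le)
      (div_le_div_of_nonneg_right hx.2 hl.le) (fun y hy => ?_) fun y hy => ?_).symm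
    · rw [truncF_of_mem hN ⟨hx.1, hx.2, hy.1, hy.2⟩, trajectory_vp hw hj hT
        ⟨by linarith [hy.2], by linarith [hy.1, ht.2]⟩]
      rfl
    · rw [truncF_of_notMem fun h => hy ⟨h.2.2.1, h.2.2.2⟩]
      simp
  · have h0 := (hw.trajectory hj hT).vp_last (not_lt.1 hN)
    simp [SubTrajectory.delayTerm, h0, vZero_of_le w (not_lt.1 hN)]

lemma trajectory_z {t x : ℝ} (ht : t ∈ Icc 0 T) (hx : x ∈ Icc (0 : ℝ) 1)
    (hxt : x / C.lam1 j ≤ t) :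
    (hw.trajectory hj hT).z ker t x = ker.target w j t x := by
  ext a
  unfold SubTrajectory.z Kernels.target
  rw [trajectory_w hw hj hT ht hx, trajectory_volterraTerm hw hj hT ht hx]
  cases a with
  | inl k =>
    rw [trajectory_delayTerm hw hj hT ht hx hxt]
    simp only [Sum.elim_inl]
    ring
  | inr l => simp [SubTrajectory.delayTerm]

end

lemma uOne_signals (ker : C.Kernels) (w : C.State) (j : ℕ) (s : ℝ) :
    ker.uOne (ker.signals w) j s = fun k => w j s 1 (Sum.inl k) := by
  ext k
  simp [Kernels.uOne, Kernels.signals, Kernels.target]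

/-- The coefficient `h³_j`, which accounts for `u_{j-1}(s, 1)` in terms of `α_{j-1}(s, 1)`. -/
def Kernels.h3 (ker : C.Kernels) : (j : ℕ) → ℝ → Matrix (Fin (C.n j)) (Fin (C.m j)) ℝ
  | 0 => 0
  | j + 1 => fun ν => -(C.Qc j * ker.truncF j 1 ν)

lemma Kernels.h3_bdMeas {ker : C.Kernels} (hker : ker.Solves) (j : ℕ) (a : Fin (C.n j))
    (b : Fin (C.m j)) : BdMeas (fun ν => ker.h3 j ν a b) := by
  cases j with
  | zero => exact BdMeas.const 0
  | succ j =>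
    simp only [Kernels.h3, Matrix.neg_apply, Matrix.mul_apply]
    exact (BdMeas.sum _ fun k _ => ((truncF_bdMeas hker k b).comp₂
      (f := fun x y => ker.truncF j x y k b) measurable_const measurable_id).const_mul _).neg

lemma BdMeas.bddMeas₁ {ι κ : Type} {f : ℝ → Matrix ι κ ℝ} (h : ∀ a b, BdMeas (fun s => f s a b)) :
    BddMeas₁ f := fun a b => h a b

lemma BdMeas.bddMeas₂ {ι κ : Type} {f : ℝ → ℝ → Matrix ι κ ℝ}
    (h : ∀ a b, BdMeas (fun p : ℝ × ℝ => f p.1 p.2 a b)) : BddMeas₂ f :=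
  fun a b => ⟨(h a b).1, (h a b).2.imp fun _ hM x y => hM (x, y)⟩

/-- Existence of the coefficients of the time-delay representation. -/
theorem exists_delayRepresentation {ker : C.Kernels} (hker : ker.Solves) :
    ∃ cf : C.DelayCoeff, cf.BddMeas ∧ ∀ (U : ℝ → Fin (C.n 0) → ℝ) (w : C.State),
      C.IsSolution U w → DelayRepresentation ker cf U w := by
  have hrep : ∀ j, ∃ (Gt : ℝ → ℝ → Matrix (Fin (C.n j)) (Fin (C.n j)) ℝ)
      (g1 : ℝ → Matrix (Fin (C.m j)) (Fin (C.n j)) ℝ)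
      (g2 : ℝ → Matrix (Fin (C.m j)) (Fin (C.m (j + 1))) ℝ)
      (h1 : ℝ → Matrix (Fin (C.n j)) (Fin (C.n j)) ℝ)
      (h2 : ℝ → Matrix (Fin (C.n j)) (Fin (C.m (j + 1))) ℝ)
      (L : ℝ → ℝ → Matrix (C.Idx j) (C.Idx j) ℝ)
      (H : ℝ → ℝ → Matrix (C.Idx j) (Fin (C.m (j + 1))) ℝ), j < C.N →
      (∀ a b, BdMeas (fun p : ℝ × ℝ => Gt p.1 p.2 a b)) ∧
      (∀ a b, BdMeas (fun ν => g1 ν a b)) ∧ (∀ a b, BdMeas (fun ν => g2 ν a b)) ∧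
      (∀ a b, BdMeas (fun ν => h1 ν a b)) ∧ (∀ a b, BdMeas (fun ν => h2 ν a b)) ∧
      (∀ a b, BdMeas (fun p : ℝ × ℝ => L p.1 p.2 a b)) ∧
      (∀ a b, BdMeas (fun p : ℝ × ℝ => H p.1 p.2 a b)) ∧
      (∀ k q x ν, ν ∉ Icc 0 (x / C.lam j k) → Gt x ν k q = 0) ∧
      (∀ x y, (x, y) ∉ triK → L x y = 0) ∧
      (∀ (ω : SubTrajectory C j) k, ∀ x ∈ Icc (0 : ℝ) 1, ∀ s, x / C.lam1 j ≤ s → s ≤ ω.T →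
        ω.z ker s x (Sum.inl k) = ω.z ker (s - x / C.lam j k) 0 (Sum.inl k) +
          ∑ q with k < q, ∫ ν, Gt x ν k q * ω.z ker (s - ν) 0 (Sum.inl q)) ∧
      ∀ (ω : SubTrajectory C j),
        (∀ s, ∀ x ∈ Icc (0 : ℝ) 1, ∀ a, ω.w s x a = ω.z ker s x a +
          (∫ y in (0 : ℝ)..(1 / C.lam1 j), ∑ l, H x y a l * ω.vp (s - y) l) +
          ∫ y in (0 : ℝ)..1, ∑ b, L x y a b * ω.z ker s y b) ∧
        ∀ s, C.tau j ≤ s → s ≤ ω.T →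
        (∀ k, ω.z ker s 0 (Sum.inl k) = ω.w s 0 (Sum.inl k) +
          (∫ ν in (0 : ℝ)..C.tau j, ∑ q, h1 ν k q * ω.z ker (s - ν) 0 (Sum.inl q)) +
          ∫ ν in (0 : ℝ)..C.tau j, ∑ l, h2 ν k l * ω.vp (s - ν) l) ∧
        ∀ l, ω.w s 0 (Sum.inr l) =
          (∑ k, C.R j l k * ω.z ker (s - 1 / C.mu j l) 1 (Sum.inl k)) +
          (∑ l', C.Rc j l l' * ω.vp (s - 1 / C.mu j l) l') +
          (∫ ν in (0 : ℝ)..C.tau j, ∑ q, g1 ν l q * ω.z ker (s - ν) 0 (Sum.inl q)) +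
          ∫ ν in (0 : ℝ)..C.tau j, ∑ l', g2 ν l l' * ω.vp (s - ν) l' := by
    intro j
    by_cases hj : j < C.N
    · obtain ⟨g1, g2, h1, h2, L, H, b1, b2, b3, b4, b5, b6, b7, r⟩ :=
        SubTrajectory.exists_representation (C := C) hker hj
      obtain ⟨Gt, c1, c2, c3⟩ := SubTrajectory.exists_alpha_kernel (C := C) hker hj
      exact ⟨Gt, g1, g2, h1, h2, L, H, fun _ => ⟨c1, b1, b2, b3, b4, b5, b7, c2, b6, c3, r⟩⟩
    · exact ⟨0, 0, 0, 0, 0, 0, 0, fun h => absurd h hj⟩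
  choose Gt g1 g2 h1 h2 L H hrep using hrep
  refine ⟨⟨g1, g2, h1, h2, ker.h3, Gt, L, H⟩, fun j hj => ?_, fun U w hw => ?_⟩
  · obtain ⟨b1, b2, b3, b4, b5, b6, b7, -⟩ := hrep j hj
    exact ⟨BdMeas.bddMeas₁ b2, BdMeas.bddMeas₁ b3, BdMeas.bddMeas₁ b4, BdMeas.bddMeas₁ b5,
      BdMeas.bddMeas₁ (Kernels.h3_bdMeas hker j), BdMeas.bddMeas₂ b1, BdMeas.bddMeas₂ b6,
      BdMeas.bddMeas₂ b7⟩
  have hpos : ∀ {s}, C.tauMax < s → 0 ≤ s := fun hs =>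
    ((C.tau_pos 0).le.trans (C.tau_le_tauMax C.N_pos)).trans hs.le
  have htau : ∀ {j}, j < C.N → ∀ {s}, C.tauMax < s → C.tau j ≤ s := fun hj _ hs =>
    (C.tau_le_tauMax hj).trans hs.le
  have hlam : ∀ {j}, j < C.N → ∀ {s}, C.tauMax < s → 1 / C.lam1 j ≤ s := fun {j} hj _ hs => by
    have := htau hj hs
    rw [tau_eq] at this
    linarith [C.one_div_mu1_pos j]
  have hz : ∀ {j} (hj : j < C.N) {s} (hs : C.tauMax < s) {ν} (_ : ν ∈ Icc 0 s) {x}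
      (_ : x ∈ Icc (0 : ℝ) 1) (_ : x / C.lam1 j ≤ s - ν),
      (hw.trajectory hj (hpos hs)).z ker (s - ν) x = ker.target w j (s - ν) x :=
    fun hj s hs ν hν x hx hxs => trajectory_z hw hj (hpos hs)
      ⟨by linarith [hν.2], by linarith [hν.1]⟩ hx hxs
  have hv : ∀ {j} (hj : j < C.N) {s} (hs : C.tauMax < s) {ν} (_ : ν ∈ Icc 0 s),
      (hw.trajectory hj (hpos hs)).vp (s - ν) = C.vZero w (j + 1) (s - ν) :=
    fun hj s hs ν hν => trajectory_vp hw hj (hpos hs) ⟨by linarith [hν.2], by linarith [hν.1]⟩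
  have hwin : ∀ {j} (hj : j < C.N) {s} (hs : C.tauMax < s) {ν} (_ : ν ∈ uIcc 0 (C.tau j)),
      ν ∈ Icc 0 s := fun hj s hs ν hν => by
    rw [uIcc_of_le (C.tau_pos _).le] at hν
    exact ⟨hν.1, hν.2.trans (htau hj hs)⟩
  have h00 : (0 : ℝ) ∈ Icc (0 : ℝ) 1 := by simp
  have hz0 : ∀ {j} (hj : j < C.N) {s} (hs : C.tauMax < s) {ν} (_ : ν ∈ Icc 0 s),
      (hw.trajectory hj (hpos hs)).z ker (s - ν) 0 = ker.target w j (s - ν) 0 :=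
    fun hj s hs ν hν => hz hj hs hν h00 (by rw [zero_div]; linarith [hν.2])
  have hα : ∀ {j} (hj : j < C.N) {s} (hs : C.tauMax < s) k,
      ker.target w j s 0 (Sum.inl k) = w j s 0 (Sum.inl k) +
        (∫ ν in (0 : ℝ)..C.tau j, (h1 j ν *ᵥ (ker.signals w).a0 j (s - ν)) k) +
        ∫ ν in (0 : ℝ)..C.tau j, (h2 j ν *ᵥ (ker.signals w).v0 (j + 1) (s - ν)) k := by
    intro j hj s hs k
    obtain ⟨-, -, -, -, -, -, -, -, -, -, r⟩ := hrep j hj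
    have := ((r (hw.trajectory hj (hpos hs))).2 s (htau hj hs) le_rfl).1 k
    have e := hz0 hj hs (ν := 0) ⟨le_rfl, hpos hs⟩
    rw [sub_zero] at e
    rw [e, trajectory_w hw hj (hpos hs) ⟨hpos hs, le_rfl⟩ h00] at this
    rw [this]
    congr 1
    · congr 1
      refine intervalIntegral.integral_congr fun ν hν => ?_
      simp only [hz0 hj hs (hwin hj hs hν)]
      rfl
    · refine intervalIntegral.integral_congr fun ν hν => ?_
      simp only [hv hj hs (hwin hj hs hν)]
      rfl
  constructor
  · intro s hs
    ext k
    have h1 := hα C.N_pos hs k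
    have h2 := congrFun (hw.left_first s (hpos hs)) k
    have h3 : (ker.signals w).v0 0 s = fun l => w 0 s 0 (Sum.inr l) := vZero_of_lt w C.N_pos s
    simp only [DelayCoeff.eqA0, h3, tauPrev, intervalIntegral.integral_same]
    change ker.target w 0 s 0 (Sum.inl k) = _
    rw [h1, h2, Pi.add_apply]
    ring
  · intro j hj s hs
    ext k
    have hj' : j < C.N := (Nat.lt_succ_self j).trans hj
    have h1 := hα hj hs k
    have h2 := congrFun (hw.left_next j hj s (hpos hs)) k
    have h3 : (ker.signals w).v0 (j + 1) s = fun l => w (j + 1) s 0 (Sum.inr l) :=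
      vZero_of_lt w hj s
    have hv' := fun l (ν : ℝ) (hν : ν ∈ uIcc 0 (C.tau j)) =>
      congrFun (hv hj' hs (hwin hj' hs hν)) l
    have bv : ∀ l, BdMeas fun ν => (hw.trajectory hj' (hpos hs)).vp (s - ν) l := fun l =>
      ((hw.trajectory hj' (hpos hs)).vp_bdMeas l).comp (e := fun ν => s - ν) (by fun_prop)
    have bF : ∀ k' l, BdMeas fun ν => ker.truncF j 1 ν k' l := fun k' l =>
      (truncF_bdMeas hker k' l).comp₂ (f := fun x y => ker.truncF j x y k' l) measurable_const
        measurable_id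
    have hu : ∀ k', w j s 1 (Sum.inl k') = (ker.signals w).a1 j s k' -
        ∫ ν in (0 : ℝ)..C.tau j, ∑ l, ker.truncF j 1 ν k' l *
          (hw.trajectory hj' (hpos hs)).vp (s - ν) l := by
      intro k'
      have := congrFun (uOne_signals ker w j s) k'
      rw [← this]
      simp only [Kernels.uOne]
      congr 1
      have hl0 := (C.one_div_lam1_pos j).le
      refine intervalIntegral_eq_intervalIntegral_of_eq_zero le_rfl hl0
        (by rw [tau_eq]; linarith [C.one_div_mu1_pos j]) (fun y hy => ?_) fun y hy => ?_
      · have hy' : y ∈ uIcc 0 (C.tau j) := by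
          rw [uIcc_of_le (C.tau_pos j).le, tau_eq]
          exact ⟨hy.1, by linarith [hy.2, C.one_div_mu1_pos j]⟩
        simp only [hv' _ y hy', truncF_of_mem hj
          (show ((1 : ℝ), y) ∈ C.triF j from ⟨zero_le_one, le_rfl, hy.1, hy.2⟩)]
        rfl
      · rw [truncF_of_notMem fun h => hy ⟨h.2.2.1, h.2.2.2⟩]
        simp
    have h4 : ∫ ν in (0 : ℝ)..C.tau j, (ker.h3 (j + 1) ν *ᵥ (ker.signals w).v0 (j + 1) (s - ν)) k =
        - ∑ k', C.Qc j k k' * ∫ ν in (0 : ℝ)..C.tau j, ∑ l, ker.truncF j 1 ν k' l *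
          (hw.trajectory hj' (hpos hs)).vp (s - ν) l := by
      simp only [← intervalIntegral.integral_const_mul]
      rw [← intervalIntegral.integral_finsetSum, ← intervalIntegral.integral_neg]
      · refine intervalIntegral.integral_congr fun ν hν => ?_
        simp only [hv' _ ν hν, Kernels.h3, Matrix.mulVec, dotProduct, Matrix.neg_apply,
          Matrix.mul_apply, neg_mul, Finset.sum_neg_distrib, Finset.sum_mul, Finset.mul_sum]
        rw [Finset.sum_comm]
        simp only [mul_assoc]
        rfl
      · exact fun k' _ => ((BdMeas.sum _ fun l _ => (bF k' l).mul (bv l)).const_mul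
          _).intervalIntegrable _ _
    simp only [DelayCoeff.eqA0, h3, tauPrev, h4]
    change ker.target w (j + 1) s 0 (Sum.inl k) = _
    rw [h1, h2, Pi.add_apply]
    have h5 : (C.Qc j *ᵥ fun k => w j s 1 (Sum.inl k)) k =
        (C.Qc j *ᵥ (ker.signals w).a1 j s) k -
          ∑ k', C.Qc j k k' * ∫ ν in (0 : ℝ)..C.tau j, ∑ l, ker.truncF j 1 ν k' l *
          (hw.trajectory hj' (hpos hs)).vp (s - ν) l := by
      simp only [Matrix.mulVec, dotProduct, hu, mul_sub, Finset.sum_sub_distrib]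
    rw [h5]
    ring
  · intro j hj s hs
    ext l
    obtain ⟨-, -, -, -, -, -, -, -, -, -, r⟩ := hrep j hj
    have := ((r (hw.trajectory hj (hpos hs))).2 s (htau hj hs) le_rfl).2 l
    rw [trajectory_w hw hj (hpos hs) ⟨hpos hs, le_rfl⟩ h00] at this
    have hts := htau hj hs
    rw [tau_eq] at hts
    have hml := C.one_div_mu_le j l
    have hmem : 1 / C.mu j l ∈ Icc 0 s := ⟨(one_div_pos.2 (C.mu_pos j l)).le, by
      linarith [C.one_div_lam1_pos j]⟩
    rw [hz hj hs hmem (by simp) (by linarith), hv hj hs hmem] at this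
    change C.vZero w j s l = _
    rw [vZero_of_lt w hj]
    refine this.trans ?_
    unfold DelayCoeff.eqV0
    congr 1
    · congr 1
      refine intervalIntegral.integral_congr fun ν hν => ?_
      simp only [hz0 hj hs (hwin hj hs hν)]
      rfl
    · refine intervalIntegral.integral_congr fun ν hν => ?_
      simp only [hv hj hs (hwin hj hs hν)]
      rfl
  · intro j hj s hs x hx
    obtain ⟨-, -, -, -, -, -, -, hGt, -, c, -⟩ := hrep j hj
    have hxs : x / C.lam1 j ≤ s :=
      (div_le_div_of_nonneg_right hx.2 (C.lam1_pos j).le).trans (hlam hj hs)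
    have e := hz hj hs (ν := 0) ⟨le_rfl, hpos hs⟩ hx (by rwa [sub_zero])
    rw [sub_zero] at e
    ext a
    cases a with
    | inl k =>
      have := c (hw.trajectory hj (hpos hs)) k x hx s hxs le_rfl
      have hlk := C.lam_pos j k
      have hx0 : 0 ≤ x / C.lam j k := div_nonneg hx.1 hlk.le
      have hxk : x / C.lam j k ≤ s :=
        (div_le_div_of_nonneg_left hx.1 (C.lam1_pos j) (C.lam1_le j k)).trans hxs
      rw [e, hz0 hj hs ⟨hx0, hxk⟩] at this
      rw [this]
      simp only [reconstructTarget, Sum.elim_inl, DelayCoeff.eqA]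
      congr 1
      refine Finset.sum_congr rfl fun q _ => ?_
      rw [← intervalIntegral_eq_integral_of_eq_zero hx0 fun ν hν => by
        rw [hGt k q x ν hν, zero_mul]]
      refine intervalIntegral.integral_congr fun ν hν => ?_
      rw [uIcc_of_le hx0] at hν
      simp only [hz0 hj hs ⟨hν.1, hν.2.trans hxk⟩]
      rfl
    | inr l =>
      have hml := C.mu_pos j l
      have hts := htau hj hs
      rw [tau_eq] at hts
      have hx1 : (1 - x) / C.mu j l ≤ s := by
        have h1 : (1 - x) / C.mu j l ≤ 1 / C.mu j l :=
          div_le_div_of_nonneg_right (by linarith [hx.1]) hml.le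
        linarith [C.one_div_mu_le j l, C.one_div_lam1_pos j]
      have hx0 : 0 ≤ (1 - x) / C.mu j l := div_nonneg (by linarith [hx.2]) hml.le
      have := SubTrajectory.z_inr_eq hker hj (hw.trajectory hj (hpos hs)) l hx hx1 le_rfl
      have hmem : ∀ ν ∈ uIcc 0 ((1 - x) / C.mu j l), ν ∈ Icc 0 s ∧
          x + C.mu j l * ν ∈ Icc (0 : ℝ) 1 := by
        intro ν hν
        rw [uIcc_of_le hx0] at hν
        refine ⟨⟨hν.1, hν.2.trans hx1⟩, by nlinarith [hx.1, hν.1], ?_⟩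
        have := (le_div_iff₀ hml).1 hν.2
        linarith
      have hw1 : ∀ ν ∈ Icc 0 s, (hw.trajectory hj (hpos hs)).w (s - ν) 1 = w j (s - ν) 1 :=
        fun ν hν => trajectory_w hw hj (hpos hs) ⟨by linarith [hν.2], by linarith [hν.1]⟩ (by simp)
      rw [e, hv hj hs ⟨hx0, hx1⟩, hw1 _ ⟨hx0, hx1⟩] at this
      rw [this]
      simp only [reconstructTarget, Sum.elim_inr, Kernels.eqB, uOne_signals]
      rw [← add_assoc]
      congr 1
      · congr 1
        refine intervalIntegral.integral_congr fun ν hν => ?_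
        obtain ⟨m1, m2⟩ := hmem ν hν
        simp only [hw1 ν m1, Kernels.truncGbar, if_pos m2]
        rfl
      · refine intervalIntegral.integral_congr fun ν hν => ?_
        obtain ⟨m1, m2⟩ := hmem ν hν
        simp only [hv hj hs m1, Kernels.truncfbar, if_pos m2]
        rfl
  · intro j hj s hs x hx
    ext a
    obtain ⟨-, -, -, -, -, -, -, -, hL, -, r⟩ := hrep j hj
    have := (r (hw.trajectory hj (hpos hs))).1 s x hx a
    have e : ∀ y ∈ Icc (0 : ℝ) 1, (hw.trajectory hj (hpos hs)).z ker s y = ker.target w j s y :=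
      fun y hy => by
        have := hz hj hs (ν := 0) ⟨le_rfl, hpos hs⟩ hy (by
          rw [sub_zero]
          exact (div_le_div_of_nonneg_right hy.2 (C.lam1_pos j).le).trans (hlam hj hs))
        rwa [sub_zero] at this
    rw [trajectory_w hw hj (hpos hs) ⟨hpos hs, le_rfl⟩ hx, e x hx] at this
    rw [this]
    unfold DelayCoeff.inverse
    congr 1
    · congr 1
      refine intervalIntegral.integral_congr fun y hy => ?_
      rw [uIcc_of_le (C.one_div_lam1_pos j).le] at hy
      simp only [hv hj hs (ν := y) ⟨hy.1, hy.2.trans (hlam hj hs)⟩]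
      rfl
    · refine (intervalIntegral_eq_intervalIntegral_of_eq_zero hx.1 hx.2 le_rfl (fun y hy => ?_)
        fun y hy => ?_).symm
      · simp only [← e y ⟨hx.1.trans hy.1, hy.2⟩]
        rfl
      · rw [hL x y fun h => hy ⟨h.2.1, h.2.2⟩]
        simp

end HyperbolicChain

end

noncomputable section

namespace HyperbolicChain

variable {C : HyperbolicChain}

/-! ### Dependence of the delay equations on the signals -/

/-- Signals advanced by `d`. -/
def Signals.shift (B : C.Signals) (d : ℝ) : C.Signals where
  a0 := fun j s => B.a0 j (s + d)
  a1 := fun j s => B.a1 j (s + d)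
  v0 := fun j s => B.v0 j (s + d)

section

variable (ker : C.Kernels) (cf : C.DelayCoeff) (B : C.Signals) (d : ℝ) (j : ℕ)

lemma eqA0_shift (p : Fin (C.n j) → ℝ) (s : ℝ) :
    cf.eqA0 (B.shift d) j p s = cf.eqA0 B j p (s + d) := by
  unfold DelayCoeff.eqA0 Signals.shift
  simp only [sub_add_eq_add_sub]

lemma eqA_shift (s x : ℝ) : cf.eqA (B.shift d) j s x = cf.eqA B j (s + d) x := by
  unfold DelayCoeff.eqA Signals.shift
  simp only [sub_add_eq_add_sub]

lemma eqV0_shift (s : ℝ) : cf.eqV0 (B.shift d) j s = cf.eqV0 B j (s + d) := by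
  unfold DelayCoeff.eqV0 Signals.shift
  simp only [sub_add_eq_add_sub]

lemma eqB_shift (s x : ℝ) : ker.eqB (B.shift d) j s x = ker.eqB B j (s + d) x := by
  unfold Kernels.eqB Kernels.uOne Signals.shift
  simp only [sub_add_eq_add_sub]

lemma reconstructTarget_shift (s x : ℝ) :
    reconstructTarget ker cf (B.shift d) j s x = reconstructTarget ker cf B j (s + d) x := by
  simp only [reconstructTarget, eqA_shift, eqB_shift]

lemma reconstructState_shift (s x : ℝ) :
    reconstructState ker cf (B.shift d) j s x = reconstructState ker cf B j (s + d) x := by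
  unfold reconstructState DelayCoeff.inverse
  simp only [reconstructTarget_shift]
  unfold Signals.shift
  simp only [sub_add_eq_add_sub]

end

lemma reconstructTarget_congr (ker : C.Kernels) (cf : C.DelayCoeff) {B B' : C.Signals} {j : ℕ}
    {s : ℝ} (h0 : ∀ r ∈ Icc (s - C.tau j) s, B.a0 j r = B'.a0 j r)
    (h1 : ∀ r ∈ Icc (s - 1 / C.mu1 j) s, B.a1 j r = B'.a1 j r)
    (hv : ∀ r ∈ Icc (s - C.tau j) s, B.v0 (j + 1) r = B'.v0 (j + 1) r) {x : ℝ}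
    (hx : x ∈ Icc (0 : ℝ) 1) :
    reconstructTarget ker cf B j s x = reconstructTarget ker cf B' j s x := by
  have hl0 := C.one_div_lam1_pos j
  have hm0 := C.one_div_mu1_pos j
  rw [tau_eq] at h0 hv
  ext a
  cases a with
  | inl k =>
    have hlk := C.lam_pos j k
    have hx0 : 0 ≤ x / C.lam j k := div_nonneg hx.1 hlk.le
    have hx1 : x / C.lam j k ≤ 1 / C.lam1 j :=
      (div_le_div_of_nonneg_right hx.2 hlk.le).trans (C.one_div_lam_le j k)
    simp only [reconstructTarget, Sum.elim_inl, DelayCoeff.eqA]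
    rw [h0 _ ⟨by linarith, by linarith⟩]
    congr 1
    refine Finset.sum_congr rfl fun q _ => intervalIntegral.integral_congr fun ν hν => ?_
    rw [uIcc_of_le hx0] at hν
    rw [h0 _ ⟨by linarith [hν.2], by linarith [hν.1]⟩]
  | inr l =>
    have hml := C.mu_pos j l
    have hx0 : 0 ≤ (1 - x) / C.mu j l := div_nonneg (by linarith [hx.2]) hml.le
    have hx1 : (1 - x) / C.mu j l ≤ 1 / C.mu1 j :=
      (div_le_div_of_nonneg_right (by linarith [hx.1]) hml.le).trans (C.one_div_mu_le j l)
    have hu : ∀ ν ∈ Icc 0 ((1 - x) / C.mu j l), ker.uOne B j (s - ν) = ker.uOne B' j (s - ν) := by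
      intro ν hν
      ext k
      unfold Kernels.uOne
      rw [h1 _ ⟨by linarith [hν.2], by linarith [hν.1]⟩]
      congr 1
      refine intervalIntegral.integral_congr fun y hy => ?_
      rw [uIcc_of_le hl0.le] at hy
      rw [hv _ ⟨by linarith [hν.2, hy.2], by linarith [hν.1, hy.1]⟩]
    simp only [reconstructTarget, Sum.elim_inr, Kernels.eqB]
    rw [hu _ ⟨hx0, le_rfl⟩, hv (s - (1 - x) / C.mu j l) ⟨by linarith, by linarith⟩]
    congr 1
    · congr 1
      refine intervalIntegral.integral_congr fun ν hν => ?_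
      rw [uIcc_of_le hx0] at hν
      rw [hu ν hν]
    · refine intervalIntegral.integral_congr fun ν hν => ?_
      rw [uIcc_of_le hx0] at hν
      rw [hv _ ⟨by linarith [hν.2], by linarith [hν.1]⟩]

lemma reconstructState_congr (ker : C.Kernels) (cf : C.DelayCoeff) {B B' : C.Signals} {j : ℕ}
    {s : ℝ} (h0 : ∀ r ∈ Icc (s - C.tau j) s, B.a0 j r = B'.a0 j r)
    (h1 : ∀ r ∈ Icc (s - 1 / C.mu1 j) s, B.a1 j r = B'.a1 j r)
    (hv : ∀ r ∈ Icc (s - C.tau j) s, B.v0 (j + 1) r = B'.v0 (j + 1) r) {x : ℝ}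
    (hx : x ∈ Icc (0 : ℝ) 1) :
    reconstructState ker cf B j s x = reconstructState ker cf B' j s x := by
  have ht := fun y hy => reconstructTarget_congr ker cf h0 h1 hv (x := y) hy
  ext a
  unfold reconstructState DelayCoeff.inverse
  simp only [ht x hx]
  congr 1
  · congr 1
    refine intervalIntegral.integral_congr fun y hy => ?_
    rw [uIcc_of_le (C.one_div_lam1_pos j).le] at hy
    rw [hv _ ⟨by rw [tau_eq]; linarith [hy.2, C.one_div_mu1_pos j], by linarith [hy.1]⟩]
  · refine intervalIntegral.integral_congr fun y hy => ?_
    rw [uIcc_of_le hx.2] at hy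
    rw [ht y ⟨hx.1.trans hy.1, hy.2⟩]

end HyperbolicChain

/-! ### Difference of two delayed signals -/

lemma intervalIntegrable_delay {c x : ℝ → ℝ} {M Y W σ' s : ℝ} (hc : Measurable c)
    (hM : ∀ ν, |c ν| ≤ M) (hx : IntegrableOn x (Icc W σ')) (hY : 0 ≤ Y) (hW : W ≤ s - Y)
    (hs : s ≤ σ') : IntervalIntegrable (fun ν => c ν * x (s - ν)) volume 0 Y := by
  have h1 : IntervalIntegrable x volume (s - Y) s :=
    (intervalIntegrable_iff_integrableOn_Icc_of_le (by linarith)).2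
      (hx.mono_set (Icc_subset_Icc hW hs))
  have h2 := (h1.comp_sub_left s).symm
  rw [sub_sub_cancel, sub_self] at h2
  rw [intervalIntegrable_iff] at h2 ⊢
  exact Integrable.bdd_mul h2 hc.aestronglyMeasurable (Filter.Eventually.of_forall hM)

lemma abs_integral_delay_sub_le {c x y : ℝ → ℝ} {M Y W σ σ' s : ℝ} (hc : Measurable c)
    (hM : ∀ ν, |c ν| ≤ M) (hx : IntegrableOn x (Icc W σ')) (hy : IntegrableOn y (Icc W σ'))
    (heq : ∀ r ∈ Icc W σ, x r = y r) (hY : 0 ≤ Y) (hW : W ≤ s - Y) (hWσ : W ≤ σ)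
    (hs : s ∈ Ioc σ σ') :
    |(∫ ν in (0 : ℝ)..Y, c ν * x (s - ν)) - ∫ ν in (0 : ℝ)..Y, c ν * y (s - ν)| ≤
      M * ∫ r in σ..σ', |x r - y r| := by
  have hM0 : 0 ≤ M := (abs_nonneg _).trans (hM 0)
  have hσ : σ ≤ σ' := hs.1.le.trans hs.2
  rw [← intervalIntegral.integral_sub (intervalIntegrable_delay hc hM hx hY hW hs.2)
    (intervalIntegrable_delay hc hM hy hY hW hs.2)]
  set ind : ℝ → ℝ := (Ioc σ σ').indicator fun r => |x r - y r| with hind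
  have hi : Integrable ind := by
    rw [hind, integrable_indicator_iff measurableSet_Ioc]
    have h : IntegrableOn (fun r => |x r - y r|) (Icc W σ') := Integrable.abs (hx.sub hy)
    exact h.mono_set (Ioc_subset_Icc_self.trans (Icc_subset_Icc_left hWσ))
  have hi0 : ∀ r, 0 ≤ ind r := fun r => indicator_nonneg (fun _ _ => abs_nonneg _) r
  have hi' : Integrable (fun ν => M * ind (s - ν)) := (hi.comp_sub_left s).const_mul M
  have h1 : ∀ ν ∈ Ioc 0 Y, ‖c ν * x (s - ν) - c ν * y (s - ν)‖ ≤ M * ind (s - ν) := by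
    intro ν hν
    rw [← mul_sub, norm_mul, Real.norm_eq_abs, Real.norm_eq_abs]
    rcases le_or_gt (s - ν) σ with h | h
    · rw [heq _ ⟨by linarith [hν.2], h⟩, sub_self, abs_zero, mul_zero]
      exact mul_nonneg hM0 (hi0 _)
    · have : ind (s - ν) = |x (s - ν) - y (s - ν)| :=
        indicator_of_mem (show s - ν ∈ Ioc σ σ' from ⟨h, by linarith [hν.1, hs.2]⟩) _
      rw [this]
      exact mul_le_mul_of_nonneg_right (hM ν) (abs_nonneg _)
  have h2 := intervalIntegral.norm_integral_le_of_norm_le hY (Filter.Eventually.of_forall h1)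
    hi'.intervalIntegrable
  refine h2.trans ?_
  rw [intervalIntegral.integral_of_le hY]
  refine (setIntegral_le_integral hi' (Filter.Eventually.of_forall fun ν =>
    mul_nonneg hM0 (hi0 _))).trans_eq ?_
  rw [integral_const_mul, integral_sub_left_eq_self ind volume s, hind,
    integral_indicator measurableSet_Ioc, ← intervalIntegral.integral_of_le hσ]

lemma abs_integral_mulVec_delay_sub_le {ι κ : Type} [Fintype κ] {A : ℝ → Matrix ι κ ℝ}
    {x y : ℝ → κ → ℝ} {M Y W σ σ' s : ℝ} (hA : ∀ a b, Measurable fun ν => A ν a b)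
    (hM : ∀ ν a b, |A ν a b| ≤ M) (hx : ∀ b, IntegrableOn (fun r => x r b) (Icc W σ'))
    (hy : ∀ b, IntegrableOn (fun r => y r b) (Icc W σ'))
    (heq : ∀ r ∈ Icc W σ, x r = y r) (hY : 0 ≤ Y) (hW : W ≤ s - Y) (hWσ : W ≤ σ)
    (hs : s ∈ Ioc σ σ') (a : ι) :
    |(∫ ν in (0 : ℝ)..Y, (A ν *ᵥ x (s - ν)) a) - ∫ ν in (0 : ℝ)..Y, (A ν *ᵥ y (s - ν)) a| ≤
      M * ∫ r in σ..σ', ∑ b, |x r b - y r b| := by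
  have hσ : σ ≤ σ' := hs.1.le.trans hs.2
  have hd : ∀ b, IntervalIntegrable (fun r => |x r b - y r b|) volume σ σ' := by
    intro b
    have h : IntegrableOn (fun r => |x r b - y r b|) (Icc W σ') :=
      Integrable.abs ((hx b).sub (hy b))
    exact (intervalIntegrable_iff_integrableOn_Icc_of_le hσ).2
      (h.mono_set (Icc_subset_Icc_left hWσ))
  simp only [Matrix.mulVec, dotProduct]
  rw [intervalIntegral.integral_finsetSum fun b _ => intervalIntegrable_delay
      (x := fun r => x r b) (hA a b) (fun ν => hM ν a b) (hx b) hY hW hs.2,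
    intervalIntegral.integral_finsetSum fun b _ => intervalIntegrable_delay
      (x := fun r => y r b) (hA a b) (fun ν => hM ν a b) (hy b) hY hW hs.2,
    intervalIntegral.integral_finsetSum fun b _ => hd b, ← Finset.sum_sub_distrib, Finset.mul_sum]
  refine (Finset.abs_sum_le_sum_abs _ _).trans (Finset.sum_le_sum fun b _ => ?_)
  exact abs_integral_delay_sub_le (x := fun r => x r b) (y := fun r => y r b) (hA a b)
    (fun ν => hM ν a b) (hx b) (hy b) (fun r hr => by simp only [heq r hr]) hY hW hWσ hs

end

noncomputable section

namespace HyperbolicChain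

variable {C : HyperbolicChain}

/-- The integral-delay recursion for the subsystems `j ≥ i` on `(S, T]`, with history on
`[S - max_r τ_r, S]` and exogenous input `V`. -/
structure IsRecursion (cf : C.DelayCoeff) (i : ℕ) (V : ℝ → Fin (C.n i) → ℝ) (S T : ℝ)
    (P : C.Signals) : Prop where
  a0_integrable : ∀ j, i ≤ j → j < C.N → ∀ k,
    IntegrableOn (fun s => P.a0 j s k) (Icc (S - C.tauMax) T)
  v0_integrable : ∀ j, i ≤ j → j ≤ C.N → ∀ l,
    IntegrableOn (fun s => P.v0 j s l) (Icc (S - C.tauMax) T)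
  v0_end : ∀ s ∈ Icc (S - C.tauMax) T, P.v0 C.N s = 0
  a0_first : ∀ s ∈ Ioc S T, P.a0 i s = cf.eqA0 P i (V s) s
  a0_next : ∀ j, i ≤ j → j + 1 < C.N → ∀ s ∈ Ioc S T,
    P.a0 (j + 1) s = cf.eqA0 P (j + 1) (C.Qc j *ᵥ P.a1 j s) s
  a1_eq : ∀ j, i ≤ j → j < C.N → ∀ s ∈ Ioc S T, P.a1 j s = cf.eqA P j s 1
  v0_eq : ∀ j, i ≤ j → j < C.N → ∀ s ∈ Ioc S T, P.v0 j s = cf.eqV0 P j s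

/-- Two families of signals agree up to the time `σ`. -/
structure AgreeUpTo (i : ℕ) (S σ : ℝ) (P P' : C.Signals) : Prop where
  a0 : ∀ j, i ≤ j → j < C.N → ∀ s ∈ Icc (S - C.tauMax) σ, P.a0 j s = P'.a0 j s
  a1 : ∀ j, i ≤ j → j < C.N → ∀ s ∈ Icc (S - 1 / C.mu1 j) σ, P.a1 j s = P'.a1 j s
  v0 : ∀ j, i ≤ j → j ≤ C.N → ∀ s ∈ Icc (S - C.tauMax) σ, P.v0 j s = P'.v0 j s

lemma BddMeas₁.eventually_le {ι κ : Type} [Finite ι] [Finite κ] {f : ℝ → Matrix ι κ ℝ}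
    (hf : BddMeas₁ f) : ∀ᶠ M in Filter.atTop, ∀ a b ν, |f ν a b| ≤ M := by
  refine Filter.eventually_all.2 fun a => Filter.eventually_all.2 fun b => ?_
  obtain ⟨M, hM⟩ := (hf a b).2
  filter_upwards [Filter.eventually_ge_atTop M] with M' h ν
  exact (hM ν).trans h

lemma BddMeas₂.eventually_le {ι κ : Type} [Finite ι] [Finite κ] {f : ℝ → ℝ → Matrix ι κ ℝ}
    (hf : BddMeas₂ f) : ∀ᶠ M in Filter.atTop, ∀ a b x ν, |f x ν a b| ≤ M := by
  refine Filter.eventually_all.2 fun a => Filter.eventually_all.2 fun b => ?_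
  obtain ⟨M, hM⟩ := (hf a b).2
  filter_upwards [Filter.eventually_ge_atTop M] with M' h x ν
  exact (hM x ν).trans h

lemma eventually_le_of_finite {ι : Type*} [Finite ι] (f : ι → ℝ) :
    ∀ᶠ M in Filter.atTop, ∀ a, f a ≤ M :=
  Filter.eventually_all.2 fun a => Filter.eventually_ge_atTop (f a)

/-- `M` bounds all coefficients of the subsystem `j`. -/
structure CoeffBound (cf : C.DelayCoeff) (j : ℕ) (M : ℝ) : Prop where
  g1 : ∀ a b ν, |cf.g1 j ν a b| ≤ M
  g2 : ∀ a b ν, |cf.g2 j ν a b| ≤ M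
  h1 : ∀ a b ν, |cf.h1 j ν a b| ≤ M
  h2 : ∀ a b ν, |cf.h2 j ν a b| ≤ M
  h3 : ∀ a b ν, |cf.h3 j ν a b| ≤ M
  Gt : ∀ a b x ν, |cf.Gt j x ν a b| ≤ M
  lam : ∀ k, C.lam j k ≤ M
  mu : ∀ l, C.mu j l ≤ M
  Q : ∀ k, ∑ l, |C.Q j k l| ≤ M
  Qc : ∀ k, ∑ k', |C.Qc j k k'| ≤ M

lemma DelayCoeff.BddMeas.exists_bound {cf : C.DelayCoeff} (hcf : cf.BddMeas) :
    ∃ M : ℝ, 0 < M ∧ ∀ j < C.N, CoeffBound cf j M := by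
  have h : ∀ᶠ M in Filter.atTop, ∀ j ∈ Finset.range C.N, CoeffBound cf j M := by
    refine (Filter.eventually_all_finset _).2 fun j hj => ?_
    obtain ⟨h1, h2, h3, h4, h5, h6, -, -⟩ := hcf j (Finset.mem_range.1 hj)
    filter_upwards [h1.eventually_le, h2.eventually_le, h3.eventually_le, h4.eventually_le,
      h5.eventually_le, h6.eventually_le, eventually_le_of_finite (C.lam j),
      eventually_le_of_finite (C.mu j), eventually_le_of_finite fun k => ∑ l, |C.Q j k l|,
      eventually_le_of_finite fun k => ∑ k', |C.Qc j k k'|] with M a1 a2 a3 a4 a5 a6 a7 a8 a9 a10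
    exact ⟨a1, a2, a3, a4, a5, a6, a7, a8, a9, a10⟩
  obtain ⟨M, h1, h2⟩ := (h.and (Filter.eventually_gt_atTop 0)).exists
  exact ⟨M, h2, fun j hj => h1 j (Finset.mem_range.2 hj)⟩

lemma abs_mulVec_sub_le {ι κ : Type} [Fintype κ] {A : Matrix ι κ ℝ} {x y : κ → ℝ} {M D : ℝ}
    (hD : 0 ≤ D) (a : ι) (hA : ∑ b, |A a b| ≤ M) (h : ∀ b, |x b - y b| ≤ D) :
    |(A *ᵥ x) a - (A *ᵥ y) a| ≤ M * D := by
  simp only [Matrix.mulVec, dotProduct]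
  rw [← Finset.sum_sub_distrib]
  refine (Finset.abs_sum_le_sum_abs _ _).trans ?_
  refine le_trans ?_ (mul_le_mul_of_nonneg_right hA hD)
  rw [Finset.sum_mul]
  refine Finset.sum_le_sum fun b _ => ?_
  rw [← mul_sub, abs_mul]
  exact mul_le_mul_of_nonneg_left (h b) (abs_nonneg _)

lemma intervalIntegrable_finsetSum {ι : Type*} (s : Finset ι) {f : ι → ℝ → ℝ} {a b : ℝ}
    (h : ∀ i ∈ s, IntervalIntegrable (f i) volume a b) :
    IntervalIntegrable (fun x => ∑ i ∈ s, f i x) volume a b := by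
  have := IntervalIntegrable.sum s h
  rwa [Finset.sum_fn] at this

/-- The total difference of two families of signals. -/
def signalDist (i : ℕ) (P P' : C.Signals) (s : ℝ) : ℝ :=
  (∑ j ∈ Finset.Ico i C.N, ∑ k, |P.a0 j s k - P'.a0 j s k|) +
    ∑ j ∈ Finset.Icc i C.N, ∑ l, |P.v0 j s l - P'.v0 j s l|

lemma exists_step {cf : C.DelayCoeff} (hcf : cf.BddMeas) (i : ℕ) :
    ∃ δ : ℝ, 0 < δ ∧ ∀ (V : ℝ → Fin (C.n i) → ℝ) (S T : ℝ) (P P' : C.Signals),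
      IsRecursion cf i V S T P → IsRecursion cf i V S T P' → ∀ σ σ', S ≤ σ → σ ≤ σ' → σ' ≤ T →
      σ' - σ ≤ δ → AgreeUpTo i S σ P P' → AgreeUpTo i S σ' P P' := by
  obtain ⟨M, hM0, hM⟩ := hcf.exists_bound
  obtain ⟨c₀, hc₀⟩ : ∃ c₀ : ℝ, c₀ = M * (2 * M) + M * M + 3 * M := ⟨_, rfl⟩
  have hc₀0 : 0 ≤ c₀ := by rw [hc₀]; positivity
  obtain ⟨c, hc⟩ : ∃ c : ℝ, c = (∑ j ∈ Finset.Ico i C.N, ∑ _k : Fin (C.n j), c₀) +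
    ∑ j ∈ Finset.Icc i C.N, ∑ _l : Fin (C.m j), 2 * M := ⟨_, rfl⟩
  have hM2 : 0 ≤ 2 * M := by linarith
  have hc0 : 0 ≤ c := by
    rw [hc]
    exact add_nonneg (Finset.sum_nonneg fun _ _ => Finset.sum_nonneg fun _ _ => hc₀0)
      (Finset.sum_nonneg fun _ _ => Finset.sum_nonneg fun _ _ => hM2)
  refine ⟨1 / (c + M + 1), by positivity, fun V S T P P' hP hP' σ σ' hS hσ hT hδ hA => ?_⟩
  have htm : 0 ≤ C.tauMax := (C.tau_pos 0).le.trans (C.tau_le_tauMax C.N_pos)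
  have hWσ : S - C.tauMax ≤ σ := by linarith
  have hsub : Icc (S - C.tauMax) σ' ⊆ Icc (S - C.tauMax) T := Icc_subset_Icc_right hT
  have hδM : ∀ {x : ℝ}, 0 < x → x ≤ M → σ' - σ ≤ 1 / x := fun hx hxM =>
    hδ.trans (one_div_le_one_div_of_le hx (by linarith))
  have ia : ∀ j, i ≤ j → j < C.N → ∀ k, IntervalIntegrable
      (fun r => |P.a0 j r k - P'.a0 j r k|) volume σ σ' := by
    intro j hij hj k
    have h : IntegrableOn (fun r => |P.a0 j r k - P'.a0 j r k|) (Icc (S - C.tauMax) T) :=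
      Integrable.abs ((hP.a0_integrable j hij hj k).sub (hP'.a0_integrable j hij hj k))
    exact (intervalIntegrable_iff_integrableOn_Icc_of_le hσ).2
      (h.mono_set (Icc_subset_Icc hWσ hT))
  have iv : ∀ j, i ≤ j → j ≤ C.N → ∀ l, IntervalIntegrable
      (fun r => |P.v0 j r l - P'.v0 j r l|) volume σ σ' := by
    intro j hij hj l
    have h : IntegrableOn (fun r => |P.v0 j r l - P'.v0 j r l|) (Icc (S - C.tauMax) T) :=
      Integrable.abs ((hP.v0_integrable j hij hj l).sub (hP'.v0_integrable j hij hj l))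
    exact (intervalIntegrable_iff_integrableOn_Icc_of_le hσ).2
      (h.mono_set (Icc_subset_Icc hWσ hT))
  have isa : ∀ j ∈ Finset.Ico i C.N, IntervalIntegrable
      (fun r => ∑ k, |P.a0 j r k - P'.a0 j r k|) volume σ σ' := fun j hj =>
    intervalIntegrable_finsetSum _ fun k _ => ia j (Finset.mem_Ico.1 hj).1 (Finset.mem_Ico.1 hj).2 k
  have isv : ∀ j ∈ Finset.Icc i C.N, IntervalIntegrable
      (fun r => ∑ l, |P.v0 j r l - P'.v0 j r l|) volume σ σ' := fun j hj =>
    intervalIntegrable_finsetSum _ fun l _ => iv j (Finset.mem_Icc.1 hj).1 (Finset.mem_Icc.1 hj).2 l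
  have iea := intervalIntegrable_finsetSum (Finset.Ico i C.N) isa
  have iev := intervalIntegrable_finsetSum (Finset.Icc i C.N) isv
  have ie : IntervalIntegrable (signalDist i P P') volume σ σ' := iea.add iev
  obtain ⟨E, hE⟩ : ∃ E, E = ∫ r in σ..σ', signalDist i P P' r := ⟨_, rfl⟩
  have hEa : ∀ j, i ≤ j → j < C.N → ∫ r in σ..σ', ∑ k, |P.a0 j r k - P'.a0 j r k| ≤ E := by
    intro j hij hj
    have hm := Finset.mem_Ico.2 ⟨hij, hj⟩
    rw [hE]
    refine intervalIntegral.integral_mono_on hσ (isa j hm) ie fun r _ => ?_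
    refine le_add_of_le_of_nonneg (Finset.single_le_sum (f := fun j =>
      ∑ k, |P.a0 j r k - P'.a0 j r k|) (fun _ _ => Finset.sum_nonneg fun _ _ => abs_nonneg _) hm) ?_
    exact Finset.sum_nonneg fun _ _ => Finset.sum_nonneg fun _ _ => abs_nonneg _
  have hEv : ∀ j, i ≤ j → j ≤ C.N → ∫ r in σ..σ', ∑ l, |P.v0 j r l - P'.v0 j r l| ≤ E := by
    intro j hij hj
    have hm := Finset.mem_Icc.2 ⟨hij, hj⟩
    rw [hE]
    refine intervalIntegral.integral_mono_on hσ (isv j hm) ie fun r _ => ?_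
    refine le_add_of_nonneg_of_le ?_ (Finset.single_le_sum (f := fun j =>
      ∑ l, |P.v0 j r l - P'.v0 j r l|) (fun _ _ => Finset.sum_nonneg fun _ _ => abs_nonneg _) hm)
    exact Finset.sum_nonneg fun _ _ => Finset.sum_nonneg fun _ _ => abs_nonneg _
  have hE0 : 0 ≤ E := by
    rw [hE]
    exact intervalIntegral.integral_nonneg hσ fun r _ => add_nonneg
      (Finset.sum_nonneg fun _ _ => Finset.sum_nonneg fun _ _ => abs_nonneg _)
      (Finset.sum_nonneg fun _ _ => Finset.sum_nonneg fun _ _ => abs_nonneg _)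
  have dA : ∀ j, i ≤ j → j < C.N → ∀ {ι : Type} {A : ℝ → Matrix ι (Fin (C.n j)) ℝ},
      BddMeas₁ A → (∀ a b ν, |A ν a b| ≤ M) → ∀ {Y s}, 0 ≤ Y → Y ≤ C.tauMax → s ∈ Ioc σ σ' → ∀ a,
      |(∫ ν in (0 : ℝ)..Y, (A ν *ᵥ P.a0 j (s - ν)) a) -
        ∫ ν in (0 : ℝ)..Y, (A ν *ᵥ P'.a0 j (s - ν)) a| ≤ M * E := by
    intro j hij hj ι A hA1 hA2 Y s hY hYt hs a
    refine (abs_integral_mulVec_delay_sub_le (fun a b => (hA1 a b).1) (fun ν a b => hA2 a b ν)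
      (fun k => (hP.a0_integrable j hij hj k).mono_set hsub)
      (fun k => (hP'.a0_integrable j hij hj k).mono_set hsub) (hA.a0 j hij hj) hY
      (by linarith [hs.1]) hWσ hs a).trans ?_
    exact mul_le_mul_of_nonneg_left (hEa j hij hj) hM0.le
  have dV : ∀ j, i ≤ j → j ≤ C.N → ∀ {ι : Type} {A : ℝ → Matrix ι (Fin (C.m j)) ℝ},
      BddMeas₁ A → (∀ a b ν, |A ν a b| ≤ M) → ∀ {Y s}, 0 ≤ Y → Y ≤ C.tauMax → s ∈ Ioc σ σ' → ∀ a,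
      |(∫ ν in (0 : ℝ)..Y, (A ν *ᵥ P.v0 j (s - ν)) a) -
        ∫ ν in (0 : ℝ)..Y, (A ν *ᵥ P'.v0 j (s - ν)) a| ≤ M * E := by
    intro j hij hj ι A hA1 hA2 Y s hY hYt hs a
    refine (abs_integral_mulVec_delay_sub_le (fun a b => (hA1 a b).1) (fun ν a b => hA2 a b ν)
      (fun k => (hP.v0_integrable j hij hj k).mono_set hsub)
      (fun k => (hP'.v0_integrable j hij hj k).mono_set hsub) (hA.v0 j hij hj) hY
      (by linarith [hs.1]) hWσ hs a).trans ?_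
    exact mul_le_mul_of_nonneg_left (hEv j hij hj) hM0.le
  have hsT : ∀ {s}, s ∈ Ioc σ σ' → s ∈ Ioc S T := fun hs =>
    ⟨hS.trans_lt hs.1, hs.2.trans hT⟩
  have bv : ∀ j, i ≤ j → j < C.N → ∀ s ∈ Ioc σ σ', ∀ l,
      |P.v0 j s l - P'.v0 j s l| ≤ 2 * M * E := by
    intro j hij hj s hs l
    obtain ⟨b1, b2, -⟩ := hcf j hj
    have hml := C.mu_pos j l
    have h1 := hδM hml ((hM j hj).mu l)
    have h2 := C.one_div_mu_le j l
    have h3 := C.tau_le_tauMax hj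
    have h4 := C.one_div_lam1_pos j
    have ht := h3
    rw [tau_eq] at h3
    rw [hP.v0_eq j hij hj s (hsT hs), hP'.v0_eq j hij hj s (hsT hs)]
    unfold DelayCoeff.eqV0
    rw [hA.a1 j hij hj (s - 1 / C.mu j l) ⟨by linarith [hs.1], by linarith [hs.2]⟩,
      hA.v0 (j + 1) (by omega) hj (s - 1 / C.mu j l) ⟨by linarith [hs.1], by linarith [hs.2]⟩]
    have e1 := abs_le.1 (dA j hij hj b1 (hM j hj).g1 (C.tau_pos j).le ht hs l)
    have e2 := abs_le.1 (dV (j + 1) (by omega) hj b2 (hM j hj).g2 (C.tau_pos j).le ht hs l)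
    rw [abs_le]
    constructor <;> linarith [e1.1, e1.2, e2.1, e2.2]
  have ba1 : ∀ j, i ≤ j → j < C.N → ∀ s ∈ Ioc σ σ', ∀ k, |P.a1 j s k - P'.a1 j s k| ≤ M * E := by
    intro j hij hj s hs k
    obtain ⟨-, -, -, -, -, b6, -⟩ := hcf j hj
    have hlk := C.lam_pos j k
    have h1 := hδM hlk ((hM j hj).lam k)
    have h2 := C.one_div_lam_le j k
    have h3 := C.tau_le_tauMax hj
    have h4 := C.one_div_mu1_pos j
    rw [tau_eq] at h3
    rw [hP.a1_eq j hij hj s (hsT hs), hP'.a1_eq j hij hj s (hsT hs)]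
    unfold DelayCoeff.eqA
    rw [hA.a0 j hij hj (s - 1 / C.lam j k) ⟨by linarith [hs.1], by linarith [hs.2]⟩,
      add_sub_add_left_eq_sub, ← Finset.sum_sub_distrib]
    refine (Finset.abs_sum_le_sum_abs _ _).trans ?_
    refine le_trans ?_ (mul_le_mul_of_nonneg_left (hEa j hij hj) hM0.le)
    rw [intervalIntegral.integral_finsetSum fun k _ => ia j hij hj k, Finset.mul_sum]
    refine (Finset.sum_le_sum fun q _ => ?_).trans (Finset.sum_le_sum_of_subset_of_nonneg
      (Finset.filter_subset _ _) fun q _ _ => mul_nonneg hM0.le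
        (intervalIntegral.integral_nonneg hσ fun _ _ => abs_nonneg _))
    exact abs_integral_delay_sub_le (x := fun r => P.a0 j r q) (y := fun r => P'.a0 j r q)
      ((b6 k q).1.comp (measurable_const.prodMk measurable_id)) (fun ν => (hM j hj).Gt k q 1 ν)
      ((hP.a0_integrable j hij hj q).mono_set hsub) ((hP'.a0_integrable j hij hj q).mono_set hsub)
      (fun r hr => by rw [hA.a0 j hij hj r hr]) (one_div_pos.2 hlk).le (by linarith [hs.1]) hWσ hs
  have ba0' : ∀ j, i ≤ j → j < C.N → ∀ s ∈ Ioc σ σ', ∀ p p' : Fin (C.n j) → ℝ,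
      (∀ k, |p k - p' k| ≤ M * (M * E)) → P.a0 j s = cf.eqA0 P j p s →
      P'.a0 j s = cf.eqA0 P' j p' s → ∀ k, |P.a0 j s k - P'.a0 j s k| ≤ c₀ * E := by
    intro j hij hj s hs p p' hp e e' k
    obtain ⟨-, -, b3, b4, b5, -⟩ := hcf j hj
    have ht := C.tau_le_tauMax hj
    have htp : 0 ≤ C.tauPrev j ∧ C.tauPrev j ≤ C.tauMax := by
      cases j with
      | zero => exact ⟨le_rfl, htm⟩
      | succ j => exact ⟨(C.tau_pos j).le, C.tau_le_tauMax (by omega)⟩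
    have e1 := abs_le.1 (dA j hij hj b3 (hM j hj).h1 (C.tau_pos j).le ht hs k)
    have e2 := abs_le.1 (dV (j + 1) (by omega) hj b4 (hM j hj).h2 (C.tau_pos j).le ht hs k)
    have e3 := abs_le.1 (dV j hij hj.le b5 (hM j hj).h3 htp.1 htp.2 hs k)
    have e4 := abs_le.1 (abs_mulVec_sub_le (by positivity) k ((hM j hj).Q k) (bv j hij hj s hs))
    have e5 := abs_le.1 (hp k)
    rw [e, e']
    unfold DelayCoeff.eqA0
    rw [abs_le, hc₀]
    constructor <;> nlinarith [e1.1, e1.2, e2.1, e2.2, e3.1, e3.2, e4.1, e4.2, e5.1, e5.2]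
  have ba0 : ∀ j, i ≤ j → j < C.N → ∀ s ∈ Ioc σ σ', ∀ k,
      |P.a0 j s k - P'.a0 j s k| ≤ c₀ * E := by
    intro j hij hj s hs
    rcases hij.eq_or_lt with rfl | hlt
    · exact ba0' i le_rfl hj s hs (V s) (V s) (fun k => by rw [sub_self, abs_zero]; positivity)
        (hP.a0_first s (hsT hs)) (hP'.a0_first s (hsT hs))
    · obtain ⟨j, rfl⟩ : ∃ j', j = j' + 1 := ⟨j - 1, by omega⟩
      have hij' : i ≤ j := by omega
      have hj' : j < C.N := by omega
      exact ba0' (j + 1) hij hj s hs _ _ (fun k => abs_mulVec_sub_le (by positivity) k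
        ((hM j hj').Qc k) (ba1 j hij' hj' s hs)) (hP.a0_next j hij' hj s (hsT hs))
        (hP'.a0_next j hij' hj s (hsT hs))
  have bv' : ∀ j, i ≤ j → j ≤ C.N → ∀ s ∈ Ioc σ σ', ∀ l,
      |P.v0 j s l - P'.v0 j s l| ≤ 2 * M * E := by
    intro j hij hj s hs l
    rcases hj.eq_or_lt with rfl | hlt
    · have hs' : s ∈ Icc (S - C.tauMax) T := ⟨by linarith [hs.1], hs.2.trans hT⟩
      rw [hP.v0_end s hs', hP'.v0_end s hs', sub_self, abs_zero]
      positivity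
    · exact bv j hij hlt s hs l
  have be : ∀ s ∈ Ioc σ σ', signalDist i P P' s ≤ c * E := by
    intro s hs
    rw [hc, add_mul, Finset.sum_mul, Finset.sum_mul]
    refine add_le_add (Finset.sum_le_sum fun j hj => ?_) (Finset.sum_le_sum fun j hj => ?_)
    · rw [Finset.sum_mul]
      obtain ⟨h1, h2⟩ := Finset.mem_Ico.1 hj
      exact Finset.sum_le_sum fun k _ => ba0 j h1 h2 s hs k
    · rw [Finset.sum_mul]
      obtain ⟨h1, h2⟩ := Finset.mem_Icc.1 hj
      exact Finset.sum_le_sum fun l _ => bv' j h1 h2 s hs l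
  have hEle : E ≤ (σ' - σ) * (c * E) := by
    have := intervalIntegral.integral_mono_on_of_le_Ioo hσ ie
      (intervalIntegrable_const (c := c * E)) fun r hr => be r (Ioo_subset_Ioc_self hr)
    rwa [intervalIntegral.integral_const, smul_eq_mul, ← hE] at this
  have hEz : E = 0 := by
    refine le_antisymm ?_ hE0
    have h1 : (σ' - σ) * (c * E) ≤ 1 / (c + M + 1) * (c * E) :=
      mul_le_mul_of_nonneg_right hδ (by positivity)
    have h2 : 0 < c + M + 1 := by positivity
    have h3 : E ≤ 1 / (c + M + 1) * (c * E) := hEle.trans h1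
    rw [one_div_mul_eq_div, le_div_iff₀ h2] at h3
    nlinarith
  have hzero : ∀ {x y b : ℝ}, |x - y| ≤ b * E → x = y := fun {x y b} h => by
    rw [hEz, mul_zero] at h
    exact sub_eq_zero.1 (abs_nonpos_iff.1 h)
  refine ⟨fun j hij hj s hs => ?_, fun j hij hj s hs => ?_, fun j hij hj s hs => ?_⟩
  · rcases le_or_gt s σ with h | h
    · exact hA.a0 j hij hj s ⟨hs.1, h⟩
    · exact funext fun k => hzero (ba0 j hij hj s ⟨h, hs.2⟩ k)
  · rcases le_or_gt s σ with h | h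
    · exact hA.a1 j hij hj s ⟨hs.1, h⟩
    · exact funext fun k => hzero (ba1 j hij hj s ⟨h, hs.2⟩ k)
  · rcases le_or_gt s σ with h | h
    · exact hA.v0 j hij hj s ⟨hs.1, h⟩
    · exact funext fun k => hzero (bv' j hij hj s ⟨h, hs.2⟩ k)

/-- The recursion determines the signals from their history. -/
theorem IsRecursion.agreeUpTo {cf : C.DelayCoeff} (hcf : cf.BddMeas) {i : ℕ}
    {V : ℝ → Fin (C.n i) → ℝ} {S T : ℝ} (hST : S ≤ T) {P P' : C.Signals}
    (hP : IsRecursion cf i V S T P) (hP' : IsRecursion cf i V S T P')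
    (h : AgreeUpTo i S S P P') : AgreeUpTo i S T P P' := by
  obtain ⟨δ, hδ, H⟩ := exists_step hcf i
  have key : ∀ n : ℕ, AgreeUpTo i S (min (S + n * δ) T) P P' := by
    intro n
    induction n with
    | zero => simpa [hST] using h
    | succ n ih =>
      have hn : (0 : ℝ) ≤ n * δ := by positivity
      refine H V S T P P' hP hP' _ _ (le_min (by linarith) hST) ?_ (min_le_right _ _) ?_ ih
      · push_cast
        exact min_le_min_right _ (by linarith)
      · push_cast
        rcases le_total (S + n * δ) T with h1 | h1
        · rw [min_eq_left h1]
          linarith [min_le_left (S + (n + 1) * δ) T]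
        · rw [min_eq_right h1]
          linarith [min_le_right (S + (n + 1) * δ) T]
  obtain ⟨n, hn⟩ := exists_nat_ge ((T - S) / δ)
  have := key n
  rwa [min_eq_right (by rw [div_le_iff₀ hδ] at hn; linarith)] at this

end HyperbolicChain

end

noncomputable section

namespace HyperbolicChain

variable {C : HyperbolicChain} {ker : C.Kernels} {cf : C.DelayCoeff}

lemma horizon_nonneg (C : HyperbolicChain) (i : ℕ) : 0 ≤ C.horizon i :=
  Finset.sum_nonneg fun k _ => (C.one_div_lam1_pos k).le

lemma tauMax_pos (C : HyperbolicChain) : 0 < C.tauMax :=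
  (C.tau_pos 0).trans_le (C.tau_le_tauMax C.N_pos)

lemma one_div_add_le_tauMax (C : HyperbolicChain) {j : ℕ} (hj : j < C.N) :
    1 / C.lam1 j + 1 / C.mu1 j ≤ C.tauMax := C.tau_le_tauMax hj

section

variable {U : ℝ → Fin (C.n 0) → ℝ} {w : C.State}

lemma integrableOn_target_shift (hker : ker.Solves) (hw : C.IsSolution U w) {j : ℕ} (hj : j < C.N)
    (k : Fin (C.n j)) {a b d : ℝ} (hab : a ≤ b) (had : 0 ≤ a + d) :
    IntegrableOn (fun s => ker.target w j (s + d) 0 (Sum.inl k)) (Icc a b) := by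
  have hT : 0 ≤ b + d := by linarith
  have h1 : BdMeas (fun s => (hw.trajectory hj hT).z ker (s + d) 0 (Sum.inl k)) :=
    (SubTrajectory.z_bdMeas hker hj (Sum.inl k)).comp₂
      (f := fun t x => (hw.trajectory hj hT).z ker t x (Sum.inl k)) (e := fun s => s + d)
      (by fun_prop) measurable_const
  refine IntegrableOn.congr_fun ((intervalIntegrable_iff_integrableOn_Icc_of_le hab).1
    (h1.intervalIntegrable a b)) (fun s hs => ?_) measurableSet_Icc
  rw [trajectory_z hw hj hT ⟨by linarith [hs.1], by linarith [hs.2]⟩ (by simp)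
    (by rw [zero_div]; linarith [hs.1])]

lemma integrableOn_vZero_shift (hw : C.IsSolution U w) {j : ℕ}
    (l : Fin (C.m j)) {a b d : ℝ} (hab : a ≤ b) (had : 0 ≤ a + d) :
    IntegrableOn (fun s => C.vZero w j (s + d) l) (Icc a b) := by
  by_cases hj : j < C.N
  · have hT : 0 ≤ b + d := by linarith
    have h1 := (hw.clamp_bdMeas hj hT (Sum.inr l)).comp (e := fun s : ℝ => (s + d, (0 : ℝ)))
      (by fun_prop)
    refine IntegrableOn.congr_fun ((intervalIntegrable_iff_integrableOn_Icc_of_le hab).1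
      (h1.intervalIntegrable a b)) (fun s hs => ?_) measurableSet_Icc
    simp only [vZero_of_lt w hj]
    rw [clamp_of_mem (t := (0 : ℝ)) (by simp),
      clamp_of_mem (t := s + d) ⟨by linarith [hs.1], by linarith [hs.2]⟩]
  · simp only [vZero_of_le w (not_lt.1 hj)]
    exact integrableOn_zero

lemma isRecursion_shift (hker : ker.Solves) (hw : C.IsSolution U w)
    (hrep : DelayRepresentation ker cf U w) {i : ℕ} (hi : i < C.N) {t : ℝ}
    (ht : C.tauMax + C.horizon i < t) :
    IsRecursion cf i (ker.virtualInput U w i) (t - C.horizon i) t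
      ((ker.signals w).shift (C.horizon i)) := by
  have hD := C.horizon_nonneg i
  have hM := C.tauMax_pos
  have hs' : ∀ {s}, s ∈ Ioc (t - C.horizon i) t → C.tauMax < s + C.horizon i := fun hs => by
    linarith [hs.1]
  refine ⟨fun j _ hj k => ?_, fun j _ _ l => ?_, fun s _ => ?_, fun s hs => ?_,
    fun j _ hj s hs => ?_, fun j _ hj s hs => ?_, fun j _ hj s hs => ?_⟩
  · exact integrableOn_target_shift hker hw hj k (by linarith) (by linarith)
  · exact integrableOn_vZero_shift hw l (by linarith) (by linarith)
  · exact vZero_of_le w le_rfl _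
  · rw [eqA0_shift]
    cases i with
    | zero =>
      have := hrep.a0_first _ (hs' hs)
      have h0 : C.horizon 0 = 0 := by simp [horizon]
      rw [h0, add_zero] at this ⊢
      change (ker.signals w).a0 0 (s + 0) = _
      rw [add_zero]
      exact this
    | succ i => exact hrep.a0_next i hi _ (hs' hs)
  · rw [eqA0_shift]
    exact hrep.a0_next j hj _ (hs' hs)
  · rw [eqA_shift]
    have := hrep.target j hj _ (hs' hs) 1 (by simp)
    funext k
    exact congrFun this (Sum.inl k)
  · rw [eqV0_shift]
    exact hrep.v0 j hj _ (hs' hs)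

end

lemma IsPrediction.isRecursion {i : ℕ} {w : C.State} {V : ℝ → Fin (C.n i) → ℝ} {t : ℝ}
    {P : C.Signals} (hP : IsPrediction ker cf i w V t P) :
    IsRecursion cf i V (t - C.horizon i) t P := by
  have e : t - C.horizon i - C.tauMax = t - C.tauMax - C.horizon i := by ring
  refine ⟨?_, ?_, ?_, hP.a0_first, hP.a0_next, hP.a1_eq, hP.v0_eq⟩
  · rw [e]; exact hP.a0_integrable
  · rw [e]
    intro j hij hj l
    rcases hj.eq_or_lt with rfl | hlt
    · exact (integrableOn_zero (μ := volume) (s := Icc (t - C.tauMax - C.horizon i) t)).congr_fun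
        (fun s hs => by simp [hP.v0_end s hs]) measurableSet_Icc
    · exact hP.v0_integrable j hij hlt l
  · rw [e]; exact hP.v0_end

section

variable {U : ℝ → Fin (C.n 0) → ℝ} {w : C.State} {i : ℕ} {t : ℝ}

/-- The future values of the signals form a prediction. -/
lemma isPrediction_shift (hker : ker.Solves) (hw : C.IsSolution U w)
    (hrep : DelayRepresentation ker cf U w) (hi : i < C.N) (ht : C.tauMax + C.horizon i < t) :
    IsPrediction ker cf i w (ker.virtualInput U w i) t
      ((ker.signals w).shift (C.horizon i)) := by
  have h := isRecursion_shift hker hw hrep hi ht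
  have e : t - C.horizon i - C.tauMax = t - C.tauMax - C.horizon i := by ring
  refine ⟨?_, ?_, ?_, fun _ _ _ _ _ => rfl, fun _ _ _ _ _ _ => rfl, fun _ _ _ _ _ => rfl,
    h.a0_first, h.a0_next, h.a1_eq, h.v0_eq⟩
  · rw [← e]; exact h.a0_integrable
  · rw [← e]; exact fun j hij hj => h.v0_integrable j hij hj.le
  · rw [← e]; exact h.v0_end

lemma IsPrediction.agreeUpTo (hker : ker.Solves) (hcf : cf.BddMeas) (hw : C.IsSolution U w)
    (hrep : DelayRepresentation ker cf U w) (hi : i < C.N) (ht : C.tauMax + C.horizon i < t)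
    {P : C.Signals} (hP : IsPrediction ker cf i w (ker.virtualInput U w i) t P) :
    AgreeUpTo i (t - C.horizon i) t P ((ker.signals w).shift (C.horizon i)) := by
  have hD := C.horizon_nonneg i
  have e : t - C.horizon i - C.tauMax = t - C.tauMax - C.horizon i := by ring
  have hQ := isPrediction_shift hker hw hrep hi ht
  refine hP.isRecursion.agreeUpTo hcf (by linarith) hQ.isRecursion ⟨?_, ?_, ?_⟩
  · rw [e]
    exact hP.a0_past
  · intro j hij hj s hs
    have h1 := C.one_div_add_le_tauMax hj
    have h2 := C.one_div_lam1_pos j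
    exact hP.a1_past j hij hj s ⟨by linarith [hs.1], hs.2⟩ (by linarith [hs.1])
  · rw [e]
    intro j hij hj s hs
    rcases hj.eq_or_lt with rfl | hlt
    · have hs' : s ∈ Icc (t - C.tauMax - C.horizon i) t := ⟨hs.1, by linarith [hs.2]⟩
      rw [hP.v0_end s hs', hQ.v0_end s hs']
    · exact hP.v0_past j hij hlt s hs

lemma IsPrediction.isExact (hker : ker.Solves) (hcf : cf.BddMeas) (hw : C.IsSolution U w)
    (hrep : DelayRepresentation ker cf U w) (hi : i < C.N) (ht : C.tauMax + C.horizon i < t)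
    {P : C.Signals} (hP : IsPrediction ker cf i w (ker.virtualInput U w i) t P) :
    IsExact ker i w t P := by
  have hA := hP.agreeUpTo hker hcf hw hrep hi ht
  intro j hij hj s hs
  have hs' : s ∈ Icc (t - C.horizon i - C.tauMax) t := ⟨by linarith [hs.1], hs.2⟩
  refine ⟨hA.a0 j hij hj s hs', fun hs1 => ?_, hA.v0 j hij hj.le s hs'⟩
  rcases le_or_gt s (t - C.horizon i) with h | h
  · exact hP.a1_past j hij hj s ⟨hs.1, h⟩ hs1
  · exact hA.a1 j hij hj s ⟨by linarith [C.one_div_mu1_pos j], hs.2⟩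

lemma IsPrediction.reconstruct_eq (hker : ker.Solves) (hcf : cf.BddMeas) (hw : C.IsSolution U w)
    (hrep : DelayRepresentation ker cf U w) (hi : i < C.N) (ht : C.tauMax + C.horizon i < t)
    {P : C.Signals} (hP : IsPrediction ker cf i w (ker.virtualInput U w i) t P) {j : ℕ}
    (hij : i ≤ j) (hj : j < C.N) {x : ℝ} (hx : x ∈ Icc (0 : ℝ) 1) :
    reconstructTarget ker cf P j t x = ker.target w j (t + C.horizon i) x ∧
      reconstructState ker cf P j t x = w j (t + C.horizon i) x := by
  have hA := hP.agreeUpTo hker hcf hw hrep hi ht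
  have hD := C.horizon_nonneg i
  have h1 := C.tau_le_tauMax hj
  have a0 : ∀ r ∈ Icc (t - C.tau j) t,
      P.a0 j r = ((ker.signals w).shift (C.horizon i)).a0 j r := fun r hr =>
    hA.a0 j hij hj r ⟨by linarith [hr.1], hr.2⟩
  have a1 : ∀ r ∈ Icc (t - 1 / C.mu1 j) t,
      P.a1 j r = ((ker.signals w).shift (C.horizon i)).a1 j r := fun r hr =>
    hA.a1 j hij hj r ⟨by linarith [hr.1], hr.2⟩
  have v0 : ∀ r ∈ Icc (t - C.tau j) t,
      P.v0 (j + 1) r = ((ker.signals w).shift (C.horizon i)).v0 (j + 1) r := fun r hr =>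
    hA.v0 (j + 1) (by omega) hj r ⟨by linarith [hr.1], hr.2⟩
  have hs : C.tauMax < t + C.horizon i := by linarith
  refine ⟨?_, ?_⟩
  · rw [reconstructTarget_congr ker cf a0 a1 v0 hx, reconstructTarget_shift,
      ← hrep.target j hj _ hs x hx]
  · rw [reconstructState_congr ker cf a0 a1 v0 hx, reconstructState_shift,
      hrep.state j hj _ hs x hx]
    have ht := fun y hy => hrep.target j hj _ hs y hy
    funext a
    unfold reconstructState DelayCoeff.inverse
    simp only [← ht x hx]
    congr 1
    refine intervalIntegral.integral_congr fun y hy => ?_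
    rw [uIcc_of_le hx.2] at hy
    rw [ht y ⟨hx.1.trans hy.1, hy.2⟩]

end

/-! ### The predictors -/

instance : Nonempty C.Signals := ⟨⟨0, 0, 0⟩⟩

/-- The boundary signals predicted at time `t`. -/
def predictedSignals (ker : C.Kernels) (cf : C.DelayCoeff) (i : ℕ) (w : C.State)
    (V : ℝ → Fin (C.n i) → ℝ) (t : ℝ) : C.Signals :=
  Classical.epsilon (IsPrediction ker cf i w V t)

open Classical in
/-- The predictor of the target states. -/
def targetPredictor (ker : C.Kernels) (cf : C.DelayCoeff) (i : ℕ) : C.Predictor i :=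
  fun w V j t x => if C.tauMax + C.horizon i < t then
    reconstructTarget ker cf (predictedSignals ker cf i w V t) j t x else 0

open Classical in
/-- The predictor of the states. -/
def statePredictor (ker : C.Kernels) (cf : C.DelayCoeff) (i : ℕ) : C.Predictor i :=
  fun w V j t x => if C.tauMax + C.horizon i < t then
    reconstructState ker cf (predictedSignals ker cf i w V t) j t x else 0

lemma IsPrediction.of_eqOn {i : ℕ} {t : ℝ} {w w' : C.State} {V V' : ℝ → Fin (C.n i) → ℝ}
    (ht : C.tauMax + C.horizon i < t)
    (hw : ∀ j, i ≤ j → j < C.N → ∀ s ∈ Icc 0 t, ∀ x ∈ Icc (0 : ℝ) 1, w j s x = w' j s x)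
    (hV : ∀ s ∈ Icc 0 t, V s = V' s) {P : C.Signals} (hP : IsPrediction ker cf i w V t P) :
    IsPrediction ker cf i w' V' t P := by
  have hD := C.horizon_nonneg i
  have hM := C.tauMax_pos
  have hv : ∀ j, i ≤ j → ∀ s ∈ Icc 0 t, C.vZero w j s = C.vZero w' j s := by
    intro j hij s hs
    by_cases hj : j < C.N
    · rw [vZero_of_lt w hj, vZero_of_lt w' hj, hw j hij hj s hs 0 (by simp)]
    · rw [vZero_of_le w (not_lt.1 hj), vZero_of_le w' (not_lt.1 hj)]
  have htar : ∀ j, i ≤ j → j < C.N → ∀ s ∈ Icc 0 t, ∀ x ∈ Icc (0 : ℝ) 1, x / C.lam1 j ≤ s → ∀ k,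
      ker.target w j s x (Sum.inl k) = ker.target w' j s x (Sum.inl k) := by
    intro j hij hj s hs x hx hxs k
    simp only [Kernels.target, Sum.elim_inl]
    rw [hw j hij hj s hs x hx]
    congr 1
    · congr 1
      refine intervalIntegral.integral_congr fun y hy => ?_
      rw [uIcc_of_le (div_nonneg hx.1 (C.lam1_pos j).le)] at hy
      rw [hv (j + 1) (by omega) (s - y) ⟨by linarith [hy.2], by linarith [hy.1, hs.2]⟩]
    · refine intervalIntegral.integral_congr fun y hy => ?_
      rw [uIcc_of_le hx.2] at hy
      rw [hw j hij hj s hs y ⟨hx.1.trans hy.1, hy.2⟩]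
  have hwin : ∀ {s}, s ∈ Icc (t - C.tauMax - C.horizon i) (t - C.horizon i) →
      s + C.horizon i ∈ Icc 0 t := fun hs => ⟨by linarith [hs.1], by linarith [hs.2]⟩
  refine ⟨hP.a0_integrable, hP.v0_integrable, hP.v0_end, fun j hij hj s hs => ?_,
    fun j hij hj s hs hs1 => ?_, fun j hij hj s hs => ?_, fun s hs => ?_, hP.a0_next, hP.a1_eq,
    hP.v0_eq⟩
  · rw [hP.a0_past j hij hj s hs]
    funext k
    exact htar j hij hj _ (hwin hs) 0 (by simp) (by rw [zero_div]; exact (hwin hs).1) k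
  · rw [hP.a1_past j hij hj s hs hs1]
    funext k
    exact htar j hij hj _ (hwin hs) 1 (by simp) hs1 k
  · rw [hP.v0_past j hij hj s hs]
    exact hv j hij _ (hwin hs)
  · rw [← hV s ⟨by linarith [hs.1], hs.2⟩]
    exact hP.a0_first s hs

lemma predictedSignals_congr {i : ℕ} {t : ℝ} {w w' : C.State} {V V' : ℝ → Fin (C.n i) → ℝ}
    (ht : C.tauMax + C.horizon i < t)
    (hw : ∀ j, i ≤ j → j < C.N → ∀ s ∈ Icc 0 t, ∀ x ∈ Icc (0 : ℝ) 1, w j s x = w' j s x)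
    (hV : ∀ s ∈ Icc 0 t, V s = V' s) :
    predictedSignals ker cf i w V t = predictedSignals ker cf i w' V' t := by
  unfold predictedSignals
  congr 1
  ext P
  exact ⟨fun h => h.of_eqOn ht hw hV, fun h => h.of_eqOn ht
    (fun j hij hj s hs x hx => (hw j hij hj s hs x hx).symm) fun s hs => (hV s hs).symm⟩

lemma causal_targetPredictor (ker : C.Kernels) (cf : C.DelayCoeff) (i : ℕ) :
    Causal i (targetPredictor ker cf i) := by
  intro t w w' V V' hw hV j _ _ x _
  unfold targetPredictor
  split_ifs with ht
  · rw [predictedSignals_congr ht hw hV]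
  · rfl

lemma causal_statePredictor (ker : C.Kernels) (cf : C.DelayCoeff) (i : ℕ) :
    Causal i (statePredictor ker cf i) := by
  intro t w w' V V' hw hV j _ _ x _
  unfold statePredictor
  split_ifs with ht
  · rw [predictedSignals_congr ht hw hV]
  · rfl

end HyperbolicChain

end

theorem mainTheorem5 (C : HyperbolicChain) (ker : C.Kernels) (hker : ker.Solves) :
    ∃ cf : C.DelayCoeff, cf.BddMeas ∧
      (∀ (U : ℝ → Fin (C.n 0) → ℝ) (w : C.State), C.IsSolution U w →
        HyperbolicChain.DelayRepresentation ker cf U w) ∧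
      ∀ i < C.N, ∃ Puv Pab : C.Predictor i,
        HyperbolicChain.Causal i Puv ∧ HyperbolicChain.Causal i Pab ∧
        ∀ (U : ℝ → Fin (C.n 0) → ℝ) (w : C.State), C.IsSolution U w →
        ∀ t : ℝ, C.tauMax + C.horizon i < t →
          (∃ P : C.Signals,
            HyperbolicChain.IsPrediction ker cf i w (ker.virtualInput U w i) t P) ∧
          (∀ P : C.Signals,
            HyperbolicChain.IsPrediction ker cf i w (ker.virtualInput U w i) t P →
              HyperbolicChain.IsExact ker i w t P ∧
              ∀ j, i ≤ j → j < C.N → ∀ x ∈ Set.Icc (0 : ℝ) 1,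
                Pab w (ker.virtualInput U w i) j t x =
                  HyperbolicChain.reconstructTarget ker cf P j t x ∧
                Puv w (ker.virtualInput U w i) j t x =
                  HyperbolicChain.reconstructState ker cf P j t x) ∧
          (∀ j, i ≤ j → j < C.N → ∀ x ∈ Set.Icc (0 : ℝ) 1,
            Puv w (ker.virtualInput U w i) j t x = w j (t + C.horizon i) x ∧
            Pab w (ker.virtualInput U w i) j t x = ker.target w j (t + C.horizon i) x) := by
  obtain ⟨cf, hcf, hrep⟩ := HyperbolicChain.exists_delayRepresentation hker
  refine ⟨cf, hcf, hrep, fun i hi => ⟨HyperbolicChain.statePredictor ker cf i,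
    HyperbolicChain.targetPredictor ker cf i, HyperbolicChain.causal_statePredictor ker cf i,
    HyperbolicChain.causal_targetPredictor ker cf i, fun U w hw t ht => ?_⟩⟩
  have hrw := hrep U w hw
  have hex : ∃ P, HyperbolicChain.IsPrediction ker cf i w (ker.virtualInput U w i) t P :=
    ⟨_, HyperbolicChain.isPrediction_shift hker hw hrw hi ht⟩
  have hpred : HyperbolicChain.IsPrediction ker cf i w (ker.virtualInput U w i) t
      (HyperbolicChain.predictedSignals ker cf i w (ker.virtualInput U w i) t) :=
    Classical.epsilon_spec hex
  have heq : ∀ j, i ≤ j → j < C.N → ∀ x ∈ Icc (0 : ℝ) 1,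
      HyperbolicChain.statePredictor ker cf i w (ker.virtualInput U w i) j t x =
        w j (t + C.horizon i) x ∧
      HyperbolicChain.targetPredictor ker cf i w (ker.virtualInput U w i) j t x =
        ker.target w j (t + C.horizon i) x := by
    intro j hij hj x hx
    have h := hpred.reconstruct_eq hker hcf hw hrw hi ht hij hj hx
    unfold HyperbolicChain.statePredictor HyperbolicChain.targetPredictor
    rw [if_pos ht, if_pos ht]
    exact ⟨h.2, h.1⟩
  refine ⟨hex, fun P hP => ⟨hP.isExact hker hcf hw hrw hi ht, fun j hij hj x hx => ?_⟩, heq⟩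
  obtain ⟨h1, h2⟩ := hP.reconstruct_eq hker hcf hw hrw hi ht hij hj hx
  rw [h1, h2]
  exact (heq j hij hj x hx).symm
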